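/- Let $(\Omega,\mathcal F,\mathbb P)$ be a probability space, $\Phi=(\Phi(t))_{t\in\mathbb R}$ a real-valued, jointly measurable, mean-square continuous, stationary Gaussian process whose covariance function has a spectral density $p:\mathbb R\to(0,\infty)$, $p\in L^1(\mathbb R)$: $$\mathrm{Cov}(\Phi(t),\Phi(0))=\int_{\mathbb R}e^{it\lambda}p(\lambda)\,d\lambda ,\qquad t\in\mathbb R .$$ Assume that there are $\gamma\in(0,2)$ and $C_1>0$ with $p(\lambda)\le C_1|\lambda|^{-(1+\gamma)}$ for all $\lambda\ne0$, and that either * (long-range dependence) there are $H\in(0,1)$ and a locally bounded function $L:(0,\infty)\to(0,\infty)$, slowly varying at infinity (that is, $L(cr)/L(r)\to1$ as $r\to\infty$ for every $c>0$), such that $p(\lambda)=L(|\lambda|^{-1})|\lambda|^{H-1}$ for all $\lambda\neq0$ in a neighbourhood of the origin, or * (short-range dependence) $p$ is bounded and continuous at the origin. Let $\psi\in L^1(\mathbb R)\cap L^2(\mathbb R)$ be complex-valued with Fourier transform $\widehat\psi(\omega)=\int_{\mathbb R}e^{-it\omega}\psi(t)\,dt$. Assume that $\psi$ is analytic, i.e.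 $\widehat\psi(\omega)=0$ for $\omega\le0$; that $\widehat\psi$ is three times differentiable on $(0,\infty)$ with $$\sup_{\lambda>1}|\lambda^{q}\widehat\psi(\lambda)|<\infty\ (q=1,2),\qquad \sup_{\lambda>0}|\lambda^{q}D\widehat\psi(\lambda)|<\infty\ (q=0,1,2),$$ $$\sup_{\lambda>0}|\lambda^{q}D^2\widehat\psi(\lambda)|<\infty\ (q=2,3),\qquad \sup_{\lambda>0}|\lambda^{3}D^3\widehat\psi(\lambda)|<\infty ;$$ and that $|\widehat\psi|$ is unimodal on $(0,\infty)$, i.e. non-decreasing on $(0,m]$ and non-increasing on $[m,\infty)$ for some $m>0$. Let $$W_\Phi(t,s)=\int_{\mathbb R}\Phi(\tau)\,\frac1s\,\overline{\psi\Big(\frac{\tau-t}{s}\Big)}\,d\tau ,\qquad t\in\mathbb R,\ s>0,$$ be the analytic wavelet transform of $\Phi$, computed along the sample paths. Let $0<a\le b<\infty$ and let $w:[a,b]\to[0,\infty)$ be (bounded and) continuous. Then, almost surely, for every $s\in[a,b]$ the integral defining $W_\Phi(0,s)$ converges absolutely and $\partial_sW_\Phi(0,s)$ exists. Moreover, in each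 of the two cases $$M=\max_{s\in[a,b]}w(s)\,|W_\Phi(0,s)|,\qquad \sigma=\max_{s\in[a,b]}w(s)\Big(\int_0^\infty|\widehat\psi(s\lambda)|^2p(\lambda)\,d\lambda\Big)^{1/2},$$ and $$M=\max_{s\in[a,b]}w(s)\,\Big|\frac{\partial W_\Phi}{\partial s}(0,s)\Big|,\qquad \sigma=\max_{s\in[a,b]}w(s)\Big(\int_0^\infty|\lambda\,[D\widehat\psi](s\lambda)|^2p(\lambda)\,d\lambda\Big)^{1/2},$$ the maximum $M$ exists almost surely, the integrals and the maximum defining $\sigma$ exist and are finite, $\mathbb E[M]<\infty$, and $$\mathbb P(M\ge u)\le\exp\Big(-\frac{(u-\mathbb E[M])^2}{\sigma^2}\Big)\qquad\text{for all }u\ge\mathbb E[M],$$ where, if $\sigma=0$, the right-hand side is read as $0$ for $u>\mathbb E[M]$ and as $1$ for $u=\mathbb E[M]$. -/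

import Mathlib

open MeasureTheory ProbabilityTheory Filter Topology Set

noncomputable section

namespace AWT

/-- The Fourier transform `ψ̂(ω) = ∫ e^{-itω} ψ(t) dt`, without the factor `2π`. -/
def fourierHat (ψ : ℝ → ℂ) (ω : ℝ) : ℂ :=
  ∫ t : ℝ, Complex.exp (-(Complex.I * t * ω)) * ψ t

/-- The integrand `τ ↦ f(τ) (1/s) conj ψ((τ - t)/s)` of the wavelet transform. -/
def integrand (ψ f : ℝ → ℂ) (t s τ : ℝ) : ℂ :=
  f τ * ((1 / s : ℝ) : ℂ) * (starRingEnd ℂ) (ψ ((τ - t) / s))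

/-- The wavelet transform `W_f(t, s) = ∫ f(τ) (1/s) conj ψ((τ - t)/s) dτ`. -/
def transform (ψ f : ℝ → ℂ) (t s : ℝ) : ℂ :=
  ∫ τ : ℝ, integrand ψ f t s τ

/-- The sample path `τ ↦ Φ(τ, ω)` of a real process, as a complex-valued function. -/
def path {Ω : Type*} (Φ : ℝ → Ω → ℝ) (ω : Ω) (τ : ℝ) : ℂ := (Φ τ ω : ℂ)

/-- The wavelet transform `W_Φ(t, s)` of a random process, taken along its sample paths. -/
def W {Ω : Type*} (ψ : ℝ → ℂ) (Φ : ℝ → Ω → ℝ) (t s : ℝ) (ω : Ω) : ℂ :=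
  transform ψ (path Φ ω) t s

/-- The partial derivative `∂W_Φ/∂s (t, s)` in the scale variable. -/
def dW {Ω : Type*} (ψ : ℝ → ℂ) (Φ : ℝ → Ω → ℝ) (t s : ℝ) (ω : Ω) : ℂ :=
  deriv (fun r : ℝ => W ψ Φ t r ω) s

/-- The noise: a (jointly measurable) real stationary Gaussian process, mean-square continuous,
whose covariance function has the everywhere positive spectral density `p`. -/
structure IsStationaryGaussianNoise {Ω : Type*} [MeasurableSpace Ω] (P : Measure Ω)
    (Φ : ℝ → Ω → ℝ) (p : ℝ → ℝ) : Prop where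
  measurable : Measurable (Function.uncurry Φ)
  gaussian : IsGaussianProcess Φ P
  stationary : ∀ (h : ℝ) (n : ℕ) (t : Fin n → ℝ),
    P.map (fun ω i => Φ (t i + h) ω) = P.map (fun ω i => Φ (t i) ω)
  meanSquareContinuous : ∀ t : ℝ,
    Tendsto (fun r : ℝ => ∫ ω, (Φ r ω - Φ t ω) ^ 2 ∂P) (𝓝 t) (𝓝 0)
  density_pos : ∀ l : ℝ, 0 < p l
  density_integrable : Integrable p
  covariance_eq : ∀ t : ℝ,
    ((covariance (Φ t) (Φ 0) P : ℝ) : ℂ) =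
      ∫ l : ℝ, Complex.exp (Complex.I * t * l) * ((p l : ℝ) : ℂ)

/-- `L : (0,∞) → (0,∞)` is locally bounded and slowly varying at infinity. -/
structure IsSlowlyVarying (L : ℝ → ℝ) : Prop where
  pos : ∀ r : ℝ, 0 < r → 0 < L r
  locallyBounded : ∀ K : Set ℝ, IsCompact K → K ⊆ Ioi 0 → BddAbove (L '' K)
  ratio : ∀ c : ℝ, 0 < c → Tendsto (fun r => L (c * r) / L r) atTop (𝓝 1)

/-- Decay of the spectral density at infinity, and its behaviour near the origin in the
long-range dependent or in the short-range dependent scenario. -/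
structure SpectralDensityCondition (p : ℝ → ℝ) : Prop where
  decay : ∃ γ C : ℝ, 0 < γ ∧ γ < 2 ∧ 0 < C ∧ ∀ l : ℝ, l ≠ 0 → p l ≤ C * |l| ^ (-(1 + γ))
  origin :
    (∃ (H : ℝ) (L : ℝ → ℝ), 0 < H ∧ H < 1 ∧ IsSlowlyVarying L ∧
      ∀ᶠ l in 𝓝[≠] (0 : ℝ), p l = L (|l|⁻¹) * |l| ^ (H - 1)) ∨
    ((∃ C : ℝ, ∀ l : ℝ, p l ≤ C) ∧ ContinuousAt p 0)

/-- `ψ ∈ L¹ ∩ L²` and `ψ̂` vanishes on `(-∞, 0]`. -/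
structure IsAnalyticWavelet (ψ : ℝ → ℂ) : Prop where
  integrable : Integrable ψ
  memLp_two : MemLp ψ 2
  analytic : ∀ ω : ℝ, ω ≤ 0 → fourierHat ψ ω = 0

/-- `f` is three times differentiable on `(0,∞)`, with the weighted bounds `D⁰₁-D⁰₂`, `D¹₀-D¹₂`,
`D²₂-D²₃`, `D³₃`, and `|f|` is unimodal on `(0,∞)`. (Used for `f = ψ̂`.) -/
structure FourierSideRegularity (f : ℝ → ℂ) : Prop where
  differentiable : ∀ k : ℕ, k < 3 → DifferentiableOn ℝ (iteratedDeriv k f) (Ioi 0)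
  bound_zero : ∀ q : ℕ, 1 ≤ q → q ≤ 2 → ∃ C : ℝ, ∀ l : ℝ, 1 < l → l ^ q * ‖f l‖ ≤ C
  bound_one : ∀ q : ℕ, q ≤ 2 → ∃ C : ℝ, ∀ l : ℝ, 0 < l → l ^ q * ‖deriv f l‖ ≤ C
  bound_two : ∀ q : ℕ, 2 ≤ q → q ≤ 3 →
    ∃ C : ℝ, ∀ l : ℝ, 0 < l → l ^ q * ‖iteratedDeriv 2 f l‖ ≤ C
  bound_three : ∃ C : ℝ, ∀ l : ℝ, 0 < l → l ^ 3 * ‖iteratedDeriv 3 f l‖ ≤ C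
  unimodal : ∃ m : ℝ, 0 < m ∧
    MonotoneOn (fun l => ‖f l‖) (Ioc 0 m) ∧ AntitoneOn (fun l => ‖f l‖) (Ici m)

/-- `∫₀^∞ |ψ̂(sλ)|² p(λ) dλ`. -/
def spectralEnergy (ψ : ℝ → ℂ) (p : ℝ → ℝ) (s : ℝ) : ℝ :=
  ∫ l in Ioi (0 : ℝ), ‖fourierHat ψ (s * l)‖ ^ 2 * p l

/-- `∫₀^∞ |λ [Dψ̂](sλ)|² p(λ) dλ`. -/
def spectralEnergyDeriv (ψ : ℝ → ℂ) (p : ℝ → ℝ) (s : ℝ) : ℝ :=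
  ∫ l in Ioi (0 : ℝ), ‖(l : ℂ) * deriv (fourierHat ψ) (s * l)‖ ^ 2 * p l

/-- The random variable `max_{s ∈ [a,b]} w(s) |V(s)|`. -/
def weightedMax {Ω : Type*} (a b : ℝ) (w : ℝ → ℝ) (V : ℝ → Ω → ℂ) (ω : Ω) : ℝ :=
  sSup ((fun s => w s * ‖V s ω‖) '' Icc a b)

/-- The maximal weighted standard deviation `max_{s ∈ [a,b]} w(s) v(s)^{1/2}`. -/
def weightedSigma (a b : ℝ) (w v : ℝ → ℝ) : ℝ :=
  sSup ((fun s => w s * Real.sqrt (v s)) '' Icc a b)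

/-- The maxima `M = max_{[a,b]} w |V|` (almost surely) and `σ = max_{[a,b]} w √v` exist,
`E[M] < ∞`, and `P(M ≥ u) ≤ exp(-(u - E[M])²/σ²)` for all `u ≥ E[M]`. Since Lean divides by zero
to zero, the reading `P(M ≥ u) = 0` for `u > E[M]` in the case `σ = 0` is stated separately. -/
structure BorellTIS {Ω : Type*} [MeasurableSpace Ω] (P : Measure Ω) (a b : ℝ) (w : ℝ → ℝ)
    (V : ℝ → Ω → ℂ) (v : ℝ → ℝ) : Prop where
  max_attained : ∀ᵐ ω ∂P,
    IsGreatest ((fun s => w s * ‖V s ω‖) '' Icc a b) (weightedMax a b w V ω)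
  sigma_attained :
    IsGreatest ((fun s => w s * Real.sqrt (v s)) '' Icc a b) (weightedSigma a b w v)
  integrable : Integrable (weightedMax a b w V) P
  tail : ∀ u : ℝ, ∫ ω, weightedMax a b w V ω ∂P ≤ u →
    P.real {ω | u ≤ weightedMax a b w V ω} ≤
      Real.exp (-(u - ∫ ω, weightedMax a b w V ω ∂P) ^ 2 / weightedSigma a b w v ^ 2)
  tail_degenerate : weightedSigma a b w v = 0 →
    ∀ u : ℝ, ∫ ω, weightedMax a b w V ω ∂P < u →
      P.real {ω | u ≤ weightedMax a b w V ω} = 0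

end AWT

end

/-! The tail bound is Gaussian concentration, with a factor 2 in the exponent gained from
circularity. If the transform `kernelHat κ` of an integrable kernel κ vanishes on (-∞,0], then Y = ∫
Φ κ has mean 0 because ∫ κ = 0. Moreover E[Y²] is the integral of p(l) κ̂(l) κ̂(-l), hence 0, while
E|Y|² is the integral of |κ̂|² p over (0,∞). So every projection α Re Y + β Im Y with α² + β² = 1
has variance E|Y|²/2 (`variance_integral`). The modulus |Y| is the maximum of these projections, so
M is a supremum of real Gaussian variables of variance at most σ²/2. Concentration then gives E
exp(l(M - E M)) ≤ exp(l²σ²/4), and Chernoff's bound with l = 2(u - E M)/σ² gives the stated tail.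

The sharp Laplace bound for a Lipschitz function F of a standard Gaussian vector
(`lintegral_exp_le_of_lipschitz_pi_gaussianReal`) follows from the Prékopa–Leindler inequality.
Strong log-concavity of the Gaussian density gains a factor exp(-t(1-t)|x-y|²/2), which pays for the
Lipschitz increment of F. Jensen's inequality and t → 0 finish the argument. General Gaussian
vectors are affine images of standard ones, and `borellTIS_of_continuous` passes from finitely many
scales to [a,b] along a dense sequence.

Joint Gaussianity of the integrals holds because each of them lies in the closed linear span of the
noise in L², and Gaussian laws form a closed set there.

It remains to dominate the kernels by integrable functions, uniformly for scales in a compact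
interval. Put f = ψ̂. Fourier inversion and one integration by parts write the kernel as the
conjugate of (2π)⁻¹ (i/τ) ∫₀^∞ exp(iτx/s) f'(x) dx. Its scale derivative has the same shape, up to a
factor 1/s, with f' replaced by g = (x f')'. The function g has integral zero, is O(x^(-1/2)) at the
origin by a Landau interpolation (`two_sqrt`), and decays like x⁻². Its half-line Fourier integral
is therefore O(|t|^(1/2)) and O(|t|^(-1/3)), and the differentiated kernel is O(|τ|^(-1/2)) near 0
and O(|τ|^(-4/3)) at infinity. The kernel itself is then controlled by the mean value inequality in
s. -/

open MeasureTheory ProbabilityTheory Filter Topology Set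
open scoped ENNReal NNReal

noncomputable section

namespace AWT

/-! ### The Prékopa–Leindler inequality and its Gaussian form -/

open scoped Pointwise in
/-- The Brunn–Minkowski inequality on the line, for compact sets. -/
lemma volume_brunnMinkowski_compact {t : ℝ} (ht0 : 0 < t) (ht1 : t < 1) {K L C : Set ℝ}
    (hK : IsCompact K) (hL : IsCompact L) (hKne : K.Nonempty) (hLne : L.Nonempty)
    (hsub : ∀ x ∈ K, ∀ y ∈ L, (1 - t) * x + t * y ∈ C) :
    ENNReal.ofReal (1 - t) * volume K + ENNReal.ofReal t * volume L ≤ volume C := by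
  -- With k = max K and l = min L, the sets (1-t)K + tl and (1-t)k + tL lie in C on opposite sides
  -- of their common point p = (1-t)k + tl, so their lengths add up.
  obtain ⟨k, hkK, hk⟩ := hK.exists_isGreatest hKne
  obtain ⟨l, hlL, hl⟩ := hL.exists_isLeast hLne
  have h1t : 0 < 1 - t := by linarith
  set p := (1 - t) * k + t * l with hp
  set X : Set ℝ := (fun x => t * l + x) '' ((1 - t) • K) with hX
  set Y : Set ℝ := (fun x => (1 - t) * k + x) '' (t • L) with hY
  have hvX : volume X = ENNReal.ofReal (1 - t) * volume K := by
    rw [hX, image_add_left, measure_preimage_add, Measure.addHaar_smul]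
    simp [abs_of_pos h1t]
  have hvY : volume Y = ENNReal.ofReal t * volume L := by
    rw [hY, image_add_left, measure_preimage_add, Measure.addHaar_smul]
    simp [abs_of_pos ht0]
  have hXs : X \ {p} ⊆ C \ Ici p := by
    rintro _ ⟨⟨_, ⟨x, hx, rfl⟩, rfl⟩, hne⟩
    simp only [smul_eq_mul, mem_singleton_iff] at hne ⊢
    refine ⟨by simpa [add_comm] using hsub x hx l hlL, ?_⟩
    simp only [mem_Ici, not_le]
    refine lt_of_le_of_ne ?_ hne
    have := mul_le_mul_of_nonneg_left (hk hx) h1t.le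
    rw [hp]; linarith
  have hYs : Y ⊆ C ∩ Ici p := by
    rintro _ ⟨_, ⟨y, hy, rfl⟩, rfl⟩
    simp only [smul_eq_mul]
    refine ⟨hsub k hkK y hy, ?_⟩
    have := mul_le_mul_of_nonneg_left (hl hy) ht0.le
    simp only [mem_Ici, hp]; linarith
  rw [← hvX, ← hvY, ← measure_inter_add_sdiff C (measurableSet_Ici (a := p)), add_comm]
  refine add_le_add (measure_mono hYs) ?_
  calc volume X = volume (X \ {p}) := (measure_sdiff_null (measure_singleton p)).symm
    _ ≤ _ := measure_mono hXs

/-- The Brunn–Minkowski inequality on the line. -/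
lemma volume_brunnMinkowski {t : ℝ} (ht0 : 0 < t) (ht1 : t < 1) {A B C : Set ℝ}
    (hA : MeasurableSet A) (hB : MeasurableSet B) (hAne : A.Nonempty) (hBne : B.Nonempty)
    (hsub : ∀ x ∈ A, ∀ y ∈ B, (1 - t) * x + t * y ∈ C) :
    ENNReal.ofReal (1 - t) * volume A + ENNReal.ofReal t * volume B ≤ volume C := by
  obtain ⟨x₀, hx₀⟩ := hAne
  obtain ⟨y₀, hy₀⟩ := hBne
  have key : ∀ K ⊆ A, IsCompact K → ∀ L ⊆ B, IsCompact L →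
      ENNReal.ofReal (1 - t) * volume K + ENNReal.ofReal t * volume L ≤ volume C := by
    intro K hKA hK L hLB hL
    -- Inner regularity also ranges over the empty set; adjoining a fixed point of A or B keeps the
    -- compact sets nonempty.
    calc _ ≤ ENNReal.ofReal (1 - t) * volume (insert x₀ K)
          + ENNReal.ofReal t * volume (insert y₀ L) := by gcongr <;> exact subset_insert _ _
      _ ≤ _ := by
        refine volume_brunnMinkowski_compact ht0 ht1 (hK.insert _) (hL.insert _)
          (insert_nonempty _ _) (insert_nonempty _ _) ?_
        intro x hx y hy
        exact hsub x (insert_subset hx₀ hKA hx) y (insert_subset hy₀ hLB hy)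
  rw [hA.measure_eq_iSup_isCompact, hB.measure_eq_iSup_isCompact]
  simp only [ENNReal.mul_iSup, iSup_and']
  exact ENNReal.biSup_add_biSup_le' ⟨∅, empty_subset _, isCompact_empty⟩
    ⟨∅, empty_subset _, isCompact_empty⟩ fun K hK L hL => key K hK.1 hK.2 L hL.1 hL.2

lemma lintegral_eq_lintegral_measure_ofReal_lt {f : ℝ → ℝ≥0∞} (hf : Measurable f)
    (hfin : ∀ x, f x ≠ ∞) :
    ∫⁻ x, f x = ∫⁻ r in Ioi (0 : ℝ), volume {x | ENNReal.ofReal r < f x} := by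
  have h := lintegral_eq_lintegral_meas_lt volume (f := fun x => (f x).toReal)
    (Eventually.of_forall fun x => ENNReal.toReal_nonneg) hf.ennreal_toReal.aemeasurable
  simp only [ENNReal.ofReal_toReal (hfin _)] at h
  rw [h]
  refine setLIntegral_congr_fun measurableSet_Ioi fun r hr => ?_
  simp only [ENNReal.ofReal_lt_iff_lt_toReal (le_of_lt hr) (hfin _)]

/-- The Prékopa–Leindler inequality on the line, in its arithmetic form for functions with
supremum `1`. -/
lemma lintegral_prekopaLeindler_of_iSup_eq_one {t : ℝ} (ht0 : 0 < t) (ht1 : t < 1)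
    {f g h : ℝ → ℝ≥0∞} (hf : Measurable f) (hg : Measurable g) (hh : Measurable h)
    (hfs : ⨆ x, f x = 1) (hgs : ⨆ x, g x = 1)
    (H : ∀ x y, f x ^ (1 - t) * g y ^ t ≤ h ((1 - t) * x + t * y)) :
    ENNReal.ofReal (1 - t) * (∫⁻ x, f x) + ENNReal.ofReal t * (∫⁻ x, g x) ≤ ∫⁻ x, h x := by
  have h1t : 0 < 1 - t := by linarith
  have hf1 : ∀ x, f x ≤ 1 := fun x => hfs ▸ le_iSup f x
  have hg1 : ∀ x, g x ≤ 1 := fun x => hgs ▸ le_iSup g x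
  have hmf : Measurable fun r : ℝ => volume {x | ENNReal.ofReal r < f x} :=
    Antitone.measurable fun r s hrs => measure_mono fun x (hx : _ < _) =>
      lt_of_le_of_lt (ENNReal.ofReal_le_ofReal hrs) hx
  have hmg : Measurable fun r : ℝ => volume {x | ENNReal.ofReal r < g x} :=
    Antitone.measurable fun r s hrs => measure_mono fun x (hx : _ < _) =>
      lt_of_le_of_lt (ENNReal.ofReal_le_ofReal hrs) hx
  -- Truncation makes h finite, as the layer-cake formula requires, and does not affect levels below
  -- 1.
  calc _ ≤ ∫⁻ x, min (h x) 1 := by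
        rw [lintegral_eq_lintegral_measure_ofReal_lt hf
            fun x => ne_top_of_le_ne_top ENNReal.one_ne_top (hf1 x),
          lintegral_eq_lintegral_measure_ofReal_lt hg
            fun x => ne_top_of_le_ne_top ENNReal.one_ne_top (hg1 x),
          lintegral_eq_lintegral_measure_ofReal_lt (hh.min measurable_const)
            fun x => ne_top_of_le_ne_top ENNReal.one_ne_top (min_le_right _ _),
          ← lintegral_const_mul _ hmf, ← lintegral_const_mul _ hmg,
          ← lintegral_add_left (hmf.const_mul _)]
        -- Brunn–Minkowski is applied at each level r < 1, where the superlevel sets are nonempty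
        -- because both suprema equal 1. From r = 1 on, those of f and g are empty.
        refine setLIntegral_mono' measurableSet_Ioi fun r hr => ?_
        rcases lt_or_ge r 1 with hr1 | hr1
        · have hr1' : ENNReal.ofReal r < 1 := by simpa using hr1
          have hne : ∀ u : ℝ → ℝ≥0∞, ⨆ x, u x = 1 → {x | ENNReal.ofReal r < u x}.Nonempty := by
            intro u hu
            obtain ⟨x, hx⟩ := lt_iSup_iff.1 (hu ▸ hr1' : ENNReal.ofReal r < ⨆ x, u x)
            exact ⟨x, hx⟩
          refine volume_brunnMinkowski ht0 ht1 (measurableSet_lt measurable_const hf)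
            (measurableSet_lt measurable_const hg) (hne f hfs) (hne g hgs) fun x hx y hy => ?_
          rw [mem_ofPred_eq] at hx hy ⊢
          refine lt_min (lt_of_lt_of_le ?_ (H x y)) hr1'
          have h0 : ENNReal.ofReal r ≠ 0 := by simpa using hr
          calc ENNReal.ofReal r = ENNReal.ofReal r ^ (1 - t) * ENNReal.ofReal r ^ t := by
                rw [← ENNReal.rpow_add _ _ h0 ENNReal.ofReal_ne_top]; simp
            _ < _ := ENNReal.mul_lt_mul (ENNReal.rpow_lt_rpow hx h1t)
                (ENNReal.rpow_lt_rpow hy ht0)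
        · have : ∀ u : ℝ → ℝ≥0∞, (∀ x, u x ≤ 1) → {x | ENNReal.ofReal r < u x} = ∅ := by
            intro u hu
            ext x
            simp only [mem_ofPred_eq, mem_empty_iff_false, iff_false, not_lt]
            exact (hu x).trans (by simpa using hr1)
          rw [this f hf1, this g hg1]
          simp
    _ ≤ _ := lintegral_mono fun x => min_le_left _ _

lemma ennreal_geom_mean_le_arith_mean {t : ℝ} (ht0 : 0 < t) (ht1 : t < 1) (a b : ℝ≥0∞) :
    a ^ (1 - t) * b ^ t ≤ ENNReal.ofReal (1 - t) * a + ENNReal.ofReal t * b := by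
  have h1t : 0 < 1 - t := by linarith
  induction a with
  | top =>
    rw [ENNReal.mul_top (ENNReal.ofReal_pos.2 h1t).ne', top_add]
    exact le_top
  | coe a =>
    induction b with
    | top =>
      rw [ENNReal.mul_top (ENNReal.ofReal_pos.2 ht0).ne', add_top]
      exact le_top
    | coe b =>
      have := NNReal.geom_mean_le_arith_mean2_weighted (1 - t).toNNReal t.toNNReal a b (by
        rw [← Real.toNNReal_add h1t.le ht0.le]; simp)
      rw [Real.coe_toNNReal _ h1t.le, Real.coe_toNNReal _ ht0.le] at this
      rw [← ENNReal.coe_rpow_of_nonneg _ h1t.le, ← ENNReal.coe_rpow_of_nonneg _ ht0.le,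
        ENNReal.ofReal, ENNReal.ofReal]
      exact_mod_cast this

/-- The Prékopa–Leindler inequality on the line, for bounded functions. -/
lemma lintegral_prekopaLeindler_of_bounded {t : ℝ} (ht0 : 0 < t) (ht1 : t < 1)
    {f g h : ℝ → ℝ≥0∞} (hf : Measurable f) (hg : Measurable g) (hh : Measurable h)
    (hfs : ⨆ x, f x ≠ ∞) (hgs : ⨆ x, g x ≠ ∞)
    (H : ∀ x y, f x ^ (1 - t) * g y ^ t ≤ h ((1 - t) * x + t * y)) :
    (∫⁻ x, f x) ^ (1 - t) * (∫⁻ x, g x) ^ t ≤ ∫⁻ x, h x := by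
  have h1t : 0 < 1 - t := by linarith
  set α := ⨆ x, f x with hα
  set β := ⨆ x, g x with hβ
  rcases eq_or_ne α 0 with h0 | hα0
  · have : ∀ x, f x = 0 := fun x => le_antisymm (h0 ▸ le_iSup f x) bot_le
    simp [this, h1t]
  rcases eq_or_ne β 0 with h0 | hβ0
  · have : ∀ x, g x = 0 := fun x => le_antisymm (h0 ▸ le_iSup g x) bot_le
    simp [this, ht0]
  have hc0 : α ^ (1 - t) * β ^ t ≠ 0 := by
    simp [hα0, hβ0, hfs, hgs]
  have hct : α ^ (1 - t) * β ^ t ≠ ∞ :=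
    ENNReal.mul_ne_top (ENNReal.rpow_ne_top_of_nonneg h1t.le hfs)
      (ENNReal.rpow_ne_top_of_nonneg ht0.le hgs)
  have hsplit : ∀ u v : ℝ≥0∞, (α⁻¹ * u) ^ (1 - t) * (β⁻¹ * v) ^ t =
      (α ^ (1 - t) * β ^ t)⁻¹ * (u ^ (1 - t) * v ^ t) := by
    intro u v
    rw [ENNReal.mul_rpow_of_nonneg _ _ h1t.le, ENNReal.mul_rpow_of_nonneg _ _ ht0.le,
      ENNReal.inv_rpow, ENNReal.inv_rpow, ENNReal.mul_inv (Or.inr (by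
        exact ENNReal.rpow_ne_top_of_nonneg ht0.le hgs)) (Or.inl (by
        exact ENNReal.rpow_ne_top_of_nonneg h1t.le hfs))]
    ring
  -- The geometric form is homogeneous, so f and g may be divided by their suprema; the weighted
  -- arithmetic–geometric inequality then weakens the arithmetic conclusion to the geometric one.
  have key := lintegral_prekopaLeindler_of_iSup_eq_one ht0 ht1 (hf.const_mul α⁻¹)
    (hg.const_mul β⁻¹) (hh.const_mul (α ^ (1 - t) * β ^ t)⁻¹)
    (by rw [← ENNReal.mul_iSup, ← hα, ENNReal.inv_mul_cancel hα0 hfs])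
    (by rw [← ENNReal.mul_iSup, ← hβ, ENNReal.inv_mul_cancel hβ0 hgs])
    (fun x y => by rw [hsplit]; gcongr; exact H x y)
  have := (ennreal_geom_mean_le_arith_mean ht0 ht1 _ _).trans key
  rw [lintegral_const_mul _ hf, lintegral_const_mul _ hg, lintegral_const_mul _ hh, hsplit] at this
  exact (ENNReal.mul_le_mul_iff_right (ENNReal.inv_ne_zero.2 hct) (ENNReal.inv_ne_top.2 hc0)).1 this

/-- The Prékopa–Leindler inequality on the line. -/
lemma lintegral_prekopaLeindler {t : ℝ} (ht0 : 0 < t) (ht1 : t < 1)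
    {f g h : ℝ → ℝ≥0∞} (hf : Measurable f) (hg : Measurable g) (hh : Measurable h)
    (H : ∀ x y, f x ^ (1 - t) * g y ^ t ≤ h ((1 - t) * x + t * y)) :
    (∫⁻ x, f x) ^ (1 - t) * (∫⁻ x, g x) ^ t ≤ ∫⁻ x, h x := by
  have h1t : 0 < 1 - t := by linarith
  have hsup : ∀ u : ℝ → ℝ≥0∞, Measurable u →
      ∫⁻ x, u x = ⨆ N : ℕ, ∫⁻ x, min (u x) N := by
    intro u hu
    rw [← lintegral_iSup (fun N => hu.min measurable_const)
      (fun N M hNM x => min_le_min_left _ (by exact_mod_cast hNM))]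
    refine lintegral_congr fun x => ?_
    rw [← inf_iSup_eq, ENNReal.iSup_natCast, inf_top_eq]
  have hb : ∀ (u : ℝ → ℝ≥0∞) (N : ℕ), ⨆ x, min (u x) N ≠ ∞ := fun u N =>
    ne_top_of_le_ne_top (ENNReal.natCast_ne_top N) (iSup_le fun x => min_le_right _ _)
  have hpow : ∀ (r : ℝ) (hr : 0 < r) (u : ℕ → ℝ≥0∞), (⨆ N, u N) ^ r = ⨆ N, u N ^ r :=
    fun r hr u => (ENNReal.orderIsoRpow r hr).map_iSup u
  rw [hsup f hf, hsup g hg, hpow _ h1t, hpow _ ht0, ENNReal.iSup_mul]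
  refine iSup_le fun N => ?_
  rw [ENNReal.mul_iSup]
  refine iSup_le fun M => ?_
  refine lintegral_prekopaLeindler_of_bounded ht0 ht1 (hf.min measurable_const)
    (hg.min measurable_const) hh (hb f N) (hb g M) fun x y => le_trans ?_ (H x y)
  gcongr <;> exact min_le_left _ _

/-- The identity (1-t)x² + ty² = ((1-t)x + ty)² + t(1-t)(x-y)² produces exactly the quadratic factor
when the three functions are multiplied by the Gaussian density. -/
lemma lintegral_gaussianReal_prekopaLeindler {t : ℝ} (ht0 : 0 < t) (ht1 : t < 1)
    {f g h : ℝ → ℝ≥0∞} (hf : Measurable f) (hg : Measurable g) (hh : Measurable h)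
    (H : ∀ x y, f x ^ (1 - t) * g y ^ t * ENNReal.ofReal (Real.exp (-(t * (1 - t) / 2 * (x - y) ^ 2)))
      ≤ h ((1 - t) * x + t * y)) :
    (∫⁻ x, f x ∂gaussianReal 0 1) ^ (1 - t) * (∫⁻ x, g x ∂gaussianReal 0 1) ^ t
      ≤ ∫⁻ x, h x ∂gaussianReal 0 1 := by
  have h1t : 0 < 1 - t := by linarith
  have hφ := measurable_gaussianPDF 0 1
  rw [gaussianReal_of_var_ne_zero _ one_ne_zero]
  simp only [lintegral_withDensity_eq_lintegral_mul _ hφ hf,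
    lintegral_withDensity_eq_lintegral_mul _ hφ hg, lintegral_withDensity_eq_lintegral_mul _ hφ hh]
  refine lintegral_prekopaLeindler ht0 ht1 (hφ.mul hf) (hφ.mul hg) (hφ.mul hh) fun x y => ?_
  have hdens : gaussianPDF 0 1 x ^ (1 - t) * gaussianPDF 0 1 y ^ t =
      gaussianPDF 0 1 ((1 - t) * x + t * y) *
        ENNReal.ofReal (Real.exp (-(t * (1 - t) / 2 * (x - y) ^ 2))) := by
    have hpos : ∀ z, 0 < gaussianPDFReal 0 1 z := fun z => gaussianPDFReal_pos 0 1 z one_ne_zero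
    simp only [gaussianPDF]
    rw [ENNReal.ofReal_rpow_of_pos (hpos x), ENNReal.ofReal_rpow_of_pos (hpos y),
      ← ENNReal.ofReal_mul (by have := hpos x; positivity), ← ENNReal.ofReal_mul (hpos _).le]
    congr 1
    simp only [gaussianPDFReal]
    set c := (√(2 * Real.pi * ((1 : ℝ≥0) : ℝ)))⁻¹ with hc
    have hc0 : 0 < c := by rw [hc]; positivity
    rw [Real.mul_rpow hc0.le (Real.exp_pos _).le, Real.mul_rpow hc0.le (Real.exp_pos _).le,
      ← Real.exp_mul, ← Real.exp_mul,
      show ∀ A B C D : ℝ, A * B * (C * D) = A * C * (B * D) by intros; ring, ← Real.rpow_add hc0,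
      mul_assoc, ← Real.exp_add, ← Real.exp_add]
    congr 1
    · simp
    · congr 1
      simp only [NNReal.coe_one]
      ring
  simp only [Pi.mul_apply]
  rw [ENNReal.mul_rpow_of_nonneg _ _ h1t.le, ENNReal.mul_rpow_of_nonneg _ _ ht0.le]
  calc _ = gaussianPDF 0 1 x ^ (1 - t) * gaussianPDF 0 1 y ^ t * (f x ^ (1 - t) * g y ^ t) := by ring
    _ = gaussianPDF 0 1 ((1 - t) * x + t * y) * (f x ^ (1 - t) * g y ^ t *
        ENNReal.ofReal (Real.exp (-(t * (1 - t) / 2 * (x - y) ^ 2)))) := by rw [hdens]; ring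
    _ ≤ _ := by gcongr; exact H x y

/-- The Prékopa–Leindler inequality for the standard Gaussian measure on `ℝⁿ`, in which strong
log-concavity yields a quadratic gain. -/
theorem lintegral_pi_gaussianReal_prekopaLeindler {t : ℝ} (ht0 : 0 < t) (ht1 : t < 1) (n : ℕ)
    {f g h : (Fin n → ℝ) → ℝ≥0∞} (hf : Measurable f) (hg : Measurable g) (hh : Measurable h)
    (H : ∀ x y, f x ^ (1 - t) * g y ^ t *
        ENNReal.ofReal (Real.exp (-(t * (1 - t) / 2 * ∑ i, (x i - y i) ^ 2)))
      ≤ h (fun i => (1 - t) * x i + t * y i)) :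
    (∫⁻ x, f x ∂Measure.pi fun _ => gaussianReal 0 1) ^ (1 - t) *
      (∫⁻ x, g x ∂Measure.pi fun _ => gaussianReal 0 1) ^ t
      ≤ ∫⁻ x, h x ∂Measure.pi fun _ => gaussianReal 0 1 := by
  induction n with
  | zero =>
    have hz : ∀ u : (Fin 0 → ℝ) → ℝ≥0∞,
        ∫⁻ x, u x ∂Measure.pi (fun _ : Fin 0 => gaussianReal 0 1) = u 0 := by
      intro u
      rw [lintegral_unique, measure_univ, mul_one]
      congr 1
      exact Subsingleton.elim _ _
    rw [hz, hz, hz]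
    have := H 0 0
    simp only [Finset.univ_eq_empty, Finset.sum_empty, mul_zero, neg_zero, Real.exp_zero,
      ENNReal.ofReal_one, mul_one] at this
    convert this
  | succ n ih =>
    set γ := Measure.pi fun _ : Fin n => gaussianReal 0 1 with hγ
    have hsymm : ∀ p : ℝ × (Fin n → ℝ),
        (MeasurableEquiv.piFinSuccAbove (fun _ : Fin (n + 1) => ℝ) 0).symm p =
          (Fin.cons p.1 p.2 : Fin (n + 1) → ℝ) := fun p => by
      simp [MeasurableEquiv.piFinSuccAbove_symm_apply, Fin.insertNthEquiv]
    have hcons : Measurable fun p : ℝ × (Fin n → ℝ) => (Fin.cons p.1 p.2 : Fin (n + 1) → ℝ) := by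
      have := (MeasurableEquiv.piFinSuccAbove (fun _ : Fin (n + 1) => ℝ) 0).symm.measurable
      convert this using 2 with p
      exact (hsymm p).symm
    have hsplit : ∀ u : (Fin (n + 1) → ℝ) → ℝ≥0∞, Measurable u →
        ∫⁻ x, u x ∂Measure.pi (fun _ : Fin (n + 1) => gaussianReal 0 1) =
          ∫⁻ x, ∫⁻ v, u (Fin.cons x v) ∂γ ∂gaussianReal 0 1 := by
      intro u hu
      have hmp := (measurePreserving_piFinSuccAbove
        (fun _ : Fin (n + 1) => gaussianReal 0 1) 0).symm
      rw [← hmp.lintegral_comp hu, lintegral_prod _ (by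
        exact (hu.comp hmp.measurable).aemeasurable)]
      simp only [hsymm]
      rfl
    have hmeas : ∀ u : (Fin (n + 1) → ℝ) → ℝ≥0∞, Measurable u →
        Measurable fun x => ∫⁻ v, u (Fin.cons x v) ∂γ := fun u hu =>
      Measurable.lintegral_prod_right' (f := fun p : ℝ × (Fin n → ℝ) => u (Fin.cons p.1 p.2))
        (hu.comp hcons)
    rw [hsplit f hf, hsplit g hg, hsplit h hh]
    refine lintegral_gaussianReal_prekopaLeindler ht0 ht1 (hmeas f hf) (hmeas g hg) (hmeas h hh)
      fun x y => ?_
    have hsec : ∀ (u : (Fin (n + 1) → ℝ) → ℝ≥0∞) (x : ℝ), Measurable u →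
        Measurable fun v : Fin n → ℝ => u (Fin.cons x v) := fun u x hu =>
      hu.comp (hcons.comp measurable_prodMk_left)
    -- The first coordinate contributes a factor exp(-c) to the hypothesis on sections. The
    -- induction hypothesis is applied with exp(c) times the section of h, and the factor is moved
    -- back afterwards.
    set c := t * (1 - t) / 2 * (x - y) ^ 2 with hc
    have hcc : ENNReal.ofReal (Real.exp c) * ENNReal.ofReal (Real.exp (-c)) = 1 := by
      rw [← ENNReal.ofReal_mul (Real.exp_pos _).le, ← Real.exp_add]; simp
    have := ih (hsec f x hf) (hsec g y hg)
      ((hsec h ((1 - t) * x + t * y) hh).const_mul (ENNReal.ofReal (Real.exp c))) (fun v w => by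
        have hv := H (Fin.cons x v) (Fin.cons y w)
        have hz : (fun i => (1 - t) * (Fin.cons x v : Fin (n + 1) → ℝ) i +
            t * (Fin.cons y w : Fin (n + 1) → ℝ) i) =
            Fin.cons ((1 - t) * x + t * y) (fun i => (1 - t) * v i + t * w i) := by
          ext i
          refine Fin.cases ?_ (fun j => ?_) i <;> simp
        rw [hz, Fin.sum_univ_succ] at hv
        simp only [Fin.cons_zero, Fin.cons_succ] at hv
        rw [mul_add, neg_add, Real.exp_add, ENNReal.ofReal_mul (Real.exp_pos _).le, ← hc] at hv
        refine le_trans (le_of_eq ?_) (mul_le_mul_right hv (ENNReal.ofReal (Real.exp c)))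
        calc _ = ENNReal.ofReal (Real.exp c) * ENNReal.ofReal (Real.exp (-c)) * _ :=
              by rw [hcc, one_mul]
          _ = _ := by ring)
    rw [lintegral_const_mul _ (hsec h _ hh)] at this
    calc _ ≤ ENNReal.ofReal (Real.exp c) *
          (∫⁻ v, h (Fin.cons ((1 - t) * x + t * y) v) ∂γ) * ENNReal.ofReal (Real.exp (-c)) := by
          gcongr
      _ = ENNReal.ofReal (Real.exp c) * ENNReal.ofReal (Real.exp (-c)) *
          (∫⁻ v, h (Fin.cons ((1 - t) * x + t * y) v) ∂γ) := by ring
      _ = _ := by rw [hcc, one_mul]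

/-! ### Gaussian concentration -/

lemma ofReal_integral_le_lintegral {α : Type*} [MeasurableSpace α] {μ : Measure α} {v : α → ℝ}
    (hv : Integrable v μ) : ENNReal.ofReal (∫ x, v x ∂μ) ≤ ∫⁻ x, ENNReal.ofReal (v x) ∂μ := by
  rw [integral_eq_lintegral_pos_part_sub_lintegral_neg_part hv]
  refine (ENNReal.ofReal_le_ofReal (sub_le_self _ ENNReal.toReal_nonneg)).trans ?_
  exact ENNReal.ofReal_toReal_le

/-- Jensen's inequality for the exponential. -/
lemma ofReal_exp_integral_le_lintegral {α : Type*} [MeasurableSpace α] {μ : Measure α}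
    [IsProbabilityMeasure μ] {v : α → ℝ} (hv : Integrable v μ) :
    ENNReal.ofReal (Real.exp (∫ x, v x ∂μ)) ≤ ∫⁻ x, ENNReal.ofReal (Real.exp (v x)) ∂μ := by
  set m := ∫ x, v x ∂μ with hm
  -- This is the tangent line of exp at the mean m: it lies below exp and integrates to exp m, so
  -- integrability of exp(v) is not needed.
  have hi : Integrable (fun x => Real.exp m * (1 + (v x - m))) μ :=
    ((integrable_const 1).add (hv.sub (integrable_const m))).const_mul _
  have hint : ∫ x, Real.exp m * (1 + (v x - m)) ∂μ = Real.exp m := by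
    have h0 : ∫ x, (v x - m) ∂μ = 0 := by
      rw [integral_sub hv (integrable_const m)]
      simp [← hm]
    have h1 : ∫ x, (1 + (v x - m)) ∂μ = 1 + ∫ x, (v x - m) ∂μ := by
      rw [integral_add (f := fun _ => (1 : ℝ)) (g := fun x => v x - m) (integrable_const 1)
        (hv.sub (integrable_const m))]
      simp
    rw [integral_const_mul, h1, h0]
    simp
  rw [← hint]
  refine (ofReal_integral_le_lintegral hi).trans (lintegral_mono fun x => ?_)
  refine ENNReal.ofReal_le_ofReal ?_
  calc Real.exp m * (1 + (v x - m)) ≤ Real.exp m * Real.exp (v x - m) := by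
        gcongr
        linarith [Real.add_one_le_exp (v x - m)]
    _ = _ := by rw [← Real.exp_add]; congr 1; ring

/-- Lipschitz functions of a standard Gaussian vector are sub-Gaussian, with the sharp constant. -/
theorem lintegral_exp_le_of_lipschitz_pi_gaussianReal {n : ℕ} {F : (Fin n → ℝ) → ℝ}
    (hF : Measurable F) {τ : ℝ} 
    (hLip : ∀ x y, F x - F y ≤ τ * √(∑ i, (x i - y i) ^ 2))
    (hint : Integrable F (Measure.pi fun _ => gaussianReal 0 1)) {l : ℝ} (hl : 0 ≤ l) :
    ∫⁻ x, ENNReal.ofReal (Real.exp (l * (F x - ∫ y, F y ∂Measure.pi fun _ => gaussianReal 0 1)))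
      ∂(Measure.pi fun _ => gaussianReal 0 1) ≤ ENNReal.ofReal (Real.exp (l ^ 2 * τ ^ 2 / 2)) := by
  set γ := Measure.pi fun _ : Fin n => gaussianReal 0 1 with hγ
  set m := ∫ y, F y ∂γ with hm
  set B := ∫⁻ x, ENNReal.ofReal (Real.exp (l * F x)) ∂γ with hB
  have key : ∀ t : ℝ, 0 < t → t < 1 →
      B ≤ ENNReal.ofReal (Real.exp (l * m + l ^ 2 * τ ^ 2 / (2 * (1 - t)))) := by
    intro t ht0 ht1
    have h1t : 0 < 1 - t := by linarith
    -- Chosen so that exp(u), exp(lF) and 1 satisfy the Prékopa–Leindler hypothesis. In lτD ≤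
    -- l²τ²/(2(1-t)) + (1-t)D²/2 the constant in u absorbs the first term and the quadratic gain
    -- absorbs the second.
    set u : (Fin n → ℝ) → ℝ := fun x =>
      -(t * l / (1 - t)) * F x - t * l ^ 2 * τ ^ 2 / (2 * (1 - t) ^ 2) with hu
    have hu_int : Integrable u γ := (hint.const_mul _).sub (integrable_const _)
    have hu_eq : ∫ x, u x ∂γ = -(t * l / (1 - t)) * m - t * l ^ 2 * τ ^ 2 / (2 * (1 - t) ^ 2) := by
      rw [hu, integral_sub (hint.const_mul _) (integrable_const _), integral_const_mul]
      simp [← hm]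
    have hrp : ∀ v r : ℝ, ENNReal.ofReal (Real.exp v) ^ r = ENNReal.ofReal (Real.exp (v * r)) :=
      fun v r => by rw [ENNReal.ofReal_rpow_of_pos (Real.exp_pos _), ← Real.exp_mul]
    have hPL := lintegral_pi_gaussianReal_prekopaLeindler ht0 ht1 n
      (f := fun x => ENNReal.ofReal (Real.exp (u x)))
      (g := fun x => ENNReal.ofReal (Real.exp (l * F x))) (h := fun _ => 1)
      (by fun_prop) (by fun_prop) measurable_const (fun x y => by
        rw [hrp, hrp, ← ENNReal.ofReal_mul (Real.exp_pos _).le, ← Real.exp_add,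
          ← ENNReal.ofReal_mul (Real.exp_pos _).le, ← Real.exp_add, ← ENNReal.ofReal_one]
        refine ENNReal.ofReal_le_ofReal (Real.exp_le_one_iff.2 ?_)
        set D := √(∑ i, (x i - y i) ^ 2) with hD
        have hD2 : ∑ i, (x i - y i) ^ 2 = D ^ 2 :=
          (Real.sq_sqrt (Finset.sum_nonneg fun i _ => sq_nonneg _)).symm
        have hyx : F y - F x ≤ τ * D := by
          have h := hLip y x
          have hs : ∑ i, (y i - x i) ^ 2 = ∑ i, (x i - y i) ^ 2 :=
            Finset.sum_congr rfl fun i _ => by ring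
          rwa [hs] at h
        rw [hD2]
        have e1 : u x * (1 - t) = -(t * l) * F x - t * l ^ 2 * τ ^ 2 / (2 * (1 - t)) := by
          simp only [hu]; field_simp
        rw [e1]
        have e2 : l * τ * D ≤ l ^ 2 * τ ^ 2 / (2 * (1 - t)) + (1 - t) / 2 * D ^ 2 := by
          have : 0 ≤ (l * τ - (1 - t) * D) ^ 2 / (2 * (1 - t)) := by positivity
          have e3 : (l * τ - (1 - t) * D) ^ 2 / (2 * (1 - t)) =
            l ^ 2 * τ ^ 2 / (2 * (1 - t)) + (1 - t) / 2 * D ^ 2 - l * τ * D := by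
            field_simp; ring
          linarith
        have e4 : l * (F y - F x) ≤ l * τ * D := by
          rw [mul_assoc]; exact mul_le_mul_of_nonneg_left hyx hl
        have e5 := mul_le_mul_of_nonneg_left (e4.trans e2) ht0.le
        have e6 : t * l ^ 2 * τ ^ 2 / (2 * (1 - t)) = t * (l ^ 2 * τ ^ 2 / (2 * (1 - t))) := by ring
        rw [e6]
        linarith)
    -- Jensen bounds the integral of exp(u) from below, which turns the Prékopa–Leindler inequality
    -- into an upper bound for B ^ t.
    have hA := ofReal_exp_integral_le_lintegral hu_int
    rw [hu_eq] at hA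
    simp only [lintegral_const, measure_univ, mul_one] at hPL
    have h2 : ENNReal.ofReal (Real.exp (-(l * m + l ^ 2 * τ ^ 2 / (2 * (1 - t))))) ^ t * B ^ t ≤ 1 := by
      refine le_trans ?_ hPL
      gcongr
      refine le_trans (le_of_eq ?_) (ENNReal.rpow_le_rpow hA h1t.le)
      rw [hrp, hrp]
      congr 2
      field_simp
      ring
    rw [← ENNReal.mul_rpow_of_nonneg _ _ ht0.le] at h2
    have h2 := (ENNReal.rpow_le_rpow_iff ht0).1 (h2.trans_eq (ENNReal.one_rpow t).symm)
    have hcc : ∀ c : ℝ, ENNReal.ofReal (Real.exp c) * ENNReal.ofReal (Real.exp (-c)) = 1 := by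
      intro c
      rw [← ENNReal.ofReal_mul (Real.exp_pos _).le, ← Real.exp_add]; simp
    calc B = ENNReal.ofReal (Real.exp (l * m + l ^ 2 * τ ^ 2 / (2 * (1 - t)))) *
          (ENNReal.ofReal (Real.exp (-(l * m + l ^ 2 * τ ^ 2 / (2 * (1 - t))))) * B) := by
          rw [← mul_assoc, hcc, one_mul]
      _ ≤ _ := mul_le_of_le_one_right' h2
  -- The loss 1/(1-t) disappears as t → 0, which yields the sharp constant.
  have hlim : B ≤ ENNReal.ofReal (Real.exp (l * m + l ^ 2 * τ ^ 2 / 2)) := by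
    have htend : Tendsto (fun t : ℝ =>
        ENNReal.ofReal (Real.exp (l * m + l ^ 2 * τ ^ 2 / (2 * (1 - t))))) (𝓝[>] 0)
        (𝓝 (ENNReal.ofReal (Real.exp (l * m + l ^ 2 * τ ^ 2 / 2)))) := by
      refine tendsto_nhdsWithin_of_tendsto_nhds ?_
      have : ContinuousAt (fun t : ℝ => Real.exp (l * m + l ^ 2 * τ ^ 2 / (2 * (1 - t)))) 0 := by
        refine Real.continuous_exp.continuousAt.comp ?_
        refine continuousAt_const.add (continuousAt_const.div (by fun_prop) (by norm_num))
      have h := (ENNReal.continuous_ofReal.tendsto _).comp this.tendsto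
      simpa [Function.comp_def] using h
    refine ge_of_tendsto htend ?_
    filter_upwards [Ioo_mem_nhdsGT (zero_lt_one' ℝ)] with t ht using key t ht.1 ht.2
  calc _ = ENNReal.ofReal (Real.exp (-(l * m))) * B := by
        rw [hB, ← lintegral_const_mul _ (by fun_prop)]
        refine lintegral_congr fun x => ?_
        rw [← ENNReal.ofReal_mul (Real.exp_pos _).le, ← Real.exp_add]
        congr 2; ring
    _ ≤ ENNReal.ofReal (Real.exp (-(l * m))) *
        ENNReal.ofReal (Real.exp (l * m + l ^ 2 * τ ^ 2 / 2)) := by gcongr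
    _ = _ := by
        rw [← ENNReal.ofReal_mul (Real.exp_pos _).le, ← Real.exp_add]
        congr 2; ring

open scoped MatrixOrder in
/-- A Gaussian measure on a Euclidean space is an affine image of the standard one. -/
lemma exists_map_stdGaussian_eq {ι : Type*} [Fintype ι] (μ : Measure (EuclideanSpace ℝ ι))
    [IsGaussian μ] : ∃ (m : EuclideanSpace ℝ ι) (A : EuclideanSpace ℝ ι →L[ℝ] EuclideanSpace ℝ ι),
      μ = (stdGaussian (EuclideanSpace ℝ ι)).map fun z => m + A z := by
  classical
  set S : Matrix ι ι ℝ := fun i j =>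
    covarianceBilin μ (EuclideanSpace.basisFun ι ℝ i) (EuclideanSpace.basisFun ι ℝ j) with hS
  have hquad : ∀ x y : EuclideanSpace ℝ ι, covarianceBilin μ x y = x ⬝ᵥ S.mulVec y := by
    intro x y
    conv_lhs => rw [← (EuclideanSpace.basisFun ι ℝ).sum_repr x,
      ← (EuclideanSpace.basisFun ι ℝ).sum_repr y]
    simp only [map_sum, map_smul, _root_.sum_apply, _root_.smul_apply,
      smul_eq_mul, EuclideanSpace.basisFun_repr, dotProduct, Matrix.mulVec, hS, Finset.mul_sum]
    rw [Finset.sum_comm]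
    refine Finset.sum_congr rfl fun i _ => Finset.sum_congr rfl fun j _ => ?_
    ring
  have hpsd : S.PosSemidef := by
    refine Matrix.PosSemidef.of_dotProduct_mulVec_nonneg ?_ ?_
    · ext i j
      change star (S j i) = S i j
      exact covarianceBilin_comm _ _
    · intro x
      have := hquad (WithLp.toLp 2 x) (WithLp.toLp 2 x)
      simp at this ⊢
      rw [← this]
      exact covarianceBilin_self_nonneg _
  -- A Gaussian law is determined by its mean and covariance, and the square root of S maps the
  -- standard Gaussian to one with covariance S.
  refine ⟨∫ x, x ∂μ, Matrix.toEuclideanCLM (𝕜 := ℝ) (CFC.sqrt S), ?_⟩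
  change μ = multivariateGaussian (∫ x, x ∂μ) S
  refine IsGaussian.ext ?_ ?_
  · simp
  · ext x y
    rw [covarianceBilin_multivariateGaussian hpsd, hquad]

/-- A supremum of linear functionals of variance at most `τ²` of a Gaussian vector is sub-Gaussian
around its mean. -/
theorem lintegral_exp_le_of_isGaussian {ι : Type*} [Fintype ι] {μ : Measure (EuclideanSpace ℝ ι)}
    [IsGaussian μ] {F : EuclideanSpace ℝ ι → ℝ} (hF : Measurable F) {τ : ℝ} (hτ : 0 ≤ τ)
    (hLip : ∀ x y, ∃ L : StrongDual ℝ (EuclideanSpace ℝ ι), Var[L; μ] ≤ τ ^ 2 ∧ F x - F y ≤ L (x - y))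
    (hint : Integrable F μ) {l : ℝ} (hl : 0 ≤ l) :
    ∫⁻ x, ENNReal.ofReal (Real.exp (l * (F x - ∫ y, F y ∂μ))) ∂μ
      ≤ ENNReal.ofReal (Real.exp (l ^ 2 * τ ^ 2 / 2)) := by
  obtain ⟨m, A, hμ⟩ := exists_map_stdGaussian_eq μ
  set b := stdOrthonormalBasis ℝ (EuclideanSpace ℝ ι) with hb
  set T : (Fin (Module.finrank ℝ (EuclideanSpace ℝ ι)) → ℝ) → EuclideanSpace ℝ ι := fun x => m + A (∑ i, x i • b i) with hT
  have hTm : Measurable T := by fun_prop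
  have hμT : μ = (Measure.pi fun _ : Fin (Module.finrank ℝ (EuclideanSpace ℝ ι)) => gaussianReal 0 1).map T := by
    rw [hμ, stdGaussian, Measure.map_map (by fun_prop) (by fun_prop)]
    rfl
  -- Variances under μ are squared operator norms after pulling back by A, so the variance bound
  -- makes F ∘ T a τ-Lipschitz function.
  have hvar : ∀ L : StrongDual ℝ (EuclideanSpace ℝ ι), ‖L.comp A‖ ^ 2 = Var[L; μ] := by
    intro L
    rw [← variance_dual_stdGaussian, hμ, variance_map (by fun_prop) (by fun_prop)]
    have : (L ∘ fun z => m + A z) = fun z => L m + (L.comp A) z := by ext z; simp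
    rw [this, variance_const_add (by fun_prop)]
  have hint' : Integrable (F ∘ T) (Measure.pi fun _ => gaussianReal 0 1) :=
    (integrable_map_measure hF.aestronglyMeasurable hTm.aemeasurable).1 (hμT ▸ hint)
  have h := lintegral_exp_le_of_lipschitz_pi_gaussianReal (hF.comp hTm) (τ := τ) (fun x y => by
    obtain ⟨L, hL, hle⟩ := hLip (T x) (T y)
    have hn : ‖L.comp A‖ ≤ τ := by
      rw [← hvar] at hL
      exact (sq_le_sq₀ (norm_nonneg _) hτ).1 hL
    have hd : T x - T y = A (∑ i, (x i - y i) • b i) := by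
      simp only [hT, add_sub_add_left_eq_sub, ← map_sub, ← Finset.sum_sub_distrib, ← sub_smul]
    have hnorm : ‖∑ i, (x i - y i) • b i‖ = √(∑ i, (x i - y i) ^ 2) := by
      rw [← Real.sqrt_sq (norm_nonneg _)]
      congr 1
      rw [← b.sum_sq_norm_inner_right]
      refine Finset.sum_congr rfl fun i _ => ?_
      rw [b.orthonormal.inner_right_fintype]
      simp
    calc F (T x) - F (T y) ≤ (L.comp A) (∑ i, (x i - y i) • b i) := by
          rw [hd] at hle; exact hle
      _ ≤ ‖L.comp A‖ * ‖∑ i, (x i - y i) • b i‖ :=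
          (Real.le_norm_self _).trans ((L.comp A).le_opNorm _)
      _ ≤ _ := by rw [hnorm]; gcongr) hint' hl
  have hmean : ∫ y, F y ∂μ = ∫ y, (F ∘ T) y ∂Measure.pi fun _ => gaussianReal 0 1 := by
    conv_lhs => rw [hμT]
    exact integral_map hTm.aemeasurable hF.aestronglyMeasurable
  rw [← hmean] at h
  set M := ∫ y, F y ∂μ
  refine le_trans (le_of_eq ?_) h
  conv_lhs => rw [hμT]
  rw [lintegral_map (by fun_prop) hTm]
  rfl

/-! ### The Borell–TIS inequality for circular complex Gaussian processes -/

/-- The real and imaginary parts of finitely many values of a complex process. -/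
def realCoordinates {Ω : Type*} {n : ℕ} (V : ℝ → Ω → ℂ) (s : Fin n → ℝ) (ω : Ω) :
    EuclideanSpace ℝ (Fin n × Bool) :=
  WithLp.toLp 2 fun ib => if ib.2 then (V (s ib.1) ω).re else (V (s ib.1) ω).im

/-- The maximum of the weighted moduli, in terms of `realCoordinates`. -/
def finiteMax {n : ℕ} (c : Fin (n + 1) → ℝ) (x : EuclideanSpace ℝ (Fin (n + 1) × Bool)) : ℝ :=
  Finset.univ.sup' Finset.univ_nonempty fun i => c i * ‖(⟨x (i, true), x (i, false)⟩ : ℂ)‖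

lemma measurable_finiteMax {n : ℕ} (c : Fin (n + 1) → ℝ) : Measurable (finiteMax c) := by
  have : Continuous (finiteMax c) := by
    refine Continuous.finset_sup'_apply _ fun i _ => continuous_const.mul ?_
    have : Continuous fun x : EuclideanSpace ℝ (Fin (n + 1) × Bool) =>
        ((x (i, true) : ℂ) + (x (i, false) : ℂ) * Complex.I) := by fun_prop
    refine (continuous_norm.comp this).congr fun x => ?_
    rw [Function.comp_apply, ← Complex.mk_eq_add_mul_I]
  exact this.measurable

lemma finiteMax_realCoordinates {Ω : Type*} {n : ℕ} (c : Fin (n + 1) → ℝ) (V : ℝ → Ω → ℂ)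
    (s : Fin (n + 1) → ℝ) (ω : Ω) : finiteMax c (realCoordinates V s ω) =
      Finset.univ.sup' Finset.univ_nonempty fun i => c i * ‖V (s i) ω‖ := by
  simp [finiteMax, realCoordinates]

/-- The direction of z itself attains its modulus. This linearises moduli into real Gaussian
projections. -/
lemma exists_norm_eq_linear (z : ℂ) : ∃ α β : ℝ, α ^ 2 + β ^ 2 = 1 ∧ ‖z‖ = α * z.re + β * z.im := by
  rcases eq_or_ne z 0 with rfl | hz
  · exact ⟨1, 0, by norm_num, by simp⟩
  · have hn : ‖z‖ ≠ 0 := norm_ne_zero_iff.2 hz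
    have h2 : ‖z‖ ^ 2 = z.re ^ 2 + z.im ^ 2 := by
      rw [← Complex.normSq_eq_norm_sq, Complex.normSq_apply]; ring
    refine ⟨z.re / ‖z‖, z.im / ‖z‖, ?_, ?_⟩ 
    · field_simp; exact h2.symm
    · field_simp; exact h2

/-- The exponential moments of the maximum of finitely many weighted moduli of a circular complex
Gaussian vector. -/
lemma lintegral_exp_finiteMax_le {Ω : Type*} [MeasurableSpace Ω] {P : Measure Ω}
    [IsProbabilityMeasure P] {n : ℕ} {V : ℝ → Ω → ℂ} {s : Fin (n + 1) → ℝ}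
    (hgauss : HasGaussianLaw (realCoordinates V s) P) {c : Fin (n + 1) → ℝ} (hc : ∀ i, 0 ≤ c i)
    {σ : ℝ} (hσ : 0 ≤ σ)
    (hvar : ∀ i, ∀ α β : ℝ, α ^ 2 + β ^ 2 = 1 →
      c i ^ 2 * Var[fun ω => α * (V (s i) ω).re + β * (V (s i) ω).im; P] ≤ σ ^ 2 / 2)
    (hint : Integrable (fun ω => finiteMax c (realCoordinates V s ω)) P) {l : ℝ} (hl : 0 ≤ l) :
    ∫⁻ ω, ENNReal.ofReal (Real.exp (l * (finiteMax c (realCoordinates V s ω)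
        - ∫ ω', finiteMax c (realCoordinates V s ω') ∂P))) ∂P
      ≤ ENNReal.ofReal (Real.exp (l ^ 2 * σ ^ 2 / 4)) := by
  have hX := hgauss.aemeasurable
  have := hgauss.isGaussian_map
  have hF := measurable_finiteMax c
  have hτ : (σ / √2) ^ 2 = σ ^ 2 / 2 := by rw [div_pow, Real.sq_sqrt (by norm_num)]
  have key := lintegral_exp_le_of_isGaussian (μ := P.map (realCoordinates V s)) hF
    (τ := σ / √2) (by positivity) (fun x y => by
      -- The functional dominating the increment from y to x uses the index where the maximum at x
      -- is attained and the direction of the difference of the i-th complex entries.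
      obtain ⟨i, -, hi⟩ := Finset.exists_mem_eq_sup' (Finset.univ_nonempty (α := Fin (n + 1)))
        fun i => c i * ‖(⟨x (i, true), x (i, false)⟩ : ℂ)‖
      obtain ⟨α, β, hαβ, hn⟩ := exists_norm_eq_linear
        (⟨x (i, true), x (i, false)⟩ - ⟨y (i, true), y (i, false)⟩)
      refine ⟨c i • (α • EuclideanSpace.proj (i, true) + β • EuclideanSpace.proj (i, false)), ?_, ?_⟩
      · rw [variance_map (by fun_prop) hX, hτ]
        refine le_trans (le_of_eq ?_) (hvar i α β hαβ)
        rw [← variance_const_mul]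
        rfl
      · have hy : c i * ‖(⟨y (i, true), y (i, false)⟩ : ℂ)‖ ≤ finiteMax c y :=
          Finset.le_sup' (fun i => c i * ‖(⟨y (i, true), y (i, false)⟩ : ℂ)‖) (Finset.mem_univ i)
        have hx : finiteMax c x = c i * ‖(⟨x (i, true), x (i, false)⟩ : ℂ)‖ := hi
        have hxy := norm_sub_norm_le (⟨x (i, true), x (i, false)⟩ : ℂ) ⟨y (i, true), y (i, false)⟩
        rw [hn] at hxy
        rw [hx]
        have := mul_le_mul_of_nonneg_left hxy (hc i)
        simp only [Complex.sub_re, Complex.sub_im] at this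
        simp
        linarith) ((integrable_map_measure hF.aestronglyMeasurable hX).2 hint) hl
  rw [integral_map hX hF.aestronglyMeasurable, lintegral_map' (by fun_prop) hX, hτ] at key
  refine key.trans (le_of_eq ?_)
  congr 2; ring

/-- Chernoff's bound. -/
lemma measureReal_le_exp_of_lintegral_exp_le {Ω : Type*} [MeasurableSpace Ω] {P : Measure Ω} {M : Ω → ℝ} (hM : AEMeasurable M P) {m C l : ℝ}
    (hl : 0 ≤ l)
    (h : ∫⁻ ω, ENNReal.ofReal (Real.exp (l * (M ω - m))) ∂P ≤ ENNReal.ofReal (Real.exp C)) (u : ℝ) :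
    P.real {ω | u ≤ M ω} ≤ Real.exp (C - l * (u - m)) := by
  have h0 : ENNReal.ofReal (Real.exp (l * (u - m))) ≠ 0 := by simp [Real.exp_pos]
  have hmk := mul_meas_ge_le_lintegral₀ (μ := P)
    (f := fun ω => ENNReal.ofReal (Real.exp (l * (M ω - m)))) (by fun_prop)
    (ENNReal.ofReal (Real.exp (l * (u - m))))
  have hsub : P {ω | u ≤ M ω} ≤ P {ω | ENNReal.ofReal (Real.exp (l * (u - m))) ≤
      ENNReal.ofReal (Real.exp (l * (M ω - m)))} := by
    refine measure_mono fun ω hω => ?_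
    rw [mem_ofPred_eq] at hω ⊢
    gcongr
  have h1 : ENNReal.ofReal (Real.exp (l * (u - m))) * P {ω | u ≤ M ω} ≤ ENNReal.ofReal (Real.exp C) :=
    (mul_le_mul_right hsub _).trans (hmk.trans h)
  have h2 := ENNReal.toReal_mono ENNReal.ofReal_ne_top h1
  rw [ENNReal.toReal_mul, ENNReal.toReal_ofReal (Real.exp_pos _).le,
    ENNReal.toReal_ofReal (Real.exp_pos _).le] at h2
  rw [Real.exp_sub, le_div_iff₀ (Real.exp_pos _), mul_comm]
  exact h2

lemma isGreatest_sSup_image_Icc {a b : ℝ} (hab : a ≤ b) {g : ℝ → ℝ}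
    (hg : ContinuousOn g (Icc a b)) : IsGreatest (g '' Icc a b) (sSup (g '' Icc a b)) := by
  obtain ⟨s, hs, hmax⟩ := isCompact_Icc.exists_isMaxOn (nonempty_Icc.2 hab) hg
  have : IsGreatest (g '' Icc a b) (g s) := ⟨mem_image_of_mem g hs, by
    rintro _ ⟨r, hr, rfl⟩; exact hmax hr⟩
  rwa [this.csSup_eq]

/-- The Borell–TIS inequality for a circular complex Gaussian process with continuous paths that are
dominated by an integrable random variable. -/
theorem borellTIS_of_continuous {Ω : Type*} [MeasurableSpace Ω] {P : Measure Ω}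
    [IsProbabilityMeasure P] {a b : ℝ} (hab : a ≤ b) {w : ℝ → ℝ}
    (hw : ContinuousOn w (Icc a b)) (hw0 : ∀ s ∈ Icc a b, 0 ≤ w s) {V : ℝ → Ω → ℂ} {v : ℝ → ℝ}
    (hgauss : ∀ (n : ℕ) (s : Fin n → ℝ), (∀ i, s i ∈ Icc a b) →
      HasGaussianLaw (realCoordinates V s) P)
    (hvar : ∀ s ∈ Icc a b, ∀ α β : ℝ, α ^ 2 + β ^ 2 = 1 →
      Var[fun ω => α * (V s ω).re + β * (V s ω).im; P] = v s / 2)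
    (hv : ContinuousOn v (Icc a b))
    (hcont : ∀ᵐ ω ∂P, ContinuousOn (fun s => V s ω) (Icc a b))
    {D : Ω → ℝ} (hD : Integrable D P) (hVD : ∀ᵐ ω ∂P, ∀ s ∈ Icc a b, ‖V s ω‖ ≤ D ω) :
    BorellTIS P a b w V v := by
  have hne : (Icc a b).Nonempty := nonempty_Icc.2 hab
  have : Nonempty (Icc a b) := hne.to_subtype
  have hv0 : ∀ s ∈ Icc a b, 0 ≤ v s := fun s hs => by
    have h1 := hvar s hs 1 0 (by norm_num)
    have h2 := variance_nonneg (fun ω => 1 * (V s ω).re + 0 * (V s ω).im) P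
    linarith
  have hmax : ∀ᵐ ω ∂P,
      IsGreatest ((fun s => w s * ‖V s ω‖) '' Icc a b) (weightedMax a b w V ω) := by
    filter_upwards [hcont] with ω hω
    exact isGreatest_sSup_image_Icc hab (hw.mul hω.norm)
  have hsig : IsGreatest ((fun s => w s * Real.sqrt (v s)) '' Icc a b) (weightedSigma a b w v) :=
    isGreatest_sSup_image_Icc hab (hw.mul (Real.continuous_sqrt.comp_continuousOn hv))
  set σ := weightedSigma a b w v with hσdef
  set M := weightedMax a b w V with hMdef
  have hσ0 : 0 ≤ σ := by
    obtain ⟨s, hs, h⟩ := hsig.1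
    rw [← h]; exact mul_nonneg (hw0 s hs) (Real.sqrt_nonneg _)
  have hσle : ∀ s ∈ Icc a b, w s ^ 2 * v s ≤ σ ^ 2 := fun s hs => by
    have h := hsig.2 (mem_image_of_mem _ hs)
    have h2 := pow_le_pow_left₀ (mul_nonneg (hw0 s hs) (Real.sqrt_nonneg _)) h 2
    rwa [mul_pow, Real.sq_sqrt (hv0 s hs)] at h2
  -- Maxima over the first n + 1 points of a dense sequence increase to M along continuous paths.
  set q : ℕ → Icc a b := TopologicalSpace.denseSeq (Icc a b) with hq
  set c : ∀ n : ℕ, Fin (n + 1) → ℝ := fun n i => w (q i) with hc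
  set S : ∀ n : ℕ, Fin (n + 1) → ℝ := fun n i => q i with hS
  set Mn : ℕ → Ω → ℝ := fun n ω => finiteMax (c n) (realCoordinates V (S n) ω) with hMn
  have hMn_apply : ∀ n ω, Mn n ω =
      Finset.univ.sup' Finset.univ_nonempty fun i : Fin (n + 1) => w (q i) * ‖V (q i) ω‖ :=
    fun n ω => finiteMax_realCoordinates _ _ _ _
  have hMn_le : ∀ᵐ ω ∂P, ∀ n, Mn n ω ≤ M ω := by
    filter_upwards [hmax] with ω hω n
    rw [hMn_apply]
    exact Finset.sup'_le _ _ fun i _ => hω.2 (mem_image_of_mem _ (q i).2)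
  have hMn_nonneg : ∀ n ω, 0 ≤ Mn n ω := fun n ω => by
    rw [hMn_apply]
    exact (mul_nonneg (hw0 _ (q 0).2) (norm_nonneg _)).trans
      (Finset.le_sup' (fun i : Fin (n + 1) => w (q i) * ‖V (q i) ω‖) (Finset.mem_univ 0))
  have htend : ∀ᵐ ω ∂P, Tendsto (fun n => Mn n ω) atTop (𝓝 (M ω)) := by
    filter_upwards [hmax, hMn_le, hcont] with ω hω hle hco
    have hmono : Monotone fun n => Mn n ω := by
      intro n m hnm
      simp only [hMn_apply]
      refine Finset.sup'_le _ _ fun i _ => ?_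
      exact Finset.le_sup' (fun i : Fin (m + 1) => w (q i) * ‖V (q i) ω‖)
        (Finset.mem_univ (Fin.castLE (by omega) i))
    refine tendsto_atTop_isLUB hmono ⟨?_, fun B hB => ?_⟩
    · rintro _ ⟨n, rfl⟩; exact hle n
    · have hq_le : ∀ k, w (q k) * ‖V (q k) ω‖ ≤ B := fun k => by
        refine le_trans ?_ (hB ⟨k, rfl⟩)
        simp only [hMn_apply]
        exact Finset.le_sup' (fun i : Fin (k + 1) => w (q i) * ‖V (q i) ω‖)
          (Finset.mem_univ (Fin.last k))
      have hgc : Continuous fun s : Icc a b => w s * ‖V s ω‖ :=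
        continuousOn_iff_continuous_domRestrict.1 (hw.mul hco.norm)
      have hall : ∀ s : Icc a b, w s * ‖V s ω‖ ≤ B := fun s =>
        (TopologicalSpace.denseRange_denseSeq (Icc a b)).induction_on s
          (isClosed_le hgc continuous_const) hq_le
      obtain ⟨s, hs, h⟩ := hω.1
      rw [← h]; exact hall ⟨s, hs⟩
  have hg : ∀ n, HasGaussianLaw (realCoordinates V (S n)) P := fun n =>
    hgauss _ _ fun i => (q i).2
  have hMn_meas : ∀ n, AEMeasurable (Mn n) P := fun n =>
    (measurable_finiteMax _).comp_aemeasurable (hg n).aemeasurable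
  have hM_meas : AEMeasurable M P := aemeasurable_of_tendsto_metrizable_ae' hMn_meas htend
  obtain ⟨B, hB⟩ : ∃ B, ∀ s ∈ Icc a b, w s ≤ B := by
    obtain ⟨B, hB⟩ := isCompact_Icc.bddAbove_image hw
    exact ⟨B, fun s hs => hB (mem_image_of_mem _ hs)⟩
  have hM_bound : ∀ᵐ ω ∂P, M ω ≤ B * D ω := by
    filter_upwards [hmax, hVD] with ω hω hd
    obtain ⟨s, hs, h⟩ := hω.1
    rw [← h]
    exact mul_le_mul (hB s hs) (hd s hs) (norm_nonneg _) ((hw0 s hs).trans (hB s hs))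
  have hMn_bound : ∀ n, ∀ᵐ ω ∂P, ‖Mn n ω‖ ≤ B * D ω := fun n => by
    filter_upwards [hM_bound, hMn_le] with ω h1 h2
    rw [Real.norm_of_nonneg (hMn_nonneg n ω)]
    exact (h2 n).trans h1
  have hMn_int : ∀ n, Integrable (Mn n) P := fun n =>
    (hD.const_mul B).mono' (hMn_meas n).aestronglyMeasurable (hMn_bound n)
  have hM_int : Integrable M P := by
    refine (hD.const_mul B).mono' hM_meas.aestronglyMeasurable ?_
    filter_upwards [hM_bound, hMn_le] with ω h1 h2
    rw [Real.norm_of_nonneg ((hMn_nonneg 0 ω).trans (h2 0))]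
    exact h1
  have hE : Tendsto (fun n => ∫ ω, Mn n ω ∂P) atTop (𝓝 (∫ ω, M ω ∂P)) :=
    tendsto_integral_of_dominated_convergence _ (fun n => (hMn_meas n).aestronglyMeasurable)
      (hD.const_mul B) hMn_bound htend
  have hmgf : ∀ l : ℝ, 0 ≤ l → ∫⁻ ω, ENNReal.ofReal (Real.exp (l * (M ω - ∫ ω', M ω' ∂P))) ∂P ≤
      ENNReal.ofReal (Real.exp (l ^ 2 * σ ^ 2 / 4)) := by
    intro l hl
    have hn : ∀ n, ∫⁻ ω, ENNReal.ofReal (Real.exp (l * (Mn n ω - ∫ ω', Mn n ω' ∂P))) ∂P ≤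
        ENNReal.ofReal (Real.exp (l ^ 2 * σ ^ 2 / 4)) := fun n =>
      lintegral_exp_finiteMax_le (hg n) (fun i => hw0 _ (q i).2) hσ0 (fun i α β hαβ => by
        have h1 := hvar (q i) (q i).2 α β hαβ
        have h2 := hσle (q i) (q i).2
        simp only [hS]
        rw [h1]
        linarith) (hMn_int n) hl
    -- Only an upper bound is needed, so Fatou's lemma suffices; the centring constants converge by
    -- dominated convergence.
    calc _ = ∫⁻ ω, liminf (fun n =>
          ENNReal.ofReal (Real.exp (l * (Mn n ω - ∫ ω', Mn n ω' ∂P)))) atTop ∂P := by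
          refine lintegral_congr_ae ?_
          filter_upwards [htend] with ω hω
          refine (Tendsto.liminf_eq ?_).symm
          refine (ENNReal.continuous_ofReal.tendsto _).comp ?_
          exact (Real.continuous_exp.tendsto _).comp ((hω.sub hE).const_mul l)
      _ ≤ liminf (fun n => ∫⁻ ω,
          ENNReal.ofReal (Real.exp (l * (Mn n ω - ∫ ω', Mn n ω' ∂P))) ∂P) atTop := by
          refine lintegral_liminf_le' fun n => ?_
          have := hMn_meas n
          fun_prop
      _ ≤ _ := by
          refine le_trans (liminf_le_liminf (Eventually.of_forall hn)) ?_
          simp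
  have htail := fun (l : ℝ) (hl : 0 ≤ l) (u : ℝ) =>
    measureReal_le_exp_of_lintegral_exp_le hM_meas hl (hmgf l hl) u
  refine ⟨hmax, hsig, hM_int, fun u hu => ?_, fun hσ u hu => ?_⟩
  -- For σ = 0 the quotient is 0 by convention, and the bound reads P ≤ 1.
  · rcases hσ0.eq_or_lt with h0 | hpos
    · rw [← hσdef, ← h0]
      simp
    -- This value of l minimises l²σ²/4 - l(u - E M).
    · refine (htail (2 * (u - ∫ ω, M ω ∂P) / σ ^ 2)
        (div_nonneg (by linarith) (sq_nonneg σ)) u).trans (le_of_eq ?_)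
      congr 1
      rw [← hσdef]
      field_simp
      ring
  · refine le_antisymm (le_of_forall_pos_le_add fun ε hε => ?_) measureReal_nonneg
    have hr : 0 < u - ∫ ω, M ω ∂P := by linarith
    -- When σ = 0, Chernoff's bound has no quadratic term, and l → ∞ forces the probability to
    -- vanish.
    have ht : Tendsto (fun l : ℝ => Real.exp (-(l * (u - ∫ ω, M ω ∂P)))) atTop (𝓝 0) :=
      Real.tendsto_exp_neg_atTop_nhds_zero.comp (tendsto_id.atTop_mul_const hr)
    obtain ⟨l, hl0, hl⟩ := ((eventually_ge_atTop 0).and (ht.eventually (gt_mem_nhds hε))).exists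
    have := htail l hl0 u
    rw [← hσdef] at hσ
    rw [hσ] at this
    simp only [ne_eq, OfNat.ofNat_ne_zero, not_false_eq_true, zero_pow, mul_zero, zero_div,
      zero_sub] at this
    linarith

/-! ### Integrals of the noise against integrable kernels -/

/-- Gaussian variables form a closed subset of `L²`. -/
lemma isClosed_setOf_hasGaussianLaw {Ω : Type*} [MeasurableSpace Ω] {P : Measure Ω}
    [IsProbabilityMeasure P] : IsClosed {X : Lp ℝ 2 P | HasGaussianLaw X P} := by
  have hmem : ∀ X : Lp ℝ 2 P, MemLp X 2 P := fun X => Lp.memLp X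
  have hint : ∀ X : Lp ℝ 2 P, Integrable X P := fun X => (hmem X).integrable (by norm_num)
  have hL1 : ∀ X Y : Lp ℝ 2 P, ∫ ω, ‖X ω - Y ω‖ ∂P ≤ ‖X - Y‖ := by
    intro X Y
    have h1 : ∫ ω, ‖X ω - Y ω‖ ∂P = ∫ ω, ‖(X - Y : Lp ℝ 2 P) ω‖ ∂P := by
      refine integral_congr_ae ?_
      filter_upwards [Lp.coeFn_sub X Y] with ω hω
      rw [hω]; rfl
    rw [h1, Lp.norm_def, integral_norm_eq_lintegral_enorm (Lp.aestronglyMeasurable _)]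
    refine ENNReal.toReal_mono (Lp.eLpNorm_ne_top _) ?_
    rw [← eLpNorm_one_eq_lintegral_enorm]
    exact eLpNorm_le_eLpNorm_of_exponent_le (by norm_num) (Lp.aestronglyMeasurable _)
  have hchar : ∀ t : ℝ, Continuous fun X : Lp ℝ 2 P => charFun (P.map X) t := by
    intro t
    refine LipschitzWith.continuous (K := ‖t‖₊) (LipschitzWith.of_dist_le_mul fun X Y => ?_)
    have hX := (hmem X).1.aemeasurable
    have hY := (hmem Y).1.aemeasurable
    simp only [charFun_apply_real]
    rw [integral_map hX (by fun_prop), integral_map hY (by fun_prop), dist_eq_norm,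
      ← integral_sub]
    · refine (norm_integral_le_integral_norm _).trans ?_
      calc _ ≤ ∫ ω, ‖t‖ * ‖X ω - Y ω‖ ∂P := by
            refine integral_mono_of_nonneg (Eventually.of_forall fun _ => norm_nonneg _)
              (((hint X).sub (hint Y)).norm.const_mul _) (Eventually.of_forall fun ω => ?_)
            have h1 : Complex.exp (t * X ω * Complex.I) - Complex.exp (t * Y ω * Complex.I) =
                Complex.exp ((t * Y ω : ℝ) * Complex.I) *
                  (Complex.exp (Complex.I * (t * X ω - t * Y ω : ℝ)) - 1) := by
              rw [mul_sub, ← Complex.exp_add, mul_one]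
              congr 2
              · push_cast; ring
              · push_cast; ring
            simp only []
            rw [h1, norm_mul, Complex.norm_exp_ofReal_mul_I, one_mul]
            refine (Real.norm_exp_I_mul_ofReal_sub_one_le).trans (le_of_eq ?_)
            rw [← mul_sub, norm_mul]
        _ = ‖t‖ * ∫ ω, ‖X ω - Y ω‖ ∂P := integral_const_mul _ _
        _ ≤ _ := by
            rw [dist_eq_norm]
            exact mul_le_mul_of_nonneg_left (hL1 X Y) (norm_nonneg t)
    · refine Integrable.of_bound (C := 1) (by fun_prop) (Eventually.of_forall fun ω => ?_)
      rw [← Complex.ofReal_mul, Complex.norm_exp_ofReal_mul_I]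
    · refine Integrable.of_bound (C := 1) (by fun_prop) (Eventually.of_forall fun ω => ?_)
      rw [← Complex.ofReal_mul, Complex.norm_exp_ofReal_mul_I]
  have hmean : Continuous fun X : Lp ℝ 2 P => ∫ ω, X ω ∂P := by
    refine LipschitzWith.continuous (K := 1) (LipschitzWith.of_dist_le_mul fun X Y => ?_)
    rw [dist_eq_norm, ← integral_sub (hint X) (hint Y), NNReal.coe_one, one_mul, dist_eq_norm]
    exact (norm_integral_le_integral_norm _).trans (hL1 X Y)
  have hvar : Continuous fun X : Lp ℝ 2 P => Var[X; P] := by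
    have : (fun X : Lp ℝ 2 P => Var[X; P]) = fun X => ‖X‖ ^ 2 - (∫ ω, X ω ∂P) ^ 2 := by
      ext X
      rw [variance_eq_sub (hmem X)]
      congr 1
      have h := MeasureTheory.L2.inner_def (𝕜 := ℝ) X X
      rw [real_inner_self_eq_norm_sq] at h
      rw [h]
      refine integral_congr_ae (Eventually.of_forall fun ω => ?_)
      simp [pow_two]
    rw [this]
    fun_prop
  -- Being Gaussian is a family of equations between the characteristic function and an expression
  -- in the mean and variance. Both sides are continuous on L².
  have heq : {X : Lp ℝ 2 P | HasGaussianLaw X P} = ⋂ t : ℝ, {X : Lp ℝ 2 P | charFun (P.map X) t =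
      Complex.exp ((t * ∫ ω, X ω ∂P : ℝ) * Complex.I - (t ^ 2 * Var[X; P] : ℝ) / 2)} := by
    ext X
    simp only [mem_ofPred_eq, mem_iInter]
    rw [hasGaussianLaw_iff_charFun_map_eq (hmem X).1.aemeasurable]
    refine forall_congr' fun t => ?_
    have h1 : ∫ ω, inner ℝ t (X ω) ∂P = t * ∫ ω, X ω ∂P := by
      rw [← integral_const_mul]; simp [mul_comm]
    have h2 : Var[fun ω => inner ℝ t (X ω); P] = t ^ 2 * Var[X; P] := by
      rw [← variance_const_mul]; simp [mul_comm]
    rw [h1, h2]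
  rw [heq]
  refine isClosed_iInter fun t => isClosed_eq (hchar t) ?_
  fun_prop

section Noise

variable {Ω : Type*} [MeasurableSpace Ω] {P : Measure Ω} {Φ : ℝ → Ω → ℝ} {p : ℝ → ℝ}

lemma IsStationaryGaussianNoise.measurable_eval (hΦ : IsStationaryGaussianNoise P Φ p) (t : ℝ) :
    Measurable (Φ t) := hΦ.measurable.comp measurable_prodMk_left

lemma IsStationaryGaussianNoise.memLp_two (hΦ : IsStationaryGaussianNoise P Φ p) (t : ℝ) :
    MemLp (Φ t) 2 P := (hΦ.gaussian.hasGaussianLaw_eval t).memLp_two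

lemma IsStationaryGaussianNoise.integral_shift (hΦ : IsStationaryGaussianNoise P Φ p) {n : ℕ}
    {g : (Fin n → ℝ) → ℝ} (hg : Measurable g) (h : ℝ) (t : Fin n → ℝ) :
    ∫ ω, g (fun i => Φ (t i + h) ω) ∂P = ∫ ω, g (fun i => Φ (t i) ω) ∂P := by
  have hm : ∀ t : Fin n → ℝ, AEMeasurable (fun ω i => Φ (t i) ω) P := fun t =>
    (measurable_pi_lambda _ fun i => hΦ.measurable_eval (t i)).aemeasurable
  have := congrArg (fun μ => ∫ x, g x ∂μ) (hΦ.stationary h n t)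
  beta_reduce at this
  rwa [integral_map (hm fun i => t i + h) hg.aestronglyMeasurable,
    integral_map (hm t) hg.aestronglyMeasurable] at this

lemma IsStationaryGaussianNoise.integral_comp_eval (hΦ : IsStationaryGaussianNoise P Φ p)
    {g : ℝ → ℝ} (hg : Measurable g) (t : ℝ) : ∫ ω, g (Φ t ω) ∂P = ∫ ω, g (Φ 0 ω) ∂P := by
  have := hΦ.integral_shift (n := 1) (g := fun x => g (x 0)) (by fun_prop) t (fun _ => 0)
  simpa using this

/-- The noise need not be centred, so the second moment carries the squared mean; kernels of
integral zero remove it later. -/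
lemma IsStationaryGaussianNoise.integral_mul [IsProbabilityMeasure P]
    (hΦ : IsStationaryGaussianNoise P Φ p) (t u : ℝ) :
    ((∫ ω, Φ t ω * Φ u ω ∂P : ℝ) : ℂ) =
      (∫ l : ℝ, Complex.exp (Complex.I * (t - u : ℝ) * l) * ((p l : ℝ) : ℂ)) +
        ((∫ ω, Φ 0 ω ∂P : ℝ) : ℂ) ^ 2 := by
  have h1 := hΦ.integral_shift (n := 2) (g := fun x => x 0 * x 1) (by fun_prop) u ![t - u, 0]
  simp only [Matrix.cons_val_zero, Matrix.cons_val_one, sub_add_cancel, zero_add] at h1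
  have h2 := hΦ.covariance_eq (t - u)
  rw [covariance_eq_sub (hΦ.memLp_two _) (hΦ.memLp_two _)] at h2
  have h3 := hΦ.integral_comp_eval measurable_id (t - u)
  simp only [id] at h3
  rw [h1, ← h2, h3]
  simp only [Pi.mul_apply]
  push_cast
  ring

/-- By stationarity the bound does not depend on t. This uniformity is what makes Fubini available
for every integrable kernel. -/
lemma IsStationaryGaussianNoise.integral_abs_mul_le (hΦ : IsStationaryGaussianNoise P Φ p)
    {X : Ω → ℝ} (hX : MemLp X 2 P) (t : ℝ) :
    ∫ ω, ‖X ω * Φ t ω‖ ∂P ≤ (∫ ω, X ω ^ 2 ∂P) + ∫ ω, Φ 0 ω ^ 2 ∂P := by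
  rw [← hΦ.integral_comp_eval (g := fun x => x ^ 2) (by fun_prop) t,
    ← integral_add hX.integrable_sq (hΦ.memLp_two t).integrable_sq]
  refine integral_mono (hX.integrable_mul (hΦ.memLp_two t)).norm
    (hX.integrable_sq.add (hΦ.memLp_two t).integrable_sq) fun ω => ?_
  simp only [norm_mul, Real.norm_eq_abs]
  nlinarith [sq_abs (X ω), sq_abs (Φ t ω), sq_nonneg (|X ω| - |Φ t ω|), sq_nonneg (|X ω|),
    sq_nonneg (|Φ t ω|)]

variable [IsProbabilityMeasure P]

/-- Integrability of `X(ω) Φ(τ, ω) κ(τ)` in both variables, for `X ∈ L²` and `κ ∈ L¹`. -/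
lemma IsStationaryGaussianNoise.integrable_prod_mul (hΦ : IsStationaryGaussianNoise P Φ p)
    {X : Ω → ℝ} (hX : MemLp X 2 P) {κ : ℝ → ℂ} (hκ : Integrable κ) :
    Integrable (fun z : Ω × ℝ => ((X z.1 * Φ z.2 z.1 : ℝ) : ℂ) * κ z.2) (P.prod volume) := by
  have hm : AEStronglyMeasurable (fun z : Ω × ℝ => ((X z.1 * Φ z.2 z.1 : ℝ) : ℂ) * κ z.2)
      (P.prod volume) := by
    refine AEStronglyMeasurable.mul ?_ hκ.1.comp_snd
    refine Complex.continuous_ofReal.comp_aestronglyMeasurable ?_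
    exact hX.1.comp_fst.mul (hΦ.measurable.comp measurable_swap).aestronglyMeasurable
  rw [integrable_prod_iff' hm]
  refine ⟨Eventually.of_forall fun τ => ?_, ?_⟩
  · exact ((hX.integrable_mul (hΦ.memLp_two τ)).ofReal (𝕜 := ℂ)).mul_const (κ τ)
  · refine (hκ.norm.const_mul ((∫ ω, X ω ^ 2 ∂P) + ∫ ω, Φ 0 ω ^ 2 ∂P)).mono'
      hm.norm.prod_swap.integral_prod_right' (Eventually.of_forall fun τ => ?_)
    rw [Real.norm_of_nonneg (integral_nonneg fun _ => norm_nonneg _)]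
    simp only [norm_mul, Complex.norm_real]
    rw [integral_mul_const]
    gcongr
    simpa only [norm_mul] using hΦ.integral_abs_mul_le hX τ

lemma IsStationaryGaussianNoise.integrable_prod (hΦ : IsStationaryGaussianNoise P Φ p)
    {κ : ℝ → ℂ} (hκ : Integrable κ) :
    Integrable (fun z : Ω × ℝ => (Φ z.2 z.1 : ℂ) * κ z.2) (P.prod volume) := by
  simpa using hΦ.integrable_prod_mul (memLp_const (1 : ℝ)) hκ

lemma IsStationaryGaussianNoise.ae_integrable (hΦ : IsStationaryGaussianNoise P Φ p)
    {κ : ℝ → ℂ} (hκ : Integrable κ) : ∀ᵐ ω ∂P, Integrable fun τ => (Φ τ ω : ℂ) * κ τ :=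
  (hΦ.integrable_prod hκ).prod_right_ae

lemma IsStationaryGaussianNoise.integral_integral (hΦ : IsStationaryGaussianNoise P Φ p)
    {κ : ℝ → ℂ} (hκ : Integrable κ) :
    ∫ ω, (∫ τ, (Φ τ ω : ℂ) * κ τ) ∂P = ((∫ ω, Φ 0 ω ∂P : ℝ) : ℂ) * ∫ τ, κ τ := by
  rw [integral_integral_swap (hΦ.integrable_prod hκ), ← integral_const_mul]
  refine integral_congr_ae (Eventually.of_forall fun τ => ?_)
  simp only [integral_mul_const]
  have h := hΦ.integral_comp_eval measurable_id τ
  simp only [id] at h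
  rw [integral_complex_ofReal, h]

/-- The random field `Φ(τ) Φ(τ') κ₁(τ) κ₂(τ')` is integrable. -/
lemma IsStationaryGaussianNoise.integrable_prod_prod (hΦ : IsStationaryGaussianNoise P Φ p)
    {κ₁ κ₂ : ℝ → ℂ} (h₁ : Integrable κ₁) (h₂ : Integrable κ₂) :
    Integrable (fun z : Ω × (ℝ × ℝ) => ((Φ z.2.1 z.1 : ℂ) * κ₁ z.2.1) * ((Φ z.2.2 z.1 : ℂ) * κ₂ z.2.2))
      (P.prod (volume.prod volume)) := by
  have hm : AEStronglyMeasurable (fun z : Ω × (ℝ × ℝ) =>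
      ((Φ z.2.1 z.1 : ℂ) * κ₁ z.2.1) * ((Φ z.2.2 z.1 : ℂ) * κ₂ z.2.2))
      (P.prod (volume.prod volume)) := by
    have e1 : AEStronglyMeasurable (fun z : Ω × (ℝ × ℝ) => (Φ z.2.1 z.1 : ℂ))
        (P.prod (volume.prod volume)) := by
      refine Measurable.aestronglyMeasurable (Complex.measurable_ofReal.comp ?_)
      exact hΦ.measurable.comp ((measurable_fst.comp measurable_snd).prodMk measurable_fst)
    have e2 : AEStronglyMeasurable (fun z : Ω × (ℝ × ℝ) => (Φ z.2.2 z.1 : ℂ))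
        (P.prod (volume.prod volume)) := by
      refine Measurable.aestronglyMeasurable (Complex.measurable_ofReal.comp ?_)
      exact hΦ.measurable.comp ((measurable_snd.comp measurable_snd).prodMk measurable_fst)
    exact (e1.mul h₁.1.comp_fst.comp_snd).mul (e2.mul h₂.1.comp_snd.comp_snd)
  rw [integrable_prod_iff' hm]
  have hre : ∀ (ω : Ω) (y : ℝ × ℝ), ((Φ y.1 ω : ℂ) * κ₁ y.1) * ((Φ y.2 ω : ℂ) * κ₂ y.2) =
      ((Φ y.1 ω * Φ y.2 ω : ℝ) : ℂ) * (κ₁ y.1 * κ₂ y.2) := fun ω y => by push_cast; ring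
  refine ⟨Eventually.of_forall fun y => ?_, ?_⟩
  · simp only [hre]
    exact (((hΦ.memLp_two y.1).integrable_mul (hΦ.memLp_two y.2)).ofReal (𝕜 := ℂ)).mul_const _
  · refine ((h₁.mul_prod h₂).norm.const_mul ((∫ ω, Φ 0 ω ^ 2 ∂P) + ∫ ω, Φ 0 ω ^ 2 ∂P)).mono'
      hm.norm.prod_swap.integral_prod_right' (Eventually.of_forall fun y => ?_)
    rw [Real.norm_of_nonneg (integral_nonneg fun _ => norm_nonneg _)]
    simp only [hre]
    simp only [norm_mul, Complex.norm_real]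
    rw [integral_mul_const]
    gcongr
    have := hΦ.integral_abs_mul_le (hΦ.memLp_two y.1) y.2
    rw [hΦ.integral_comp_eval (g := fun x => x ^ 2) (by fun_prop) y.1] at this
    simpa only [norm_mul] using this

lemma IsStationaryGaussianNoise.integrable_mul (hΦ : IsStationaryGaussianNoise P Φ p)
    {κ₁ κ₂ : ℝ → ℂ} (h₁ : Integrable κ₁) (h₂ : Integrable κ₂) :
    Integrable (fun ω => (∫ τ, (Φ τ ω : ℂ) * κ₁ τ) * ∫ τ, (Φ τ ω : ℂ) * κ₂ τ) P := by
  have := (hΦ.integrable_prod_prod h₁ h₂).integral_prod_left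
  refine this.congr (Eventually.of_forall fun ω => ?_)
  exact integral_prod_mul (fun τ => (Φ τ ω : ℂ) * κ₁ τ) (fun τ => (Φ τ ω : ℂ) * κ₂ τ)

/-- The transform `λ ↦ ∫ e^{iτλ} κ(τ) dτ` of a kernel. -/
def kernelHat (κ : ℝ → ℂ) (l : ℝ) : ℂ := ∫ τ : ℝ, Complex.exp (Complex.I * τ * l) * κ τ

/-- The spectral representation of the second moments. -/
lemma IsStationaryGaussianNoise.integral_mul_eq (hΦ : IsStationaryGaussianNoise P Φ p)
    {κ₁ κ₂ : ℝ → ℂ} (h₁ : Integrable κ₁) (h₂ : Integrable κ₂) (h0 : ∫ τ, κ₁ τ = 0) :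
    ∫ ω, (∫ τ, (Φ τ ω : ℂ) * κ₁ τ) * (∫ τ, (Φ τ ω : ℂ) * κ₂ τ) ∂P =
      ∫ l, (p l : ℂ) * (kernelHat κ₁ l * kernelHat κ₂ (-l)) := by
  have hI := hΦ.integrable_prod_prod h₁ h₂
  have h12 : Integrable (fun y : ℝ × ℝ => κ₁ y.1 * κ₂ y.2) (volume.prod volume) := h₁.mul_prod h₂
  have hG : Integrable (fun z : (ℝ × ℝ) × ℝ =>
      (κ₁ z.1.1 * κ₂ z.1.2) * (Complex.exp (Complex.I * (z.1.1 - z.1.2 : ℝ) * z.2) * (p z.2 : ℂ)))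
      ((volume.prod volume).prod volume) := by
    have hb := h12.mul_prod (hΦ.density_integrable.ofReal (𝕜 := ℂ))
    refine (hb.bdd_mul (c := 1) (f := fun z : (ℝ × ℝ) × ℝ =>
      Complex.exp (Complex.I * (z.1.1 - z.1.2 : ℝ) * z.2)) ?_ ?_).congr ?_
    · exact Continuous.aestronglyMeasurable (by fun_prop)
    · refine Eventually.of_forall fun z => ?_
      rw [mul_assoc, ← Complex.ofReal_mul, Complex.norm_exp_I_mul_ofReal]
    · refine Eventually.of_forall fun z => ?_
      simp only [Complex.coe_algebraMap]
      ring
  calc _ = ∫ ω, ∫ y : ℝ × ℝ, ((Φ y.1 ω : ℂ) * κ₁ y.1) * ((Φ y.2 ω : ℂ) * κ₂ y.2)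
        ∂(volume.prod volume) ∂P := by
        refine integral_congr_ae (Eventually.of_forall fun ω => ?_)
        exact (integral_prod_mul (fun τ => (Φ τ ω : ℂ) * κ₁ τ)
          (fun τ => (Φ τ ω : ℂ) * κ₂ τ)).symm
    _ = ∫ y : ℝ × ℝ, ∫ ω, ((Φ y.1 ω : ℂ) * κ₁ y.1) * ((Φ y.2 ω : ℂ) * κ₂ y.2) ∂P
        ∂(volume.prod volume) := integral_integral_swap hI
    _ = ∫ y : ℝ × ℝ, ((∫ l : ℝ, (κ₁ y.1 * κ₂ y.2) *
          (Complex.exp (Complex.I * (y.1 - y.2 : ℝ) * l) * (p l : ℂ))) +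
          (((∫ ω, Φ 0 ω ∂P : ℝ) : ℂ) ^ 2) * (κ₁ y.1 * κ₂ y.2)) ∂(volume.prod volume) := by
        refine integral_congr_ae (Eventually.of_forall fun y => ?_)
        have hre : ∀ ω, ((Φ y.1 ω : ℂ) * κ₁ y.1) * ((Φ y.2 ω : ℂ) * κ₂ y.2) =
            ((Φ y.1 ω * Φ y.2 ω : ℝ) : ℂ) * (κ₁ y.1 * κ₂ y.2) := fun ω => by push_cast; ring
        simp only [hre]
        rw [integral_mul_const, integral_complex_ofReal, hΦ.integral_mul, integral_const_mul]
        ring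
    _ = ∫ y : ℝ × ℝ, (∫ l : ℝ, (κ₁ y.1 * κ₂ y.2) *
          (Complex.exp (Complex.I * (y.1 - y.2 : ℝ) * l) * (p l : ℂ))) ∂(volume.prod volume) := by
        -- The squared-mean term factors through ∫ κ₁ = 0.
        rw [integral_add hG.integral_prod_left (h12.const_mul _), integral_const_mul,
          integral_prod_mul κ₁ κ₂, h0]
        simp
    _ = ∫ l : ℝ, ∫ y : ℝ × ℝ, (κ₁ y.1 * κ₂ y.2) *
          (Complex.exp (Complex.I * (y.1 - y.2 : ℝ) * l) * (p l : ℂ)) ∂(volume.prod volume) :=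
        integral_integral_swap hG
    _ = _ := by
        refine integral_congr_ae (Eventually.of_forall fun l => ?_)
        simp only [kernelHat]
        rw [← integral_prod_mul (μ := volume) (ν := volume)
          (fun τ : ℝ => Complex.exp (Complex.I * τ * l) * κ₁ τ)
          (fun τ : ℝ => Complex.exp (Complex.I * τ * (-l : ℝ)) * κ₂ τ), ← integral_const_mul]
        refine integral_congr_ae (Eventually.of_forall fun y => ?_)
        have : Complex.exp (Complex.I * (y.1 - y.2 : ℝ) * l) =
            Complex.exp (Complex.I * y.1 * l) * Complex.exp (Complex.I * y.2 * (-l : ℝ)) := by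
          rw [← Complex.exp_add]
          congr 1
          push_cast; ring
        simp only [this]
        ring

end Noise

lemma ofReal_integral_path_mul {Ω : Type*} {Φ : ℝ → Ω → ℝ} (g : ℝ → ℝ) (ω : Ω) :
    ∫ τ, (Φ τ ω : ℂ) * (g τ : ℂ) = ((∫ τ, Φ τ ω * g τ : ℝ) : ℂ) := by
  rw [← integral_complex_ofReal]
  simp

section Noise

variable {Ω : Type*} [MeasurableSpace Ω] {P : Measure Ω} [IsProbabilityMeasure P]
  {Φ : ℝ → Ω → ℝ} {p : ℝ → ℝ}

lemma IsStationaryGaussianNoise.memLp_integral (hΦ : IsStationaryGaussianNoise P Φ p)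
    {g : ℝ → ℝ} (hg : Integrable g) : MemLp (fun ω => ∫ τ, Φ τ ω * g τ) 2 P := by
  have h1 := (hΦ.integrable_prod (hg.ofReal (𝕜 := ℂ))).integral_prod_left
  have h2 := hΦ.integrable_mul (hg.ofReal (𝕜 := ℂ)) (hg.ofReal (𝕜 := ℂ))
  simp only [Complex.coe_algebraMap, ofReal_integral_path_mul] at h1 h2
  have h1' := h1.re
  have h2' := h2.re
  rw [memLp_two_iff_integrable_sq (by simpa using h1'.1)]
  refine h2'.congr (Eventually.of_forall fun ω => ?_)
  simp [pow_two]

/-- The integral of the noise against an integrable function is Gaussian: it lies in the closed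
linear span of the noise in `L²`. -/
lemma IsStationaryGaussianNoise.hasGaussianLaw_integral (hΦ : IsStationaryGaussianNoise P Φ p)
    {g : ℝ → ℝ} (hg : Integrable g) : HasGaussianLaw (fun ω => ∫ τ, Φ τ ω * g τ) P := by
  have hY := hΦ.memLp_integral hg
  set Z : ℝ → Lp ℝ 2 P := fun t => (hΦ.memLp_two t).toLp (Φ t) with hZ
  set S : Submodule ℝ (Lp ℝ 2 P) := Submodule.span ℝ (range Z) with hS
  -- A vector orthogonal to every Φ(t) is orthogonal to the integral by Fubini. The double
  -- orthogonal complement is the closure of the span, so no approximation by Riemann sums is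
  -- needed.
  have hmem : hY.toLp _ ∈ Sᗮᗮ := by
    rw [Submodule.mem_orthogonal]
    intro u hu
    have hu0 : ∀ t, ∫ ω, u ω * Φ t ω ∂P = 0 := by
      intro t
      have h := (Submodule.mem_orthogonal _ _).1 hu (Z t) (Submodule.subset_span ⟨t, rfl⟩)
      rw [L2.inner_def] at h
      rw [← h]
      refine integral_congr_ae ?_
      filter_upwards [(hΦ.memLp_two t).coeFn_toLp] with ω hω
      simp [hZ, hω]
    rw [L2.inner_def]
    have hI := hΦ.integrable_prod_mul (Lp.memLp u) (hg.ofReal (𝕜 := ℂ))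
    have hsw := integral_integral_swap (f := fun ω τ =>
      ((u ω * Φ τ ω : ℝ) : ℂ) * (algebraMap ℝ ℂ (g τ))) hI
    have hz : ∫ ω, (∫ τ, ((u ω * Φ τ ω : ℝ) : ℂ) * (algebraMap ℝ ℂ (g τ))) ∂P = 0 := by
      rw [hsw]
      simp only [integral_mul_const, integral_complex_ofReal, hu0]
      simp
    have hc : ((∫ ω, inner ℝ (u ω) (hY.toLp _ ω) ∂P : ℝ) : ℂ) = 0 := by
      rw [← hz, ← integral_complex_ofReal]
      refine integral_congr_ae ?_
      filter_upwards [hY.coeFn_toLp] with ω hω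
      have : ∀ τ, ((u ω * Φ τ ω : ℝ) : ℂ) * (algebraMap ℝ ℂ (g τ)) =
          (u ω : ℂ) * ((Φ τ ω : ℂ) * (g τ : ℂ)) := fun τ => by
        simp only [Complex.coe_algebraMap]; push_cast; ring
      simp only [this, hω]
      rw [integral_const_mul, ofReal_integral_path_mul]
      simp [mul_comm]
    exact_mod_cast hc
  rw [Submodule.orthogonal_orthogonal_eq_closure] at hmem
  have hspan : (S : Set (Lp ℝ 2 P)) ⊆ {X : Lp ℝ 2 P | HasGaussianLaw X P} := by
    intro X hX
    obtain ⟨c, rfl⟩ := (Finsupp.mem_span_range_iff_exists_finsupp).1 hX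
    rw [mem_ofPred_eq]
    refine ((hΦ.gaussian.smul c).hasGaussianLaw_fun_sum (I := c.support)).congr ?_
    have h1 : (c.sum fun t r => r • Z t : Lp ℝ 2 P) = ∑ t ∈ c.support, c t • Z t := rfl
    rw [h1]
    have h2 : ∀ᵐ ω ∂P, ∀ t ∈ c.support, (c t • Z t : Lp ℝ 2 P) ω = c t • Φ t ω := by
      refine (ae_ball_iff c.support.countable_toSet).2 fun t _ => ?_
      filter_upwards [Lp.coeFn_smul (c t) (Z t), (hΦ.memLp_two t).coeFn_toLp] with ω h1 h2
      rw [h1, Pi.smul_apply, hZ, h2]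
    filter_upwards [h2, Lp.coeFn_finsetSum c.support (fun t => c t • Z t)] with ω h2 h3
    rw [h3]
    simp only [Finset.sum_apply]
    exact (Finset.sum_congr rfl h2).symm
  have hG := closure_minimal hspan isClosed_setOf_hasGaussianLaw hmem
  exact HasGaussianLaw.congr hG hY.coeFn_toLp

/-- Integrals of the noise against finitely many integrable functions are jointly Gaussian. -/
lemma IsStationaryGaussianNoise.hasGaussianLaw_integral_pi
    (hΦ : IsStationaryGaussianNoise P Φ p) {ι : Type*} [Fintype ι] {g : ι → ℝ → ℝ}
    (hg : ∀ i, Integrable (g i)) :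
    HasGaussianLaw (fun ω => (WithLp.toLp 2 fun i => ∫ τ, Φ τ ω * g i τ : EuclideanSpace ℝ ι)) P := by
  classical
  have hm : AEMeasurable
      (fun ω => (WithLp.toLp 2 fun i => ∫ τ, Φ τ ω * g i τ : EuclideanSpace ℝ ι)) P := by
    refine (WithLp.measurable_toLp 2 _).comp_aemeasurable (aemeasurable_pi_lambda _ fun i => ?_)
    exact (hΦ.hasGaussianLaw_integral (hg i)).aemeasurable
  refine ⟨isGaussian_of_isGaussian_map fun L => ?_⟩
  rw [AEMeasurable.map_map_of_aemeasurable (by fun_prop) hm]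
  -- A linear functional of the vector is almost surely the integral of the noise against one
  -- combined kernel, which reduces joint Gaussianity to the scalar case.
  have hcomb : Integrable fun τ => ∑ i, L (EuclideanSpace.single i 1) * g i τ :=
    integrable_finsetSum _ fun i _ => (hg i).const_mul _
  have hae : ∀ᵐ ω ∂P, ∀ i, Integrable fun τ => Φ τ ω * g i τ := by
    refine ae_all_iff.2 fun i => ?_
    filter_upwards [hΦ.ae_integrable ((hg i).ofReal (𝕜 := ℂ))] with ω hω
    simpa using hω.re
  refine ((hΦ.hasGaussianLaw_integral hcomb).congr ?_).isGaussian_map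
  filter_upwards [hae] with ω hω
  have hx : (WithLp.toLp 2 fun i => ∫ τ, Φ τ ω * g i τ : EuclideanSpace ℝ ι) =
      ∑ i, (∫ τ, Φ τ ω * g i τ) • EuclideanSpace.single i (1 : ℝ) := by
    ext j
    simp [Finset.sum_apply, Pi.single_apply]
  rw [Function.comp_apply, hx, map_sum]
  simp only [map_smul, smul_eq_mul]
  simp only [Finset.mul_sum]
  rw [integral_finsetSum _ fun i _ => ?_]
  · refine Finset.sum_congr rfl fun i _ => ?_
    rw [← integral_mul_const]
    refine integral_congr_ae (Eventually.of_forall fun τ => ?_)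
    ring
  · refine ((hω i).const_mul (L (EuclideanSpace.single i 1))).congr (Eventually.of_forall fun τ => ?_)
    ring

lemma kernelHat_conj (κ : ℝ → ℂ) (l : ℝ) :
    kernelHat (fun τ => (starRingEnd ℂ) (κ τ)) l = (starRingEnd ℂ) (kernelHat κ (-l)) := by
  rw [kernelHat, kernelHat, ← integral_conj]
  refine integral_congr_ae (Eventually.of_forall fun τ => ?_)
  simp only [map_mul, ← Complex.exp_conj, Complex.conj_I, Complex.conj_ofReal]
  congr 2
  push_cast; ring

lemma norm_kernelHat_le (κ : ℝ → ℂ) (l : ℝ) : ‖kernelHat κ l‖ ≤ ∫ τ, ‖κ τ‖ := by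
  refine (norm_integral_le_integral_norm _).trans (le_of_eq ?_)
  refine integral_congr_ae (Eventually.of_forall fun τ => ?_)
  simp only [norm_mul]
  rw [mul_assoc, ← Complex.ofReal_mul, Complex.norm_exp_I_mul_ofReal, one_mul]

lemma kernelHat_zero (κ : ℝ → ℂ) : kernelHat κ 0 = ∫ τ, κ τ := by simp [kernelHat]

lemma continuous_kernelHat {κ : ℝ → ℂ} (hκ : Integrable κ) : Continuous (kernelHat κ) := by
  refine continuous_of_dominated (bound := fun τ => ‖κ τ‖) (fun l => ?_)
    (fun l => Eventually.of_forall fun τ => ?_) hκ.norm (Eventually.of_forall fun τ => by fun_prop)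
  · exact AEStronglyMeasurable.mul (by fun_prop) hκ.1
  · rw [norm_mul, mul_assoc, ← Complex.ofReal_mul, Complex.norm_exp_I_mul_ofReal, one_mul]

/-- The integral of the noise against an analytic kernel is a circular complex Gaussian variable:
its real projections all have half the total variance. -/
lemma IsStationaryGaussianNoise.variance_integral (hΦ : IsStationaryGaussianNoise P Φ p)
    {κ : ℝ → ℂ} (hκ : Integrable κ) (h0 : ∀ l ≤ 0, kernelHat κ l = 0) {α β : ℝ}
    (hαβ : α ^ 2 + β ^ 2 = 1) :
    Var[fun ω => α * (∫ τ, (Φ τ ω : ℂ) * κ τ).re + β * (∫ τ, (Φ τ ω : ℂ) * κ τ).im; P] =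
      (∫ l in Ioi 0, ‖kernelHat κ l‖ ^ 2 * p l) / 2 := by
  set Y : Ω → ℂ := fun ω => ∫ τ, (Φ τ ω : ℂ) * κ τ with hY
  have hκ0 : ∫ τ, κ τ = 0 := by rw [← kernelHat_zero, h0 0 le_rfl]
  have hκc : Integrable fun τ => (starRingEnd ℂ) (κ τ) := 
    Complex.conjCLE.toContinuousLinearMap.integrable_comp hκ
  have hYi : Integrable Y P := (hΦ.integrable_prod hκ).integral_prod_left
  have hYY : Integrable (fun ω => Y ω * Y ω) P := hΦ.integrable_mul hκ hκ
  have hconj : ∀ ω, ∫ τ, (Φ τ ω : ℂ) * (starRingEnd ℂ) (κ τ) = (starRingEnd ℂ) (Y ω) := by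
    intro ω
    rw [hY, ← integral_conj]
    simp
  have hYc : Integrable (fun ω => Y ω * (starRingEnd ℂ) (Y ω)) P := by
    have := hΦ.integrable_mul hκ hκc
    simpa only [hconj] using this
  have hEY : ∫ ω, Y ω ∂P = 0 := by
    have := hΦ.integral_integral hκ
    rw [hκ0, mul_zero] at this
    exact this
  -- Circularity: at each frequency one of κ̂(l), κ̂(-l) vanishes.
  have hEYY : ∫ ω, Y ω * Y ω ∂P = 0 := by
    rw [hΦ.integral_mul_eq hκ hκ hκ0]
    refine integral_eq_zero_of_ae (Eventually.of_forall fun l => ?_)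
    rcases le_total l 0 with hl | hl
    · simp [h0 l hl]
    · simp [h0 (-l) (by linarith)]
  have hEYc : ∫ ω, Y ω * (starRingEnd ℂ) (Y ω) ∂P =
      ((∫ l in Ioi 0, ‖kernelHat κ l‖ ^ 2 * p l : ℝ) : ℂ) := by
    have h := hΦ.integral_mul_eq hκ hκc hκ0
    simp only [hconj, kernelHat_conj, neg_neg] at h
    rw [h, ← integral_complex_ofReal, ← integral_indicator measurableSet_Ioi]
    refine integral_congr_ae (Eventually.of_forall fun l => ?_)
    simp only []
    rcases le_or_gt l 0 with hl | hl
    · rw [indicator_of_notMem (by simpa using hl), h0 l hl]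
      simp
    · rw [indicator_of_mem (by simpa using hl), Complex.mul_conj, Complex.normSq_eq_norm_sq]
      push_cast; ring
  have hEre : ∫ ω, (Y ω).re ∂P = 0 := by
    have := integral_re hYi
    simp only [RCLike.re_to_complex] at this
    rw [this, hEY]; simp
  have hEim : ∫ ω, (Y ω).im ∂P = 0 := by
    have := integral_im hYi
    simp only [RCLike.im_to_complex] at this
    rw [this, hEY]; simp
  have hre : Integrable (fun ω => (Y ω).re) P := hYi.re
  have him : Integrable (fun ω => (Y ω).im) P := hYi.im
  have hmean : ∫ ω, (α * (Y ω).re + β * (Y ω).im) ∂P = 0 := by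
    rw [integral_add (hre.const_mul α) (him.const_mul β), integral_const_mul, integral_const_mul,
      hEre, hEim]
    simp
  have hmeas : AEMeasurable (fun ω => α * (Y ω).re + β * (Y ω).im) P :=
    ((hre.const_mul α).add (him.const_mul β)).aemeasurable
  change Var[fun ω => α * (Y ω).re + β * (Y ω).im; P] = _
  rw [variance_of_integral_eq_zero hmeas hmean]
  -- The squared projection is |Y|²/2 + Re((α - iβ)² Y²)/2, and the second summand has mean zero.
  have hpt : ∀ ω, (α * (Y ω).re + β * (Y ω).im) ^ 2 =
      ((1 / 2 : ℂ) * (Y ω * (starRingEnd ℂ) (Y ω)) +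
        ((1 / 2 : ℂ) * (α - β * Complex.I) ^ 2) * (Y ω * Y ω)).re := by
    intro ω
    have e1 : (1 / 2 : ℂ) = ((1 / 2 : ℝ) : ℂ) := by push_cast; rfl
    rw [e1, mul_assoc, Complex.add_re, Complex.re_ofReal_mul, Complex.re_ofReal_mul]
    simp only [pow_two, Complex.mul_re, Complex.mul_im, Complex.sub_re, Complex.sub_im,
      Complex.ofReal_re, Complex.ofReal_im, Complex.I_re, Complex.I_im, Complex.conj_re,
      Complex.conj_im]
    linear_combination ((1 / 2) * ((Y ω).re ^ 2 + (Y ω).im ^ 2)) * hαβ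
  simp only [hpt]
  have hint := (hYc.const_mul (1 / 2 : ℂ)).add (hYY.const_mul ((1 / 2 : ℂ) * (α - β * Complex.I) ^ 2))
  have h := integral_re hint
  simp only [RCLike.re_to_complex, Pi.add_apply] at h
  rw [h, integral_add (hYc.const_mul _) (hYY.const_mul _), integral_const_mul, integral_const_mul,
    hEYY, hEYc, mul_zero, add_zero]
  rw [show (1 / 2 : ℂ) = ((1 / 2 : ℝ) : ℂ) by push_cast; rfl, Complex.re_ofReal_mul,
    Complex.ofReal_re]
  ring

/-- The Borell–TIS inequality for the integrals of the noise against a dominated family of analytic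
kernels depending continuously on a parameter. -/
theorem IsStationaryGaussianNoise.borellTIS_of_kernel (hΦ : IsStationaryGaussianNoise P Φ p)
    {a b : ℝ} (hab : a ≤ b) {w : ℝ → ℝ}
    (hw : ContinuousOn w (Icc a b)) (hw0 : ∀ s ∈ Icc a b, 0 ≤ w s)
    {κ : ℝ → ℝ → ℂ} {K : ℝ → ℝ} (hK : Integrable K)
    (hκm : ∀ s ∈ Icc a b, AEStronglyMeasurable (κ s) volume)
    (hκK : ∀ᵐ τ, ∀ s ∈ Icc a b, ‖κ s τ‖ ≤ K τ)
    (hκc : ∀ᵐ τ, ContinuousOn (fun s => κ s τ) (Icc a b))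
    (h0 : ∀ s ∈ Icc a b, ∀ l ≤ 0, kernelHat (κ s) l = 0)
    {V : ℝ → Ω → ℂ} (hV : ∀ᵐ ω ∂P, ∀ s ∈ Icc a b, V s ω = ∫ τ, (Φ τ ω : ℂ) * κ s τ)
    {v : ℝ → ℝ} (hv : ∀ s ∈ Icc a b, v s = ∫ l in Ioi 0, ‖kernelHat (κ s) l‖ ^ 2 * p l) :
    BorellTIS P a b w V v := by
  have hκi : ∀ s ∈ Icc a b, Integrable (κ s) := fun s hs =>
    hK.mono' (hκm s hs) (hκK.mono fun τ h => h s hs)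
  have hKi : ∀ᵐ ω ∂P, Integrable fun τ => ‖(Φ τ ω : ℂ) * (K τ : ℂ)‖ := by
    filter_upwards [hΦ.ae_integrable (hK.ofReal (𝕜 := ℂ))] with ω hω using hω.norm
  have hdom : ∀ ω, ∀ᵐ τ, ∀ s ∈ Icc a b, ‖(Φ τ ω : ℂ) * κ s τ‖ ≤ ‖(Φ τ ω : ℂ) * (K τ : ℂ)‖ := by
    intro ω
    filter_upwards [hκK] with τ hτ s hs
    rw [norm_mul, norm_mul]
    gcongr
    refine (hτ s hs).trans ?_
    rw [Complex.norm_real]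
    exact Real.le_norm_self _
  have hpm : ∀ ω, AEStronglyMeasurable (fun τ => (Φ τ ω : ℂ)) volume := fun ω =>
    (Complex.measurable_ofReal.comp (hΦ.measurable.comp measurable_prodMk_right)).aestronglyMeasurable
  -- The single majorant K gives continuity of the variance, continuity of the paths, and the
  -- integrable bound ∫ |Φ||K| for the maximum.
  refine borellTIS_of_continuous hab hw hw0 ?_ ?_ ?_ ?_
    (D := fun ω => ∫ τ, ‖(Φ τ ω : ℂ) * (K τ : ℂ)‖) ?_ ?_
  · intro n s hs
    have hg : ∀ ib : Fin n × Bool, Integrable fun τ =>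
        if ib.2 then (κ (s ib.1) τ).re else (κ (s ib.1) τ).im := by
      rintro ⟨i, _ | _⟩
      · exact (hκi _ (hs i)).im
      · exact (hκi _ (hs i)).re
    refine (hΦ.hasGaussianLaw_integral_pi hg).congr ?_
    have hae : ∀ᵐ ω ∂P, ∀ i, Integrable fun τ => (Φ τ ω : ℂ) * κ (s i) τ :=
      ae_all_iff.2 fun i => hΦ.ae_integrable (hκi _ (hs i))
    filter_upwards [hV, hae] with ω h1 h2
    ext ⟨i, c⟩
    have h3 := h1 (s i) (hs i)
    cases c with
    | false =>
      have := integral_im (h2 i)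
      simp only [RCLike.im_to_complex, Complex.im_ofReal_mul] at this
      simp [realCoordinates, h3, ← this]
    | true =>
      have := integral_re (h2 i)
      simp only [RCLike.re_to_complex, Complex.re_ofReal_mul] at this
      simp [realCoordinates, h3, ← this]
  · intro s hs α β hαβ
    rw [hv s hs, ← hΦ.variance_integral (hκi s hs) (h0 s hs) hαβ]
    refine variance_congr ?_
    filter_upwards [hV] with ω hω
    rw [hω s hs]
  · have : ContinuousOn (fun s => ∫ l in Ioi 0, ‖kernelHat (κ s) l‖ ^ 2 * p l) (Icc a b) := by
      refine continuousOn_of_dominated (bound := fun l => (∫ τ, K τ) ^ 2 * p l) ?_ ?_ ?_ ?_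
      · intro s hs
        exact ((((continuous_kernelHat (hκi s hs)).norm.pow 2).aestronglyMeasurable).mul
          hΦ.density_integrable.1).restrict
      · intro s hs
        refine Eventually.of_forall fun l => ?_
        rw [norm_mul, norm_pow, norm_norm, Real.norm_of_nonneg (hΦ.density_pos l).le]
        have hp := (hΦ.density_pos l).le
        gcongr
        refine (norm_kernelHat_le _ _).trans ?_
        exact integral_mono_ae (hκi s hs).norm hK (hκK.mono fun τ h => h s hs)
      · exact (hΦ.density_integrable.const_mul _).integrableOn
      · refine Eventually.of_forall fun l => ?_
        refine ContinuousOn.mul (ContinuousOn.pow (ContinuousOn.norm ?_) 2) continuousOn_const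
        refine continuousOn_of_dominated (bound := K) ?_ ?_ hK ?_
        · intro s hs
          exact AEStronglyMeasurable.mul (by fun_prop) (hκm s hs)
        · intro s hs
          filter_upwards [hκK] with τ hτ
          rw [norm_mul, mul_assoc, ← Complex.ofReal_mul, Complex.norm_exp_I_mul_ofReal, one_mul]
          exact hτ s hs
        · filter_upwards [hκc] with τ hτ using continuousOn_const.mul hτ
    exact this.congr hv
  · filter_upwards [hV, hKi] with ω h1 h2
    refine ContinuousOn.congr ?_ h1
    refine continuousOn_of_dominated (fun s hs => (hpm ω).mul (hκm s hs)) ?_ h2 ?_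
    · intro s hs
      filter_upwards [hdom ω] with τ hτ using hτ s hs
    · filter_upwards [hκc] with τ hτ using continuousOn_const.mul hτ
  · exact (hΦ.integrable_prod (hK.ofReal (𝕜 := ℂ))).norm.integral_prod_left
  · filter_upwards [hV, hKi] with ω h1 h2 s hs
    rw [h1 s hs]
    exact norm_integral_le_of_norm_le h2 ((hdom ω).mono fun τ h => h s hs)

end Noise

/-! ### Oscillatory integrals on the half-line -/

/-- The function equal to `x^(-α)` on `(0,1]` and to `x^(-β)` on `(1,∞)`. -/
def powerMajorant (α β x : ℝ) : ℝ := if x ≤ 1 then x ^ (-α) else x ^ (-β)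

lemma powerMajorant_nonneg (α β : ℝ) {x : ℝ} (hx : 0 ≤ x) : 0 ≤ powerMajorant α β x := by
  rw [powerMajorant]; split_ifs <;> positivity

lemma integrableOn_Ioi_powerMajorant {α β : ℝ} (hα : α < 1) (hβ : 1 < β) :
    IntegrableOn (powerMajorant α β) (Ioi 0) := by
  rw [← Ioc_union_Ioi_eq_Ioi (zero_le_one' ℝ)]
  refine IntegrableOn.union ?_ ?_
  · have h := (intervalIntegral.intervalIntegrable_rpow' (a := 0) (b := 1) (r := -α) (by linarith)).1
    refine h.congr_fun (fun x hx => ?_) measurableSet_Ioc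
    simp [powerMajorant, hx.2]
  · refine (integrableOn_Ioi_rpow_of_lt (a := -β) (by linarith) zero_lt_one).congr_fun
      (fun x hx => ?_) measurableSet_Ioi
    have : ¬ x ≤ 1 := not_le.2 hx
    simp [powerMajorant, this]

lemma integrable_powerMajorant_abs {α β : ℝ} (hα : α < 1) (hβ : 1 < β) :
    Integrable fun τ => powerMajorant α β |τ| := by
  have h := integrableOn_Ioi_powerMajorant hα hβ
  rw [← integrableOn_univ, ← Iic_union_Ioi (a := (0 : ℝ))]
  refine IntegrableOn.union ?_ ?_
  · have h2 := (h.comp_neg)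
    simp only [neg_zero, neg_Ioi] at h2
    rw [integrableOn_Iic_iff_integrableOn_Iio]
    refine h2.congr_fun (fun x hx => ?_) measurableSet_Iio
    simp only [abs_of_neg (mem_Iio.1 hx)]
  · refine h.congr_fun (fun x hx => ?_) measurableSet_Ioi
    simp only [abs_of_pos (mem_Ioi.1 hx)]

/-- The half-line Fourier integral `∫₀^∞ e^{itx} g(x) dx`. -/
def halfFourier (g : ℝ → ℂ) (t : ℝ) : ℂ := ∫ x in Ioi (0 : ℝ), Complex.exp (Complex.I * t * x) * g x

lemma norm_exp_I_mul_mul (t x : ℝ) : ‖Complex.exp (Complex.I * t * x)‖ = 1 := by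
  rw [mul_assoc, ← Complex.ofReal_mul, Complex.norm_exp_I_mul_ofReal]

lemma continuous_halfFourier {g : ℝ → ℂ} (hg : IntegrableOn g (Ioi 0)) :
    Continuous (halfFourier g) := by
  refine continuous_of_dominated (bound := fun x => ‖g x‖) (fun t => ?_)
    (fun t => Eventually.of_forall fun x => ?_) hg.norm (Eventually.of_forall fun x => by fun_prop)
  · exact AEStronglyMeasurable.mul (by fun_prop) hg.1
  · rw [norm_mul, norm_exp_I_mul_mul, one_mul]

lemma integrableOn_exp_mul {g : ℝ → ℂ} {S : Set ℝ} (hg : IntegrableOn g S) (t : ℝ) :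
    IntegrableOn (fun x : ℝ => Complex.exp (Complex.I * t * x) * g x) S := by
  refine Integrable.bdd_mul (c := 1) hg (by fun_prop) (Eventually.of_forall fun x => ?_)
  rw [norm_exp_I_mul_mul]

lemma hasDerivAt_exp_I_mul (t x : ℝ) : HasDerivAt (fun x : ℝ => Complex.exp (Complex.I * t * x))
    (Complex.I * t * Complex.exp (Complex.I * t * x)) x := by
  have h1 : HasDerivAt (fun x : ℝ => Complex.I * t * (x : ℂ)) (Complex.I * t) x := by
    simpa using (Complex.ofRealCLM.hasDerivAt (x := x)).const_mul (Complex.I * (t : ℂ))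
  simpa [mul_comm] using h1.cexp

/-- The exponent 1/2 is a compromise: it leaves an integrand √x ‖g x‖ that is integrable when g is
O(x⁻²), where the linear bound would leave only O(1/x) at infinity. -/
lemma norm_exp_I_mul_sub_one_le_sqrt (θ : ℝ) : ‖Complex.exp (Complex.I * θ) - 1‖ ≤ 2 * √|θ| := by
  rcases le_total |θ| 1 with h | h
  · refine Real.norm_exp_I_mul_ofReal_sub_one_le.trans ?_
    rw [Real.norm_eq_abs]
    have h1 := Real.sq_sqrt (abs_nonneg θ)
    have h2 : √|θ| ≤ 1 := Real.sqrt_le_one.2 h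
    nlinarith [Real.sqrt_nonneg |θ|]
  · have h1 : ‖Complex.exp (Complex.I * θ) - 1‖ ≤ 1 + 1 := by
      refine (norm_sub_le _ _).trans ?_
      rw [Complex.norm_exp_I_mul_ofReal, norm_one]
    have h2 : 1 ≤ √|θ| := Real.one_le_sqrt.2 h
    linarith

/-- Integration by parts on a half-line. -/
lemma integral_Ioi_exp_mul_deriv {g g' : ℝ → ℂ} {d t : ℝ}
    (hc : ContinuousWithinAt g (Ici d) d) (hd : ∀ x ∈ Ioi d, HasDerivAt g (g' x) x)
    (hg : IntegrableOn g (Ioi d)) (hg' : IntegrableOn g' (Ioi d)) (hlim : Tendsto g atTop (𝓝 0)) :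
    Complex.I * t * (∫ x in Ioi d, Complex.exp (Complex.I * t * x) * g x) =
      -(Complex.exp (Complex.I * t * d) * g d) -
        ∫ x in Ioi d, Complex.exp (Complex.I * t * x) * g' x := by
  have h1 : ∀ x ∈ Ioi d, HasDerivAt (fun x : ℝ => Complex.exp (Complex.I * t * x) * g x)
      (Complex.I * t * Complex.exp (Complex.I * t * x) * g x + Complex.exp (Complex.I * t * x) * g' x)
      x := fun x hx => (hasDerivAt_exp_I_mul t x).mul (hd x hx)
  have hi1 := integrableOn_exp_mul hg t
  have hi2 := integrableOn_exp_mul hg' t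
  have hi1' : IntegrableOn (fun x : ℝ => Complex.I * t * Complex.exp (Complex.I * t * x) * g x)
      (Ioi d) := (hi1.const_mul (Complex.I * t)).congr (Eventually.of_forall fun x => by
        simp only []; ring)
  have h2 := integral_Ioi_of_hasDerivAt_of_tendsto (m := 0)
    (f := fun x : ℝ => Complex.exp (Complex.I * t * x) * g x)
    (ContinuousWithinAt.mul (by fun_prop) hc) h1 (hi1'.add hi2) (by
      rw [tendsto_zero_iff_norm_tendsto_zero] at hlim ⊢
      refine hlim.congr fun x => ?_
      rw [norm_mul, norm_exp_I_mul_mul, one_mul])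
  rw [integral_add hi1' hi2] at h2
  have h3 : ∫ x in Ioi d, Complex.I * t * Complex.exp (Complex.I * t * x) * g x =
      Complex.I * t * ∫ x in Ioi d, Complex.exp (Complex.I * t * x) * g x := by
    rw [← integral_const_mul]
    refine integral_congr_ae (Eventually.of_forall fun x => ?_)
    simp only []; ring
  rw [h3] at h2
  linear_combination h2

lemma tendsto_zero_of_mul_norm_le {g : ℝ → ℂ} {C : ℝ} (h : ∀ x, 0 < x → x * ‖g x‖ ≤ C) :
    Tendsto g atTop (𝓝 0) := by
  rw [tendsto_zero_iff_norm_tendsto_zero]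
  have h1 : Tendsto (fun x : ℝ => C * x⁻¹) atTop (𝓝 0) := by
    simpa using tendsto_inv_atTop_zero.const_mul C
  refine squeeze_zero' (Eventually.of_forall fun x => norm_nonneg _) ?_ h1
  filter_upwards [eventually_gt_atTop 0] with x hx
  rw [← div_eq_mul_inv, le_div_iff₀ hx, mul_comm]
  exact h x hx

/-- A function with a singularity of order `x^(-1/2)` at the origin and decay of order `x⁻²`, whose
derivative is of order `x⁻²`. -/
structure HalfLineSymbol (g g' : ℝ → ℂ) (C : ℝ) : Prop where
  hasDerivAt : ∀ x, 0 < x → HasDerivAt g (g' x) x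
  measurable : Measurable g'
  bound_sqrt : ∀ x, 0 < x → √x * ‖g x‖ ≤ C
  bound_one : ∀ x, 0 < x → x * ‖g x‖ ≤ C
  bound_two : ∀ x, 0 < x → x ^ 2 * ‖g x‖ ≤ C
  bound_deriv : ∀ x, 0 < x → x ^ 2 * ‖g' x‖ ≤ C

namespace HalfLineSymbol

variable {g g' : ℝ → ℂ} {C : ℝ}

lemma nonneg (h : HalfLineSymbol g g' C) : 0 ≤ C :=
  (mul_nonneg zero_le_one (norm_nonneg _)).trans (h.bound_one 1 one_pos)

lemma continuousOn (h : HalfLineSymbol g g' C) : ContinuousOn g (Ioi 0) := fun x hx =>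
  (h.hasDerivAt x hx).continuousAt.continuousWithinAt

lemma norm_le (h : HalfLineSymbol g g' C) {x : ℝ} (hx : 0 < x) :
    ‖g x‖ ≤ C * powerMajorant (1 / 2) 2 x := by
  rw [powerMajorant]
  split_ifs with h1
  · have := h.bound_sqrt x hx
    rw [Real.rpow_neg hx.le, ← Real.sqrt_eq_rpow, ← div_eq_mul_inv,
      le_div_iff₀ (Real.sqrt_pos.2 hx), mul_comm]
    exact this
  · have := h.bound_two x hx
    rw [Real.rpow_neg hx.le, ← div_eq_mul_inv, le_div_iff₀ (by positivity), mul_comm]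
    exact_mod_cast this

lemma aestronglyMeasurable (h : HalfLineSymbol g g' C) :
    AEStronglyMeasurable g (volume.restrict (Ioi 0)) :=
  h.continuousOn.aestronglyMeasurable measurableSet_Ioi

lemma integrableOn (h : HalfLineSymbol g g' C) : IntegrableOn g (Ioi 0) :=
  ((integrableOn_Ioi_powerMajorant (by norm_num) (by norm_num)).const_mul C).mono'
    h.aestronglyMeasurable ((ae_restrict_mem measurableSet_Ioi).mono fun x hx => h.norm_le hx)

/-- Since g has integral zero, 1 may be subtracted from the exponential, and the difference is at
most 2√(|t|x). -/
lemma norm_halfFourier_le_sqrt (h : HalfLineSymbol g g' C) (h0 : ∫ x in Ioi (0 : ℝ), g x = 0) :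
    ∃ D, 0 ≤ D ∧ ∀ t : ℝ, ‖halfFourier g t‖ ≤ D * √|t| := by
  have hi : IntegrableOn (fun x => √x * ‖g x‖) (Ioi 0) := by
    have hm := (integrableOn_Ioi_powerMajorant (α := 0) (β := 3 / 2) (by norm_num)
      (by norm_num)).const_mul C
    refine hm.mono' (Real.continuous_sqrt.aestronglyMeasurable.mul h.aestronglyMeasurable.norm) ?_
    filter_upwards [ae_restrict_mem measurableSet_Ioi] with x hx
    have hx : 0 < x := hx
    rw [Real.norm_of_nonneg (by positivity), powerMajorant]
    split_ifs with h1
    · simpa using h.bound_sqrt x hx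
    · rw [Real.rpow_neg hx.le, ← div_eq_mul_inv, le_div_iff₀ (by positivity)]
      refine le_trans (le_of_eq ?_) (h.bound_two x hx)
      have : √x * x ^ (3 / 2 : ℝ) = x ^ 2 := by
        rw [Real.sqrt_eq_rpow, ← Real.rpow_add hx, ← Real.rpow_natCast]
        norm_num
      calc _ = √x * x ^ (3 / 2 : ℝ) * ‖g x‖ := by ring
        _ = _ := by rw [this]
  refine ⟨2 * ∫ x in Ioi (0 : ℝ), √x * ‖g x‖, ?_, fun t => ?_⟩
  · exact mul_nonneg zero_le_two (integral_nonneg fun x => by positivity)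
  · have h1 : halfFourier g t = ∫ x in Ioi (0 : ℝ), (Complex.exp (Complex.I * t * x) - 1) * g x := by
      simp only [sub_mul, one_mul]
      rw [integral_sub (integrableOn_exp_mul h.integrableOn t) h.integrableOn, h0, sub_zero]
      rfl
    rw [h1]
    calc _ ≤ ∫ x in Ioi (0 : ℝ), 2 * √|t| * (√x * ‖g x‖) := by
          refine norm_integral_le_of_norm_le (hi.const_mul _) ?_
          filter_upwards [ae_restrict_mem measurableSet_Ioi] with x hx
          have hx : 0 < x := hx
          have h2 := norm_exp_I_mul_sub_one_le_sqrt (t * x)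
          rw [abs_mul, Real.sqrt_mul (abs_nonneg t), abs_of_pos hx] at h2
          push_cast at h2
          rw [norm_mul, mul_assoc Complex.I]
          calc _ ≤ 2 * (√|t| * √x) * ‖g x‖ := by gcongr
            _ = _ := by ring
      _ = _ := by rw [integral_const_mul]; ring

lemma norm_integral_Ioc_le (h : HalfLineSymbol g g' C) {d : ℝ} (hd : 0 < d) (t : ℝ) :
    ‖∫ x in Ioc 0 d, Complex.exp (Complex.I * t * x) * g x‖ ≤ 2 * C * √d := by
  have hi := (intervalIntegral.intervalIntegrable_rpow' (a := 0) (b := d) (r := -(1 / 2))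
    (by norm_num)).1
  calc _ ≤ ∫ x in Ioc 0 d, C * x ^ (-(1 / 2) : ℝ) := by
        refine norm_integral_le_of_norm_le (hi.const_mul C) ?_
        filter_upwards [ae_restrict_mem measurableSet_Ioc] with x hx
        rw [norm_mul, norm_exp_I_mul_mul, one_mul, Real.rpow_neg hx.1.le, ← Real.sqrt_eq_rpow,
          ← div_eq_mul_inv, le_div_iff₀ (Real.sqrt_pos.2 hx.1), mul_comm]
        exact h.bound_sqrt x hx.1
    _ = _ := by
        rw [integral_const_mul, ← intervalIntegral.integral_of_le hd.le,
          integral_rpow (Or.inl (by norm_num)), Real.sqrt_eq_rpow]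
        norm_num
        ring

lemma norm_integral_Ioi_le (h : HalfLineSymbol g g' C) {d : ℝ} (hd : 0 < d) (t : ℝ) :
    |t| * ‖∫ x in Ioi d, Complex.exp (Complex.I * t * x) * g x‖ ≤ 2 * C / d := by
  have hsub : Ioi d ⊆ Ioi 0 := Ioi_subset_Ioi hd.le
  have hm : IntegrableOn (fun x : ℝ => C * x ^ (-2 : ℝ)) (Ioi d) :=
    (integrableOn_Ioi_rpow_of_lt (by norm_num) hd).const_mul C
  have hb : ∀ x ∈ Ioi d, ‖g' x‖ ≤ C * x ^ (-2 : ℝ) := by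
    intro x hx
    have hx0 : 0 < x := hsub hx
    rw [Real.rpow_neg hx0.le, ← div_eq_mul_inv, le_div_iff₀ (by positivity), mul_comm]
    exact_mod_cast h.bound_deriv x hx0
  have hg' : IntegrableOn g' (Ioi d) :=
    hm.mono' h.measurable.aestronglyMeasurable ((ae_restrict_mem measurableSet_Ioi).mono hb)
  have hp := integral_Ioi_exp_mul_deriv (t := t)
    (h.hasDerivAt d hd).continuousAt.continuousWithinAt (fun x hx => h.hasDerivAt x (hsub hx))
    (h.integrableOn.mono_set hsub) hg' (tendsto_zero_of_mul_norm_le h.bound_one)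
  have hn := congrArg norm hp
  rw [norm_mul, norm_mul, Complex.norm_I, one_mul, Complex.norm_real, Real.norm_eq_abs] at hn
  rw [hn]
  have h1 : ‖∫ x in Ioi d, Complex.exp (Complex.I * t * x) * g' x‖ ≤ C / d := by
    calc _ ≤ ∫ x in Ioi d, C * x ^ (-2 : ℝ) := by
          refine norm_integral_le_of_norm_le hm ?_
          filter_upwards [ae_restrict_mem measurableSet_Ioi] with x hx
          rw [norm_mul, norm_exp_I_mul_mul, one_mul]
          exact hb x hx
      _ = _ := by
          rw [integral_const_mul, integral_Ioi_rpow_of_lt (by norm_num) hd]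
          norm_num
          rw [Real.rpow_neg_one]; rfl
  have h2 : ‖-(Complex.exp (Complex.I * t * d) * g d)‖ ≤ C / d := by
    rw [norm_neg, norm_mul, norm_exp_I_mul_mul, one_mul, le_div_iff₀ hd, mul_comm]
    exact h.bound_one d hd
  calc _ ≤ C / d + C / d := (norm_sub_le _ _).trans (add_le_add h2 h1)
    _ = _ := by ring

lemma norm_halfFourier_le_rpow (h : HalfLineSymbol g g' C) {t : ℝ} (ht : t ≠ 0) :
    ‖halfFourier g t‖ ≤ 4 * C * |t| ^ (-(1 / 3) : ℝ) := by
  have ht0 : 0 < |t| := abs_pos.2 ht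
  -- Balances the contribution √d of (0,d] against 1/(d|t|), obtained on (d,∞) by integration by
  -- parts.
  set d := |t| ^ (-(2 / 3) : ℝ) with hd
  have hd0 : 0 < d := by positivity
  have hs : halfFourier g t = (∫ x in Ioc 0 d, Complex.exp (Complex.I * t * x) * g x) +
      ∫ x in Ioi d, Complex.exp (Complex.I * t * x) * g x := by
    have hi := integrableOn_exp_mul h.integrableOn t
    rw [halfFourier, ← Ioc_union_Ioi_eq_Ioi hd0.le, setIntegral_union (Ioc_disjoint_Ioi le_rfl)
      measurableSet_Ioi (hi.mono_set Ioc_subset_Ioi_self) (hi.mono_set (Ioi_subset_Ioi hd0.le))]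
  have h1 := h.norm_integral_Ioc_le hd0 t
  have h2 := h.norm_integral_Ioi_le hd0 t
  have e1 : √d = |t| ^ (-(1 / 3) : ℝ) := by
    rw [Real.sqrt_eq_rpow, hd, ← Real.rpow_mul ht0.le]; norm_num
  have e2 : 2 * C / d = |t| * (2 * C * |t| ^ (-(1 / 3) : ℝ)) := by
    have : |t| * |t| ^ (-(1 / 3) : ℝ) * d = 1 := by
      rw [hd, ← Real.rpow_one_add' ht0.le (by norm_num), ← Real.rpow_add ht0]; norm_num
    rw [div_eq_iff hd0.ne']
    linear_combination (-2 * C) * this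
  rw [e1] at h1
  rw [e2] at h2
  have h3 := le_of_mul_le_mul_left h2 ht0
  rw [hs]
  refine (norm_add_le _ _).trans ?_
  linarith

end HalfLineSymbol

/-! ### Consequences of the regularity of the Fourier transform of the wavelet -/

/-- Derivatives of a function on `(0,∞)` together with uniform weighted bounds. -/
structure WeightedDerivBounds (f f₁ f₂ f₃ : ℝ → ℂ) (C : ℝ) : Prop where
  hasDerivAt_zero : ∀ x, 0 < x → HasDerivAt f (f₁ x) x
  hasDerivAt_one : ∀ x, 0 < x → HasDerivAt f₁ (f₂ x) x
  hasDerivAt_two : ∀ x, 0 < x → HasDerivAt f₂ (f₃ x) x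
  measurable_two : Measurable f₂
  measurable_three : Measurable f₃
  zero_two : ∀ x, 1 < x → x ^ 2 * ‖f x‖ ≤ C
  one_zero : ∀ x, 0 < x → ‖f₁ x‖ ≤ C
  one_one : ∀ x, 0 < x → x * ‖f₁ x‖ ≤ C
  one_two : ∀ x, 0 < x → x ^ 2 * ‖f₁ x‖ ≤ C
  two_two : ∀ x, 0 < x → x ^ 2 * ‖f₂ x‖ ≤ C
  two_three : ∀ x, 0 < x → x ^ 3 * ‖f₂ x‖ ≤ C
  three_three : ∀ x, 0 < x → x ^ 3 * ‖f₃ x‖ ≤ C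

lemma FourierSideRegularity.weightedDerivBounds {f : ℝ → ℂ} (h : FourierSideRegularity f) :
    ∃ C, WeightedDerivBounds f (deriv f) (iteratedDeriv 2 f) (iteratedDeriv 3 f) C := by
  obtain ⟨c02, h02⟩ := h.bound_zero 2 (by norm_num) le_rfl
  obtain ⟨c10, h10⟩ := h.bound_one 0 (by norm_num)
  obtain ⟨c11, h11⟩ := h.bound_one 1 (by norm_num)
  obtain ⟨c12, h12⟩ := h.bound_one 2 (by norm_num)
  obtain ⟨c22, h22⟩ := h.bound_two 2 (by norm_num) (by norm_num)
  obtain ⟨c23, h23⟩ := h.bound_two 3 (by norm_num) (by norm_num)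
  obtain ⟨c33, h33⟩ := h.bound_three
  have hd : ∀ k < 3, ∀ x : ℝ, 0 < x →
      HasDerivAt (iteratedDeriv k f) (iteratedDeriv (k + 1) f x) x := by
    intro k hk x hx
    rw [iteratedDeriv_succ]
    exact ((h.differentiable k hk).differentiableAt (Ioi_mem_nhds hx)).hasDerivAt
  refine ⟨|c02| + |c10| + |c11| + |c12| + |c22| + |c23| + |c33|, ?_, ?_, ?_, ?_, ?_, ?_, ?_, ?_, ?_,
    ?_, ?_, ?_⟩
  · intro x hx
    simpa using hd 0 (by norm_num) x hx
  · intro x hx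
    simpa using hd 1 (by norm_num) x hx
  · exact hd 2 (by norm_num)
  · rw [iteratedDeriv_succ]; exact measurable_deriv _
  · rw [iteratedDeriv_succ]; exact measurable_deriv _
  all_goals
    intro x hx
    have e0 := abs_nonneg c02
    have e1 := abs_nonneg c10
    have e2 := abs_nonneg c11
    have e3 := abs_nonneg c12
    have e4 := abs_nonneg c22
    have e5 := abs_nonneg c23
    have e6 := abs_nonneg c33
  · linarith [h02 x hx, le_abs_self c02]
  · have := h10 x hx
    rw [pow_zero, one_mul] at this
    linarith [le_abs_self c10]
  · have := h11 x hx
    rw [pow_one] at this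
    linarith [le_abs_self c11]
  · linarith [h12 x hx, le_abs_self c12]
  · linarith [h22 x hx, le_abs_self c22]
  · linarith [h23 x hx, le_abs_self c23]
  · linarith [h33 x hx, le_abs_self c33]

namespace WeightedDerivBounds

variable {f f₁ f₂ f₃ : ℝ → ℂ} {C : ℝ}

lemma nonneg (h : WeightedDerivBounds f f₁ f₂ f₃ C) : 0 ≤ C :=
  (norm_nonneg _).trans (h.one_zero 1 one_pos)

/-- A Landau type interpolation inequality. -/
lemma two_sqrt (h : WeightedDerivBounds f f₁ f₂ f₃ C) {x : ℝ} (hx : 0 < x) :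
    x * √x * ‖f₂ x‖ ≤ 3 * C := by
  have hs : 0 < √x := Real.sqrt_pos.2 hx
  have hss : √x * √x = x := Real.mul_self_sqrt hx.le
  -- Comparing f₁(x+δ) - f₁(x) with δ f₂(x) costs at most Cδ²/x³. This δ makes the cost equal to C,
  -- and the increment itself is at most 2C.
  set δ := x * √x with hδ
  have hδ0 : 0 < δ := by positivity
  have hpos : ∀ y ∈ Icc x (x + δ), 0 < y := fun y hy => hx.trans_le hy.1
  have hC := h.nonneg
  have h2 : ∀ y ∈ Icc x (x + δ), ‖f₂ y - f₂ x‖ ≤ C / x ^ 3 * δ := by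
    intro y hy
    have := (convex_Icc x (x + δ)).norm_image_sub_le_of_norm_hasDerivWithin_le (f := f₂) (f' := f₃)
      (C := C / x ^ 3) (fun z hz => (h.hasDerivAt_two z (hpos z hz)).hasDerivWithinAt)
      (fun z hz => by
        rw [le_div_iff₀ (by positivity), mul_comm]
        refine le_trans ?_ (h.three_three z (hpos z hz))
        gcongr
        exact hz.1) (left_mem_Icc.2 (by linarith)) hy
    refine this.trans ?_
    gcongr
    rw [Real.norm_of_nonneg (by linarith [hy.1])]
    linarith [hy.2]
  have h3 := (convex_Icc x (x + δ)).norm_image_sub_le_of_norm_hasDerivWithin_le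
      (f := fun y : ℝ => f₁ y - ((y - x : ℝ) : ℂ) * f₂ x) (f' := fun y => f₂ y - f₂ x)
      (C := C / x ^ 3 * δ) (fun z hz => by
        have e : HasDerivAt (fun y : ℝ => ((y - x : ℝ) : ℂ) * f₂ x) (f₂ x) z := by
          have := ((hasDerivAt_id z).sub_const x).ofReal_comp.mul_const (f₂ x)
          simpa using this
        exact ((h.hasDerivAt_one z (hpos z hz)).sub e).hasDerivWithinAt)
      h2 (left_mem_Icc.2 (by linarith)) (right_mem_Icc.2 (by linarith))
  simp only [add_sub_cancel_left, sub_self, Complex.ofReal_zero, zero_mul, sub_zero] at h3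
  rw [Real.norm_of_nonneg hδ0.le] at h3
  have e1 : C / x ^ 3 * δ * δ = C := by
    have : δ * δ = x ^ 3 := by
      rw [hδ]; linear_combination x ^ 2 * hss
    rw [mul_assoc, this]
    field_simp
  rw [e1] at h3
  have e2 : (δ : ℂ) * f₂ x = f₁ (x + δ) - f₁ x - (f₁ (x + δ) - (δ : ℂ) * f₂ x - f₁ x) := by ring
  have e3 : ‖(δ : ℂ) * f₂ x‖ = δ * ‖f₂ x‖ := by
    rw [norm_mul, Complex.norm_real, Real.norm_of_nonneg hδ0.le]
  rw [← e3, e2]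
  have b1 := h.one_zero (x + δ) (by linarith)
  have b2 := h.one_zero x hx
  linarith [norm_sub_le (f₁ (x + δ) - f₁ x) (f₁ (x + δ) - (δ : ℂ) * f₂ x - f₁ x),
    norm_sub_le (f₁ (x + δ)) (f₁ x)]

lemma hasDerivAt_symbol (h : WeightedDerivBounds f f₁ f₂ f₃ C) {x : ℝ} (hx : 0 < x) :
    HasDerivAt (fun x : ℝ => (x : ℂ) * f₁ x) (f₁ x + x * f₂ x) x := by
  have h1 := (hasDerivAt_id x).ofReal_comp.mul (h.hasDerivAt_one x hx)
  simp only [id_eq, Complex.ofReal_one, one_mul] at h1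
  exact h1

/-- The symbol is the derivative of x f₁(x). Its x^(-1/2) bound near the origin comes from the
interpolation `two_sqrt`; the others come from the weighted bounds directly. -/
lemma halfLineSymbol (h : WeightedDerivBounds f f₁ f₂ f₃ C) :
    HalfLineSymbol (fun x => f₁ x + x * f₂ x) (fun x => 2 * f₂ x + x * f₃ x) (4 * C) := by
  have hC := h.nonneg
  have hn : ∀ x : ℝ, 0 < x → ‖f₁ x + x * f₂ x‖ ≤ ‖f₁ x‖ + x * ‖f₂ x‖ := fun x hx => by
    refine (norm_add_le _ _).trans (le_of_eq ?_)
    rw [norm_mul, Complex.norm_real, Real.norm_of_nonneg hx.le]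
  have b1 : ∀ x : ℝ, 0 < x → x * ‖f₁ x + x * f₂ x‖ ≤ 2 * C := fun x hx => by
    calc _ ≤ x * (‖f₁ x‖ + x * ‖f₂ x‖) := by gcongr; exact hn x hx
      _ = x * ‖f₁ x‖ + x ^ 2 * ‖f₂ x‖ := by ring
      _ ≤ _ := by linarith [h.one_one x hx, h.two_two x hx]
  refine ⟨fun x hx => ?_, ?_, fun x hx => ?_, fun x hx => ?_, fun x hx => ?_, fun x hx => ?_⟩
  · have h1 : HasDerivAt (fun x : ℝ => (x : ℂ) * f₂ x) (f₂ x + x * f₃ x) x := by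
      have h1 := (hasDerivAt_id x).ofReal_comp.mul (h.hasDerivAt_two x hx)
      simp only [id_eq, Complex.ofReal_one, one_mul] at h1
      exact h1
    have h2 := (h.hasDerivAt_one x hx).add h1
    rw [show f₂ x + (f₂ x + x * f₃ x) = 2 * f₂ x + x * f₃ x by ring] at h2
    exact h2
  · exact (h.measurable_two.const_mul 2).add
      (Complex.measurable_ofReal.mul h.measurable_three)
  · rcases le_total x 1 with hx1 | hx1
    · have hs1 : √x ≤ 1 := Real.sqrt_le_one.2 hx1
      calc _ ≤ √x * (‖f₁ x‖ + x * ‖f₂ x‖) := by gcongr; exact hn x hx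
        _ = √x * ‖f₁ x‖ + x * √x * ‖f₂ x‖ := by ring
        _ ≤ 1 * C + 3 * C := add_le_add (mul_le_mul hs1 (h.one_zero x hx) (norm_nonneg _)
            zero_le_one) (h.two_sqrt hx)
        _ = _ := by ring
    · have hs1 : √x ≤ x := by
        rw [Real.sqrt_le_left hx.le]; nlinarith
      calc _ ≤ x * ‖f₁ x + x * f₂ x‖ := by gcongr
        _ ≤ _ := by linarith [b1 x hx]
  · linarith [b1 x hx]
  · calc _ ≤ x ^ 2 * (‖f₁ x‖ + x * ‖f₂ x‖) := by gcongr; exact hn x hx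
      _ = x ^ 2 * ‖f₁ x‖ + x ^ 3 * ‖f₂ x‖ := by ring
      _ ≤ _ := by linarith [h.one_two x hx, h.two_three x hx]
  · calc _ ≤ x ^ 2 * (2 * ‖f₂ x‖ + x * ‖f₃ x‖) := by
          gcongr
          refine (norm_add_le _ _).trans (le_of_eq ?_)
          rw [norm_mul, norm_mul, Complex.norm_real, Real.norm_of_nonneg hx.le]
          norm_num
      _ = 2 * (x ^ 2 * ‖f₂ x‖) + x ^ 3 * ‖f₃ x‖ := by ring
      _ ≤ _ := by linarith [h.two_two x hx, h.three_three x hx]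

/-- The primitive x f₁(x) tends to 0 at both ends of the half-line. -/
lemma integral_symbol (h : WeightedDerivBounds f f₁ f₂ f₃ C) :
    ∫ x in Ioi (0 : ℝ), (f₁ x + x * f₂ x) = 0 := by
  have hl0 : Tendsto (fun x : ℝ => (x : ℂ) * f₁ x) (𝓝[>] 0) (𝓝 0) := by
    rw [tendsto_zero_iff_norm_tendsto_zero]
    have h1 : Tendsto (fun x : ℝ => x * C) (𝓝[>] 0) (𝓝 0) := by
      have h2 : Continuous fun x : ℝ => x * C := by fun_prop
      simpa using (h2.tendsto 0).mono_left (nhdsWithin_le_nhds (s := Ioi 0))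
    refine squeeze_zero' (Eventually.of_forall fun x => norm_nonneg _) ?_ h1
    filter_upwards [self_mem_nhdsWithin] with x hx
    have hx : 0 < x := hx
    rw [norm_mul, Complex.norm_real, Real.norm_of_nonneg hx.le]
    gcongr
    exact h.one_zero x hx
  have hl1 : Tendsto (fun x : ℝ => (x : ℂ) * f₁ x) atTop (𝓝 0) := by
    refine tendsto_zero_of_mul_norm_le (C := C) fun x hx => ?_
    rw [norm_mul, Complex.norm_real, Real.norm_of_nonneg hx.le]
    exact (le_of_eq (by ring)).trans (h.one_two x hx)
  have h2 := integral_Ioi_of_hasDerivAt_of_tendsto (a := (0 : ℝ)) (m := 0)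
    (f := fun x : ℝ => (x : ℂ) * f₁ x) (f' := fun x => f₁ x + x * f₂ x)
    (by
      rw [← continuousWithinAt_Ioi_iff_Ici, ContinuousWithinAt, Complex.ofReal_zero, zero_mul]
      exact hl0) (fun x hx => h.hasDerivAt_symbol hx) h.halfLineSymbol.integrableOn hl1
  simpa using h2

lemma continuousOn_one (h : WeightedDerivBounds f f₁ f₂ f₃ C) : ContinuousOn f₁ (Ioi 0) :=
  fun x hx => (h.hasDerivAt_one x hx).continuousAt.continuousWithinAt

lemma norm_one_le (h : WeightedDerivBounds f f₁ f₂ f₃ C) {x : ℝ} (hx : 0 < x) :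
    ‖f₁ x‖ ≤ C * powerMajorant 0 2 x := by
  rw [powerMajorant]
  split_ifs with h1
  · simpa using h.one_zero x hx
  · rw [Real.rpow_neg hx.le, ← div_eq_mul_inv, le_div_iff₀ (by positivity), mul_comm]
    exact_mod_cast h.one_two x hx

lemma integrableOn_one (h : WeightedDerivBounds f f₁ f₂ f₃ C) : IntegrableOn f₁ (Ioi 0) :=
  ((integrableOn_Ioi_powerMajorant (by norm_num) (by norm_num)).const_mul C).mono'
    (h.continuousOn_one.aestronglyMeasurable measurableSet_Ioi)
    ((ae_restrict_mem measurableSet_Ioi).mono fun x hx => h.norm_one_le hx)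

lemma integrableOn_zero (h : WeightedDerivBounds f f₁ f₂ f₃ C) (hf : Continuous f) :
    IntegrableOn f (Ioi 0) := by
  rw [← Ioc_union_Ioi_eq_Ioi (zero_le_one' ℝ)]
  refine IntegrableOn.union (hf.integrableOn_Ioc) ?_
  refine ((integrableOn_Ioi_rpow_of_lt (a := -2) (by norm_num) zero_lt_one).const_mul C).mono'
    hf.aestronglyMeasurable ((ae_restrict_mem measurableSet_Ioi).mono fun x hx => ?_)
  have hx : 1 < x := hx
  have hx0 : 0 < x := by linarith
  rw [Real.rpow_neg hx0.le, ← div_eq_mul_inv, le_div_iff₀ (by positivity), mul_comm]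
  exact_mod_cast h.zero_two x hx

lemma tendsto_zero_atTop (h : WeightedDerivBounds f f₁ f₂ f₃ C) : Tendsto f atTop (𝓝 0) := by
  rw [tendsto_zero_iff_norm_tendsto_zero]
  have h1 : Tendsto (fun x : ℝ => C * x⁻¹) atTop (𝓝 0) := by
    simpa using tendsto_inv_atTop_zero.const_mul C
  refine squeeze_zero' (Eventually.of_forall fun x => norm_nonneg _) ?_ h1
  filter_upwards [eventually_gt_atTop 1] with x hx
  rw [← div_eq_mul_inv, le_div_iff₀ (by linarith), mul_comm]
  refine le_trans ?_ (h.zero_two x hx)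
  gcongr
  nlinarith

end WeightedDerivBounds

/-! ### Fourier inversion almost everywhere -/

section Inversion

open scoped FourierTransform

lemma integral_fourier_mul_flip {f g : ℝ → ℂ} (hf : Integrable f) (hg : Integrable g) :
    ∫ ξ, 𝓕 f ξ * g ξ = ∫ x, f x * 𝓕 g x := by
  simpa using! (VectorFourier.integral_fourierIntegral_smul_eq_flip (L := innerₗ ℝ)
    Real.continuous_fourierChar continuous_inner hf hg)

/-- As ψ need not be continuous, both sides are tested against smooth compactly supported functions.
The multiplication formula moves the transforms onto the test function, where Schwartz inversion
applies. -/
lemma ae_eq_fourierInv_fourier {ψ : ℝ → ℂ} (hψ : Integrable ψ) (hψ' : Integrable (𝓕 ψ)) :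
    ∀ᵐ t, ψ t = 𝓕⁻ (𝓕 ψ) t := by
  have hneg : Integrable fun x => 𝓕 ψ (-x) := hψ'.comp_neg
  have hloc : LocallyIntegrable (𝓕⁻ (𝓕 ψ)) := by
    refine Continuous.locallyIntegrable ?_
    rw [Real.fourierInv_eq_fourier_comp_neg]
    exact VectorFourier.fourierIntegral_continuous Real.continuous_fourierChar
      (L := innerₗ ℝ) continuous_inner hneg
  refine ae_eq_of_integral_contDiff_smul_eq hψ.locallyIntegrable hloc fun g hg hgc => ?_
  have hgc' : HasCompactSupport fun x => (g x : ℂ) := hgc.comp_left Complex.ofReal_zero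
  set G : SchwartzMap ℝ ℂ := hgc'.toSchwartzMap (Complex.ofRealCLM.contDiff.comp hg) with hG
  have hGx : ∀ x, G x = g x := fun x => rfl
  have h1 : ∫ x, G x * 𝓕⁻ (𝓕 ψ) x = ∫ x, 𝓕⁻ G x * 𝓕 ψ x := by
    rw [Real.fourierInv_eq_fourier_comp_neg, ← integral_fourier_mul_flip G.integrable hneg,
      ← integral_neg_eq_self]
    refine integral_congr_ae (Eventually.of_forall fun x => ?_)
    simp only [neg_neg]
    rw [SchwartzMap.fourierInv_coe, Real.fourierInv_eq_fourier_neg]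
  have h2 : ∫ x, 𝓕 ψ x * 𝓕⁻ G x = ∫ x, ψ x * G x := by
    rw [integral_fourier_mul_flip hψ (SchwartzMap.integrable _), ← SchwartzMap.fourier_coe,
      FourierInvPair.fourier_fourierInv_eq]
  simp only [Complex.real_smul, ← hGx]
  rw [h1]
  simp only [mul_comm (𝓕⁻ G _)]
  rw [h2]
  simp only [mul_comm]

lemma fourier_eq_fourierHat (ψ : ℝ → ℂ) (v : ℝ) : 𝓕 ψ v = fourierHat ψ (2 * Real.pi * v) := by
  rw [Real.fourier_real_eq_integral_exp_smul, fourierHat]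
  refine integral_congr_ae (Eventually.of_forall fun t => ?_)
  simp only [smul_eq_mul]
  congr 2
  push_cast
  ring

end Inversion

lemma continuous_fourierHat {ψ : ℝ → ℂ} (hψ : Integrable ψ) : Continuous (fourierHat ψ) := by
  refine continuous_of_dominated (bound := fun τ => ‖ψ τ‖) (fun l => ?_)
    (fun l => Eventually.of_forall fun τ => ?_) hψ.norm (Eventually.of_forall fun τ => by fun_prop)
  · exact AEStronglyMeasurable.mul (by fun_prop) hψ.1
  · rw [norm_mul, mul_assoc, ← mul_neg, ← Complex.ofReal_mul, ← Complex.ofReal_neg,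
      Complex.norm_exp_I_mul_ofReal, one_mul]

lemma IsAnalyticWavelet.ae_eq_halfFourier {ψ : ℝ → ℂ} (hψ : IsAnalyticWavelet ψ)
    (hf : IntegrableOn (fourierHat ψ) (Ioi 0)) :
    ∀ᵐ t, ψ t = ((2 * Real.pi : ℝ) : ℂ)⁻¹ * halfFourier (fourierHat ψ) t := by
  have hpi : 0 < 2 * Real.pi := by positivity
  have hf' : Integrable (fourierHat ψ) := by
    rw [← integrableOn_univ, ← Iic_union_Ioi (a := (0 : ℝ))]
    refine IntegrableOn.union ?_ hf
    exact integrableOn_zero.congr_fun (fun x hx => (hψ.analytic x hx).symm) measurableSet_Iic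
  have hF : FourierTransform.fourier ψ = fun v => fourierHat ψ (2 * Real.pi * v) :=
    funext fun v => fourier_eq_fourierHat ψ v
  have hi : Integrable (FourierTransform.fourier ψ) := by
    rw [hF]
    exact hf'.comp_mul_left' hpi.ne'
  filter_upwards [ae_eq_fourierInv_fourier hψ.integrable hi] with t ht
  rw [ht, hF, Real.fourierInv_eq']
  have h1 := Measure.integral_comp_mul_left
    (fun x : ℝ => Complex.exp (Complex.I * t * x) * fourierHat ψ x) (2 * Real.pi)
  rw [abs_of_pos (by positivity), Complex.real_smul, Complex.ofReal_inv] at h1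
  have h2 : ∫ x : ℝ, Complex.exp (Complex.I * t * x) * fourierHat ψ x =
      halfFourier (fourierHat ψ) t := by
    rw [halfFourier, setIntegral_eq_integral_of_forall_compl_eq_zero]
    intro x hx
    rw [hψ.analytic x (not_lt.1 hx), mul_zero]
  rw [h2] at h1
  rw [← h1]
  refine integral_congr_ae (Eventually.of_forall fun v => ?_)
  simp only [smul_eq_mul]
  congr 2
  simp only [RCLike.inner_apply, conj_trivial]
  push_cast
  ring

/-! ### Scaling -/

lemma halfFourier_comp_mul (g : ℝ → ℂ) {s : ℝ} (hs : 0 < s) (t : ℝ) :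
    halfFourier (fun x => g (s * x)) t = (s : ℂ)⁻¹ * halfFourier g (t / s) := by
  have h := integral_comp_mul_left_Ioi
    (fun x : ℝ => Complex.exp (Complex.I * (t / s : ℝ) * x) * g x) 0 hs
  rw [mul_zero, Complex.real_smul, Complex.ofReal_inv] at h
  rw [halfFourier, halfFourier, ← h]
  refine integral_congr_ae (Eventually.of_forall fun x => ?_)
  have hs' : (s : ℂ) ≠ 0 := by exact_mod_cast hs.ne'
  simp only []
  congr 2
  push_cast
  field_simp

lemma ae_comp_div {q : ℝ → Prop} (h : ∀ᵐ t, q t) {s : ℝ} (hs : 0 < s) : ∀ᵐ t : ℝ, q (t / s) := by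
  have hm : Measure.QuasiMeasurePreserving (fun t : ℝ => s⁻¹ * t) := by
    refine ⟨by fun_prop, ?_⟩
    rw [Real.map_volume_mul_left (inv_ne_zero hs.ne')]
    exact Measure.smul_absolutelyContinuous
  filter_upwards [hm.ae h] with t ht
  rwa [div_eq_inv_mul]

lemma powerMajorant_anti {α β : ℝ} (hα : 0 ≤ α) (hβ : 0 ≤ β) {x y : ℝ} (hx : 0 < x) (hxy : x ≤ y) :
    powerMajorant α β y ≤ powerMajorant α β x := by
  rw [powerMajorant, powerMajorant]
  split_ifs with h1 h2 h2
  · exact Real.rpow_le_rpow_of_nonpos hx hxy (by linarith)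
  · linarith
  · exact (Real.rpow_le_one_of_one_le_of_nonpos (by linarith) (by linarith)).trans
      (Real.one_le_rpow_of_pos_of_le_one_of_nonpos hx h2 (by linarith))
  · exact Real.rpow_le_rpow_of_nonpos hx hxy (by linarith)

/-- The kernel `(1/s) conj ψ(τ/s)`, expressed through `f = ψ̂`. -/
def waveletKernel (f : ℝ → ℂ) (s τ : ℝ) : ℂ :=
  ((2 * Real.pi : ℝ) : ℂ)⁻¹ * (starRingEnd ℂ) ((s : ℂ)⁻¹ * halfFourier f (τ / s))

/-- The derivative of `waveletKernel f` in the scale, with `g x = (x f'(x))'`. -/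
def waveletKernelDeriv (g : ℝ → ℂ) (s τ : ℝ) : ℂ :=
  ((2 * Real.pi : ℝ) : ℂ)⁻¹ *
    (starRingEnd ℂ) (Complex.I / τ * ((s : ℂ)⁻¹ * halfFourier g (τ / s)))

namespace WeightedDerivBounds

variable {f f₁ f₂ f₃ : ℝ → ℂ} {C : ℝ}

/-- Integration by parts without boundary term, as f(0) = 0. It gains 1/τ and cancels the prefactor
1/s, leaving the scale only in the argument τ/s. -/
lemma halfFourier_eq (h : WeightedDerivBounds f f₁ f₂ f₃ C) (hf : Continuous f) (h0 : f 0 = 0)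
    {s τ : ℝ} (hs : 0 < s) (hτ : τ ≠ 0) :
    (s : ℂ)⁻¹ * halfFourier f (τ / s) = Complex.I / τ * halfFourier f₁ (τ / s) := by
  have h1 := integral_Ioi_exp_mul_deriv (t := τ / s) (d := 0) hf.continuousAt.continuousWithinAt
    (fun x hx => h.hasDerivAt_zero x hx) (h.integrableOn_zero hf) h.integrableOn_one
    h.tendsto_zero_atTop
  rw [h0, mul_zero, neg_zero, zero_sub] at h1
  have hs' : (s : ℂ) ≠ 0 := by exact_mod_cast hs.ne'
  have hτ' : (τ : ℂ) ≠ 0 := by exact_mod_cast hτ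
  have h2 : halfFourier f₁ (τ / s) = -(Complex.I * (τ / s : ℝ) * halfFourier f (τ / s)) := by
    rw [halfFourier, halfFourier, h1, neg_neg]
  rw [h2]
  push_cast
  field_simp
  linear_combination (halfFourier f (τ / s)) * Complex.I_sq

/-- Differentiating exp(iτx/s) directly would produce x f₁(x), for which the bounds give only
O(1/x). The substitution x ↦ sx moves the scale into f₁ and leaves an absolutely integrable
derivative. -/
lemma hasDerivAt_halfFourier_div (h : WeightedDerivBounds f f₁ f₂ f₃ C) {s : ℝ} (hs : 0 < s)
    (τ : ℝ) : HasDerivAt (fun s : ℝ => halfFourier f₁ (τ / s))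
      ((s : ℂ)⁻¹ * halfFourier (fun x => f₁ x + x * f₂ x) (τ / s)) s := by
  have hS := h.halfLineSymbol
  -- Scales above c share one majorant, because `powerMajorant` is decreasing for these exponents.
  set c := s / 2 with hc
  have hc0 : 0 < c := by positivity
  have hcs : c < s := by rw [hc]; linarith
  have hi : ∀ r : ℝ, 0 < r → IntegrableOn (fun x => f₁ (r * x)) (Ioi 0) := fun r hr => by
    rw [integrableOn_Ioi_comp_mul_left_iff _ _ hr, mul_zero]
    exact h.integrableOn_one
  have hiG : ∀ r : ℝ, 0 < r → IntegrableOn (fun x : ℝ => f₁ (r * x) + (r * x : ℝ) * f₂ (r * x))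
      (Ioi 0) := fun r hr => by
    rw [integrableOn_Ioi_comp_mul_left_iff (fun x : ℝ => f₁ x + x * f₂ x) _ hr, mul_zero]
    exact hS.integrableOn
  have hb : IntegrableOn (fun x => 4 * C * powerMajorant (1 / 2) 2 (c * x)) (Ioi 0) := by
    refine Integrable.const_mul ?_ _
    have := integrableOn_Ioi_powerMajorant (α := 1 / 2) (β := 2) (by norm_num) (by norm_num)
    exact (integrableOn_Ioi_comp_mul_left_iff (powerMajorant (1 / 2) 2) 0 hc0).2
      (by rwa [mul_zero])
  have key := (hasDerivAt_integral_of_dominated_loc_of_deriv_le (μ := volume.restrict (Ioi 0))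
    (F := fun (r : ℝ) (x : ℝ) => Complex.exp (Complex.I * τ * x) * ((r : ℂ) * f₁ (r * x)))
    (F' := fun (r : ℝ) (x : ℝ) => Complex.exp (Complex.I * τ * x) *
      (f₁ (r * x) + (r * x : ℝ) * f₂ (r * x)))
    (bound := fun x => 4 * C * powerMajorant (1 / 2) 2 (c * x)) (x₀ := s) (Ioi_mem_nhds hcs)
    (by
      filter_upwards [Ioi_mem_nhds hcs] with r hr
      exact (integrableOn_exp_mul ((hi r (hc0.trans hr)).const_mul _) τ).1)
    (integrableOn_exp_mul ((hi s hs).const_mul _) τ)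
    (integrableOn_exp_mul (hiG s hs) τ).1
    (by
      filter_upwards [ae_restrict_mem measurableSet_Ioi] with x hx r hr
      have hx : 0 < x := hx
      have hr : c < r := hr
      rw [norm_mul, norm_exp_I_mul_mul, one_mul]
      refine (hS.norm_le (mul_pos (hc0.trans hr) hx)).trans ?_
      gcongr
      · exact hS.nonneg
      · exact powerMajorant_anti (by norm_num) (by norm_num) (by positivity) (by gcongr))
    hb
    (by
      filter_upwards [ae_restrict_mem measurableSet_Ioi] with x hx r hr
      have hx : 0 < x := hx
      have hr : 0 < r := hc0.trans hr
      have h1 : HasDerivAt (fun r : ℝ => f₁ (r * x)) ((x : ℂ) * f₂ (r * x)) r := by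
        have := (h.hasDerivAt_one (r * x) (by positivity)).scomp r ((hasDerivAt_id r).mul_const x)
        rw [one_mul, Complex.real_smul] at this
        exact this
      have h2 : HasDerivAt (fun r : ℝ => (r : ℂ) * f₁ (r * x))
          (1 * f₁ (r * x) + r * ((x : ℂ) * f₂ (r * x))) r :=
        (hasDerivAt_id r).ofReal_comp.mul h1
      have h3 := h2.const_mul (Complex.exp (Complex.I * τ * x))
      rw [one_mul, ← mul_assoc (r : ℂ), ← Complex.ofReal_mul] at h3
      exact h3)).2
  have e1 : ∀ r : ℝ, 0 < r →
      ∫ x in Ioi (0 : ℝ), Complex.exp (Complex.I * τ * x) * ((r : ℂ) * f₁ (r * x)) =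
        halfFourier f₁ (τ / r) := fun r hr => by
    have hr' : (r : ℂ) ≠ 0 := by exact_mod_cast hr.ne'
    have h1 := halfFourier_comp_mul f₁ hr τ
    rw [halfFourier, eq_comm, inv_mul_eq_iff_eq_mul₀ hr', ← integral_const_mul] at h1
    rw [h1]
    refine integral_congr_ae (Eventually.of_forall fun x => ?_)
    simp only []
    ring
  have e2 := halfFourier_comp_mul (fun x : ℝ => f₁ x + x * f₂ x) hs τ
  rw [← e2, halfFourier]
  refine key.congr_of_eventuallyEq ?_
  filter_upwards [Ioi_mem_nhds hs] with r hr
  exact (e1 r hr).symm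

lemma hasDerivAt_waveletKernel (h : WeightedDerivBounds f f₁ f₂ f₃ C) (hf : Continuous f)
    (h0 : f 0 = 0) {s τ : ℝ} (hs : 0 < s) (hτ : τ ≠ 0) :
    HasDerivAt (fun s => waveletKernel f s τ)
      (waveletKernelDeriv (fun x => f₁ x + x * f₂ x) s τ) s := by
  have h1 := (h.hasDerivAt_halfFourier_div hs τ).const_mul (Complex.I / τ)
  have h2 := (Complex.conjCLE.toContinuousLinearMap.hasFDerivAt.comp_hasDerivAt s h1).const_mul
    (((2 * Real.pi : ℝ) : ℂ)⁻¹)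
  refine h2.congr_of_eventuallyEq ?_
  filter_upwards [Ioi_mem_nhds hs] with r hr
  rw [waveletKernel, h.halfFourier_eq hf h0 hr hτ]
  rfl

end WeightedDerivBounds

lemma norm_inv_two_pi_le : ‖((2 * Real.pi : ℝ) : ℂ)⁻¹‖ ≤ 1 := by
  rw [norm_inv, Complex.norm_real, Real.norm_of_nonneg (by positivity)]
  exact inv_le_one_of_one_le₀ (by linarith [Real.pi_gt_three])

namespace HalfLineSymbol

variable {g g' : ℝ → ℂ} {C : ℝ}

/-- The factor 1/|τ| multiplies the bounds |τ|^(1/2) and |τ|^(-1/3) for the half-line integral. The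
resulting exponents -1/2 and -4/3 are integrable at 0 and at infinity respectively. -/
lemma norm_waveletKernelDeriv_le (h : HalfLineSymbol g g' C)
    (h0 : ∫ x in Ioi (0 : ℝ), g x = 0) {c d : ℝ} (hc : 0 < c) :
    ∃ B, 0 ≤ B ∧ ∀ s ∈ Icc c d, ∀ τ ≠ 0,
      ‖waveletKernelDeriv g s τ‖ ≤ B * powerMajorant (1 / 2) (4 / 3) |τ| := by
  obtain ⟨D, hD, hDt⟩ := h.norm_halfFourier_le_sqrt h0
  have hC := h.nonneg
  refine ⟨c⁻¹ * (D * √c⁻¹) + c⁻¹ * (4 * C * |d| ^ (1 / 3 : ℝ)), by positivity, fun s hs τ hτ => ?_⟩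
  have hs0 : 0 < s := hc.trans_le hs.1
  have hτ0 : 0 < |τ| := abs_pos.2 hτ
  have hn : ‖waveletKernelDeriv g s τ‖ ≤ |τ|⁻¹ * (c⁻¹ * ‖halfFourier g (τ / s)‖) := by
    rw [waveletKernelDeriv, norm_mul]
    refine (mul_le_of_le_one_left (norm_nonneg _) norm_inv_two_pi_le).trans ?_
    rw [RCLike.norm_conj, norm_mul, norm_mul, norm_div, Complex.norm_I, norm_inv, Complex.norm_real,
      Complex.norm_real, Real.norm_of_nonneg hs0.le, Real.norm_eq_abs, one_div]
    gcongr
    exact hs.1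
  refine hn.trans ?_
  have hpm := powerMajorant_nonneg (1 / 2) (4 / 3) hτ0.le
  rw [add_mul]
  by_cases h1 : |τ| ≤ 1
  · refine le_add_of_le_of_nonneg ?_ (by positivity)
    rw [powerMajorant, if_pos h1]
    have h2 : √|τ / s| ≤ √c⁻¹ * √|τ| := by
      rw [← Real.sqrt_mul (by positivity), abs_div, abs_of_pos hs0, div_eq_inv_mul]
      gcongr
      exact hs.1
    have h3 : |τ|⁻¹ * √|τ| = |τ| ^ (-(1 / 2) : ℝ) := by
      rw [Real.sqrt_eq_rpow, ← Real.rpow_neg_one, ← Real.rpow_add hτ0]; norm_num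
    calc _ ≤ |τ|⁻¹ * (c⁻¹ * (D * (√c⁻¹ * √|τ|))) := by
          gcongr
          exact (hDt _).trans (by gcongr)
      _ = c⁻¹ * (D * √c⁻¹) * (|τ|⁻¹ * √|τ|) := by ring
      _ = _ := by rw [h3]
  · refine le_add_of_nonneg_of_le (by positivity) ?_
    rw [powerMajorant, if_neg h1]
    have h2 : |τ / s| ^ (-(1 / 3) : ℝ) ≤ |d| ^ (1 / 3 : ℝ) * |τ| ^ (-(1 / 3) : ℝ) := by
      rw [abs_div, abs_of_pos hs0, Real.div_rpow hτ0.le hs0.le, Real.rpow_neg hs0.le, div_inv_eq_mul,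
        mul_comm]
      gcongr
      exact hs.2.trans (le_abs_self d)
    have h3 : |τ|⁻¹ * |τ| ^ (-(1 / 3) : ℝ) = |τ| ^ (-(4 / 3) : ℝ) := by
      rw [← Real.rpow_neg_one, ← Real.rpow_add hτ0]; norm_num
    calc _ ≤ |τ|⁻¹ * (c⁻¹ * (4 * C * (|d| ^ (1 / 3 : ℝ) * |τ| ^ (-(1 / 3) : ℝ)))) := by
          gcongr
          exact (h.norm_halfFourier_le_rpow (div_ne_zero hτ hs0.ne')).trans (by gcongr)
      _ = c⁻¹ * (4 * C * |d| ^ (1 / 3 : ℝ)) * (|τ|⁻¹ * |τ| ^ (-(1 / 3) : ℝ)) := by ring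
      _ = _ := by rw [h3]

lemma continuousOn_waveletKernelDeriv (h : HalfLineSymbol g g' C) (τ : ℝ) :
    ContinuousOn (fun s => waveletKernelDeriv g s τ) (Ioi 0) := by
  have hc := continuous_halfFourier h.integrableOn
  intro s hs
  have hs' : (s : ℂ) ≠ 0 := by exact_mod_cast (ne_of_gt hs)
  have hs'' : s ≠ 0 := ne_of_gt hs
  refine ContinuousAt.continuousWithinAt ?_
  refine continuousAt_const.mul (Complex.continuous_conj.continuousAt.comp ?_)
  refine continuousAt_const.mul (ContinuousAt.mul ?_ ?_)
  · exact Complex.continuous_ofReal.continuousAt.inv₀ hs'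
  · exact hc.continuousAt.comp (continuousAt_const.div continuousAt_id hs'')

lemma measurable_waveletKernelDeriv (h : HalfLineSymbol g g' C) (s : ℝ) :
    Measurable (waveletKernelDeriv g s) := by
  have hc := (continuous_halfFourier h.integrableOn).measurable
  have h2 : Measurable fun τ : ℝ => halfFourier g (τ / s) := hc.comp (measurable_id.div_const s)
  refine (Complex.continuous_conj.measurable.comp ?_).const_mul _
  exact ((Complex.measurable_ofReal.const_div _)).mul (h2.const_mul _)

end HalfLineSymbol

/-! ### The wavelet kernel and its derivative in the scale -/

lemma IsAnalyticWavelet.ae_waveletKernel_eq {ψ : ℝ → ℂ} (hψ : IsAnalyticWavelet ψ)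
    (hf : IntegrableOn (fourierHat ψ) (Ioi 0)) {s : ℝ} (hs : 0 < s) :
    ∀ᵐ τ : ℝ, ((1 / s : ℝ) : ℂ) * (starRingEnd ℂ) (ψ (τ / s)) =
      waveletKernel (fourierHat ψ) s τ := by
  filter_upwards [ae_comp_div (hψ.ae_eq_halfFourier hf) hs] with τ hτ
  rw [hτ, waveletKernel, map_mul, map_mul, map_inv₀, map_inv₀, Complex.conj_ofReal,
    Complex.conj_ofReal, one_div, Complex.ofReal_inv]
  ring

lemma IsAnalyticWavelet.integrable_waveletKernel {ψ : ℝ → ℂ} (hψ : IsAnalyticWavelet ψ)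
    (hf : IntegrableOn (fourierHat ψ) (Ioi 0)) {s : ℝ} (hs : 0 < s) :
    Integrable (waveletKernel (fourierHat ψ) s) := by
  refine Integrable.congr ?_ (hψ.ae_waveletKernel_eq hf hs)
  refine Integrable.const_mul ?_ _
  exact Complex.conjCLE.toContinuousLinearMap.integrable_comp (hψ.integrable.comp_div hs.ne')

lemma IsAnalyticWavelet.kernelHat_waveletKernel {ψ : ℝ → ℂ} (hψ : IsAnalyticWavelet ψ)
    (hf : IntegrableOn (fourierHat ψ) (Ioi 0)) {s : ℝ} (hs : 0 < s) (l : ℝ) :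
    kernelHat (waveletKernel (fourierHat ψ) s) l = (starRingEnd ℂ) (fourierHat ψ (s * l)) := by
  have hs' : (s : ℂ) ≠ 0 := by exact_mod_cast hs.ne'
  have h1 := Measure.integral_comp_div (fun x : ℝ =>
    Complex.exp (Complex.I * x * (s * l : ℝ)) * (starRingEnd ℂ) (ψ x)) s
  rw [abs_of_pos hs, Complex.real_smul] at h1
  have h2 : (starRingEnd ℂ) (fourierHat ψ (s * l)) =
      ∫ x : ℝ, Complex.exp (Complex.I * x * (s * l : ℝ)) * (starRingEnd ℂ) (ψ x) := by
    rw [fourierHat, ← integral_conj]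
    refine integral_congr_ae (Eventually.of_forall fun x => ?_)
    simp only [map_mul, ← Complex.exp_conj, map_neg, Complex.conj_I, Complex.conj_ofReal, neg_mul,
      neg_neg]
  rw [← h2] at h1
  have h3 : (starRingEnd ℂ) (fourierHat ψ (s * l)) = (s : ℂ)⁻¹ *
      ∫ x : ℝ, Complex.exp (Complex.I * (x / s : ℝ) * (s * l : ℝ)) *
        (starRingEnd ℂ) (ψ (x / s)) := by
    rw [h1, inv_mul_cancel_left₀ hs']
  rw [h3, kernelHat, ← integral_const_mul]
  refine integral_congr_ae ?_
  filter_upwards [hψ.ae_waveletKernel_eq hf hs] with τ hτ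
  rw [← hτ, one_div, Complex.ofReal_inv]
  have h4 : Complex.I * (τ / s : ℝ) * (s * l : ℝ) = Complex.I * τ * l := by
    push_cast; field_simp
  rw [h4]
  ring

/-- Integrable majorants of the kernels `waveletKernel f s` and `waveletKernelDeriv g s`,
uniform for scales `s ∈ [c, d]`. -/
structure KernelMajorants (f g : ℝ → ℂ) (c d : ℝ) (K K₁ : ℝ → ℝ) : Prop where
  integrable : Integrable K
  integrable_deriv : Integrable K₁
  norm_le : ∀ τ ≠ 0, ∀ s ∈ Icc c d, ‖waveletKernel f s τ‖ ≤ K τ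
  norm_deriv_le : ∀ τ ≠ 0, ∀ s ∈ Icc c d, ‖waveletKernelDeriv g s τ‖ ≤ K₁ τ
  hasDerivAt : ∀ τ ≠ 0, ∀ s ∈ Icc c d,
    HasDerivAt (fun s => waveletKernel f s τ) (waveletKernelDeriv g s τ) s

/-- The derivative kernel has an explicit integrable majorant. The mean value inequality in s
transfers it to the kernel, starting from scale c, where integrability of ψ suffices without
pointwise decay. -/
lemma IsAnalyticWavelet.exists_kernelMajorants {ψ f₁ f₂ f₃ : ℝ → ℂ} {C : ℝ}
    (hψ : IsAnalyticWavelet ψ) (h : WeightedDerivBounds (fourierHat ψ) f₁ f₂ f₃ C) {c d : ℝ}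
    (hc : 0 < c) (hcd : c ≤ d) :
    ∃ K K₁, KernelMajorants (fourierHat ψ) (fun x => f₁ x + x * f₂ x) c d K K₁ := by
  have hf := continuous_fourierHat hψ.integrable
  obtain ⟨B, hB, hBs⟩ := h.halfLineSymbol.norm_waveletKernelDeriv_le h.integral_symbol (d := d) hc
  have hK₁ : Integrable fun τ : ℝ => B * powerMajorant (1 / 2) (4 / 3) |τ| :=
    (integrable_powerMajorant_abs (by norm_num) (by norm_num)).const_mul B
  have hder : ∀ τ ≠ 0, ∀ s ∈ Icc c d, HasDerivAt (fun s => waveletKernel (fourierHat ψ) s τ)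
      (waveletKernelDeriv (fun x => f₁ x + x * f₂ x) s τ) s := fun τ hτ s hs =>
    h.hasDerivAt_waveletKernel hf (hψ.analytic 0 le_rfl) (hc.trans_le hs.1) hτ
  refine ⟨fun τ => ‖waveletKernel (fourierHat ψ) c τ‖ +
    B * powerMajorant (1 / 2) (4 / 3) |τ| * (d - c), fun τ => B * powerMajorant (1 / 2) (4 / 3) |τ|,
    ?_, hK₁, ?_, ?_, hder⟩
  · exact (hψ.integrable_waveletKernel (h.integrableOn_zero hf) hc).norm.add (hK₁.mul_const _)
  · intro τ hτ s hs
    have h1 := (convex_Icc c d).norm_image_sub_le_of_norm_hasDerivWithin_le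
      (fun r hr => (hder τ hτ r hr).hasDerivWithinAt) (fun r hr => hBs r hr τ hτ)
      (left_mem_Icc.2 hcd) hs
    have h2 : ‖s - c‖ ≤ d - c := by
      rw [Real.norm_of_nonneg (by linarith [hs.1])]; linarith [hs.2]
    have h3 := mul_le_mul_of_nonneg_left h2
      (mul_nonneg hB (powerMajorant_nonneg (1 / 2) (4 / 3) (abs_nonneg τ)))
    have h4 := norm_sub_norm_le (waveletKernel (fourierHat ψ) s τ) (waveletKernel (fourierHat ψ) c τ)
    linarith
  · exact fun τ hτ s hs => hBs s hs τ hτ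

lemma ae_ne_zero : ∀ᵐ τ : ℝ, τ ≠ 0 := by
  simp [ae_iff]

namespace KernelMajorants

variable {f g : ℝ → ℂ} {c d : ℝ} {K K₁ : ℝ → ℝ}

lemma integrable_mul (h : KernelMajorants f g c d K K₁) {φ : ℝ → ℂ}
    (hφ : AEStronglyMeasurable φ) (hφK : Integrable fun τ => φ τ * (K τ : ℂ)) {s : ℝ}
    (hs : s ∈ Icc c d) (hm : AEStronglyMeasurable (waveletKernel f s)) :
    Integrable fun τ => φ τ * waveletKernel f s τ := by
  refine hφK.mono (hφ.mul hm) ?_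
  filter_upwards [ae_ne_zero] with τ hτ
  rw [norm_mul, norm_mul, Complex.norm_real]
  gcongr
  exact (h.norm_le τ hτ s hs).trans (le_abs_self _)

lemma hasDerivAt_integral_mul (h : KernelMajorants f g c d K K₁) {φ : ℝ → ℂ}
    (hφ : AEStronglyMeasurable φ) (hφK : Integrable fun τ => φ τ * (K τ : ℂ))
    (hφK₁ : Integrable fun τ => φ τ * (K₁ τ : ℂ))
    (hm : ∀ s ∈ Ioo c d, AEStronglyMeasurable (waveletKernel f s))
    (hm' : ∀ s ∈ Ioo c d, AEStronglyMeasurable (waveletKernelDeriv g s)) {s : ℝ}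
    (hs : s ∈ Ioo c d) :
    HasDerivAt (fun s => ∫ τ, φ τ * waveletKernel f s τ) (∫ τ, φ τ * waveletKernelDeriv g s τ) s :=
  (hasDerivAt_integral_of_dominated_loc_of_deriv_le (μ := volume)
    (F := fun s τ => φ τ * waveletKernel f s τ) (F' := fun s τ => φ τ * waveletKernelDeriv g s τ)
    (bound := fun τ => ‖φ τ * (K₁ τ : ℂ)‖) (isOpen_Ioo.mem_nhds hs)
    (by
      filter_upwards [isOpen_Ioo.mem_nhds hs] with r hr
      exact hφ.mul (hm r hr))
    (h.integrable_mul hφ hφK (Ioo_subset_Icc_self hs) (hm s hs)) (hφ.mul (hm' s hs))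
    (by
      filter_upwards [ae_ne_zero] with τ hτ r hr
      rw [norm_mul, norm_mul, Complex.norm_real]
      gcongr
      exact (h.norm_deriv_le τ hτ r (Ioo_subset_Icc_self hr)).trans (le_abs_self _))
    hφK₁.norm
    (by
      filter_upwards [ae_ne_zero] with τ hτ r hr
      exact (h.hasDerivAt τ hτ r (Ioo_subset_Icc_self hr)).const_mul _)).2

end KernelMajorants

/-- Both sides are the scale derivative of conj ψ̂(sl), once under the integral and once by the
chain rule. For l ≤ 0 this function vanishes for all s > 0, so no derivative of ψ̂ outside (0,∞)
enters. -/
lemma IsAnalyticWavelet.kernelHat_waveletKernelDeriv {ψ f₁ f₂ f₃ : ℝ → ℂ} {C : ℝ}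
    (hψ : IsAnalyticWavelet ψ) (h : WeightedDerivBounds (fourierHat ψ) f₁ f₂ f₃ C)
    {s : ℝ} (hs : 0 < s) (l : ℝ) :
    kernelHat (waveletKernelDeriv (fun x => f₁ x + x * f₂ x) s) l =
      if 0 < l then (starRingEnd ℂ) ((l : ℂ) * f₁ (s * l)) else 0 := by
  have hf := continuous_fourierHat hψ.integrable
  have hfi := h.integrableOn_zero hf
  obtain ⟨K, K₁, hK⟩ := hψ.exists_kernelMajorants h (c := s / 2) (d := 2 * s) (by linarith)
    (by linarith)
  have hexp : ∀ {k : ℝ → ℝ}, Integrable k →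
      Integrable fun τ : ℝ => Complex.exp (Complex.I * τ * l) * (k τ : ℂ) := fun {k} hk => by
    refine hk.ofReal.bdd_mul (c := 1) (by fun_prop) (Eventually.of_forall fun τ => ?_)
    rw [norm_exp_I_mul_mul]
  have h1 := hK.hasDerivAt_integral_mul (s := s)
    (φ := fun τ : ℝ => Complex.exp (Complex.I * τ * l)) (by fun_prop)
    (hexp hK.integrable) (hexp hK.integrable_deriv)
    (fun r hr => (hψ.integrable_waveletKernel hfi (by linarith [hr.1])).1)
    (fun r _ => (h.halfLineSymbol.measurable_waveletKernelDeriv r).aestronglyMeasurable)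
    ⟨by linarith, by linarith⟩
  have h2 : HasDerivAt (fun s : ℝ => (starRingEnd ℂ) (fourierHat ψ (s * l)))
      (kernelHat (waveletKernelDeriv (fun x => f₁ x + x * f₂ x) s) l) s := by
    refine h1.congr_of_eventuallyEq ?_
    filter_upwards [Ioi_mem_nhds hs] with r hr
    exact (hψ.kernelHat_waveletKernel hfi hr l).symm
  refine h2.unique ?_
  split_ifs with hl
  · have h3 : HasDerivAt (fun r : ℝ => fourierHat ψ (r * l)) ((l : ℂ) * f₁ (s * l)) s := by
      have := (h.hasDerivAt_zero (s * l) (by positivity)).scomp s ((hasDerivAt_id s).mul_const l)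
      rw [one_mul, Complex.real_smul] at this
      exact this
    exact Complex.conjCLE.toContinuousLinearMap.hasFDerivAt.comp_hasDerivAt s h3
  · refine (hasDerivAt_const s (0 : ℂ)).congr_of_eventuallyEq ?_
    filter_upwards [Ioi_mem_nhds hs] with r hr
    have hr : 0 < r := hr
    rw [hψ.analytic _ (mul_nonpos_of_nonneg_of_nonpos hr.le (not_lt.1 hl)), map_zero]

lemma integrableOn_norm_kernelHat_sq_mul {κ : ℝ → ℂ} (hκ : Integrable κ) {p : ℝ → ℝ}
    (hp : Integrable p) : IntegrableOn (fun l => ‖kernelHat κ l‖ ^ 2 * p l) (Ioi 0) := by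
  refine Integrable.bdd_mul (c := (∫ τ, ‖κ τ‖) ^ 2) hp.integrableOn
    ((continuous_kernelHat hκ).norm.pow 2).aestronglyMeasurable (Eventually.of_forall fun l => ?_)
  rw [norm_pow, norm_norm]
  gcongr
  exact norm_kernelHat_le κ l

/-! ### The wavelet transform of the noise -/

variable {Ω : Type*} {Φ : ℝ → Ω → ℝ} {ψ : ℝ → ℂ}

lemma IsAnalyticWavelet.ae_integrand_eq (hψ : IsAnalyticWavelet ψ)
    (hf : IntegrableOn (fourierHat ψ) (Ioi 0)) {s : ℝ} (hs : 0 < s) (ω : Ω) :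
    integrand ψ (path Φ ω) 0 s =ᵐ[volume]
      fun τ => (Φ τ ω : ℂ) * waveletKernel (fourierHat ψ) s τ := by
  filter_upwards [hψ.ae_waveletKernel_eq hf hs] with τ hτ
  rw [integrand, path, sub_zero, mul_assoc, hτ]

lemma IsAnalyticWavelet.W_eq (hψ : IsAnalyticWavelet ψ)
    (hf : IntegrableOn (fourierHat ψ) (Ioi 0)) {s : ℝ} (hs : 0 < s) (ω : Ω) :
    W ψ Φ 0 s ω = ∫ τ, (Φ τ ω : ℂ) * waveletKernel (fourierHat ψ) s τ :=
  integral_congr_ae (hψ.ae_integrand_eq hf hs ω)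

/-- One null set serves all scales, since it depends only on the two majorants, which are uniform in
s. -/
lemma IsStationaryGaussianNoise.ae_integrable_and_hasDerivAt [MeasurableSpace Ω] {P : Measure Ω}
    {p : ℝ → ℝ} [IsProbabilityMeasure P]
    (hΦ : IsStationaryGaussianNoise P Φ p) (hψ : IsAnalyticWavelet ψ) {f₁ f₂ f₃ : ℝ → ℂ} {C : ℝ}
    (h : WeightedDerivBounds (fourierHat ψ) f₁ f₂ f₃ C) {c d : ℝ} (hc : 0 < c) (hcd : c ≤ d) :
    ∀ᵐ ω ∂P, ∀ s ∈ Ioo c d, Integrable (integrand ψ (path Φ ω) 0 s) ∧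
      HasDerivAt (fun r => W ψ Φ 0 r ω)
        (∫ τ, (Φ τ ω : ℂ) * waveletKernelDeriv (fun x => f₁ x + x * f₂ x) s τ) s := by
  have hfi := h.integrableOn_zero (continuous_fourierHat hψ.integrable)
  obtain ⟨K, K₁, hK⟩ := hψ.exists_kernelMajorants h hc hcd
  filter_upwards [hΦ.ae_integrable hK.integrable.ofReal, hΦ.ae_integrable hK.integrable_deriv.ofReal]
    with ω h0 h1 s hs
  have hm : AEStronglyMeasurable fun τ => (Φ τ ω : ℂ) :=
    (Complex.measurable_ofReal.comp
      (hΦ.measurable.comp (measurable_id.prodMk measurable_const))).aestronglyMeasurable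
  have hκm : ∀ r ∈ Ioo c d, AEStronglyMeasurable (waveletKernel (fourierHat ψ) r) := fun r hr =>
    (hψ.integrable_waveletKernel hfi (hc.trans hr.1)).1
  refine ⟨?_, ?_⟩
  · exact (hK.integrable_mul hm h0 (Ioo_subset_Icc_self hs) (hκm s hs)).congr
      (hψ.ae_integrand_eq hfi (hc.trans hs.1) ω).symm
  · refine (hK.hasDerivAt_integral_mul hm h0 h1 hκm
      (fun r _ => (h.halfLineSymbol.measurable_waveletKernelDeriv r).aestronglyMeasurable)
      hs).congr_of_eventuallyEq ?_
    filter_upwards [isOpen_Ioo.mem_nhds hs] with r hr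
    exact hψ.W_eq hfi (hc.trans hr.1) ω

end AWT

end



/-! ### The theorem for the transform and for its scale derivative -/

theorem mainTheorem5 {Ω : Type*} [MeasurableSpace Ω] (P : Measure Ω) [IsProbabilityMeasure P]
    (Φ : ℝ → Ω → ℝ) (p : ℝ → ℝ) (ψ : ℝ → ℂ)
    (hΦ : AWT.IsStationaryGaussianNoise P Φ p)
    (hp : AWT.SpectralDensityCondition p)
    (hψ : AWT.IsAnalyticWavelet ψ)
    (hψreg : AWT.FourierSideRegularity (AWT.fourierHat ψ))
    (a b : ℝ) (ha : 0 < a) (hab : a ≤ b)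
    (w : ℝ → ℝ) (hw : ContinuousOn w (Icc a b)) (hw0 : ∀ s ∈ Icc a b, 0 ≤ w s) :
    -- the transform and its scale derivative exist along almost every sample path
    (∀ᵐ ω ∂P, ∀ s ∈ Icc a b,
      Integrable (AWT.integrand ψ (AWT.path Φ ω) 0 s) ∧
      DifferentiableAt ℝ (fun r : ℝ => AWT.W ψ Φ 0 r ω) s) ∧
    -- first case
    ((∀ s ∈ Icc a b,
        IntegrableOn (fun l : ℝ => ‖AWT.fourierHat ψ (s * l)‖ ^ 2 * p l) (Ioi 0)) ∧
      AWT.BorellTIS P a b w (AWT.W ψ Φ 0) (AWT.spectralEnergy ψ p)) ∧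
    -- second case
    ((∀ s ∈ Icc a b,
        IntegrableOn (fun l : ℝ => ‖(l : ℂ) * deriv (AWT.fourierHat ψ) (s * l)‖ ^ 2 * p l)
          (Ioi 0)) ∧
      AWT.BorellTIS P a b w (AWT.dW ψ Φ 0) (AWT.spectralEnergyDeriv ψ p)) := by
  obtain ⟨C, hC⟩ := hψreg.weightedDerivBounds
  set g : ℝ → ℂ := fun x => deriv (AWT.fourierHat ψ) x +
    x * iteratedDeriv 2 (AWT.fourierHat ψ) x
  have hfi := hC.integrableOn_zero (AWT.continuous_fourierHat hψ.integrable)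
  have hpos : ∀ s ∈ Icc a b, 0 < s := fun s hs => ha.trans_le hs.1
  -- An open interval around [a,b] makes the derivative two-sided at the endpoints, also when a = b.
  have hsub : ∀ s ∈ Icc a b, s ∈ Ioo (a / 2) (2 * b) := fun s hs =>
    ⟨by linarith [hs.1], by linarith [hs.2, hpos s hs]⟩
  have hae := hΦ.ae_integrable_and_hasDerivAt hψ hC (c := a / 2) (d := 2 * b) (by linarith)
    (by linarith)
  obtain ⟨K, K₁, hK⟩ := hψ.exists_kernelMajorants hC ha hab
  have hκi : ∀ s ∈ Icc a b, Integrable (AWT.waveletKernel (AWT.fourierHat ψ) s) := fun s hs =>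
    hψ.integrable_waveletKernel hfi (hpos s hs)
  have hκm' : ∀ s, AEStronglyMeasurable (AWT.waveletKernelDeriv g s) := fun s =>
    (hC.halfLineSymbol.measurable_waveletKernelDeriv s).aestronglyMeasurable
  have hκi' : ∀ s ∈ Icc a b, Integrable (AWT.waveletKernelDeriv g s) := fun s hs =>
    hK.integrable_deriv.mono' (hκm' s) (AWT.ae_ne_zero.mono fun τ hτ => hK.norm_deriv_le τ hτ s hs)
  have hhat : ∀ s ∈ Icc a b, ∀ l, ‖AWT.kernelHat (AWT.waveletKernel (AWT.fourierHat ψ) s) l‖ =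
      ‖AWT.fourierHat ψ (s * l)‖ := fun s hs l => by
    rw [hψ.kernelHat_waveletKernel hfi (hpos s hs), RCLike.norm_conj]
  have hhat' : ∀ s ∈ Icc a b, ∀ l ∈ Ioi (0 : ℝ), ‖AWT.kernelHat (AWT.waveletKernelDeriv g s) l‖ =
      ‖(l : ℂ) * deriv (AWT.fourierHat ψ) (s * l)‖ := fun s hs l hl => by
    rw [hψ.kernelHat_waveletKernelDeriv hC (hpos s hs), if_pos (mem_Ioi.1 hl), RCLike.norm_conj]
  refine ⟨?_, ⟨?_, ?_⟩, ?_, ?_⟩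
  · filter_upwards [hae] with ω hω s hs
    exact ⟨(hω s (hsub s hs)).1, (hω s (hsub s hs)).2.differentiableAt⟩
  · intro s hs
    simpa only [hhat s hs] using
      AWT.integrableOn_norm_kernelHat_sq_mul (hκi s hs) hΦ.density_integrable
  · refine hΦ.borellTIS_of_kernel hab hw hw0 (κ := AWT.waveletKernel (AWT.fourierHat ψ))
      hK.integrable (fun s hs => (hκi s hs).1) (AWT.ae_ne_zero.mono hK.norm_le)
      (AWT.ae_ne_zero.mono fun τ hτ s hs =>
        (hK.hasDerivAt τ hτ s hs).continuousAt.continuousWithinAt) ?_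
      (Eventually.of_forall fun ω s hs => hψ.W_eq hfi (hpos s hs) ω) ?_
    · intro s hs l hl
      rw [hψ.kernelHat_waveletKernel hfi (hpos s hs),
        hψ.analytic _ (mul_nonpos_of_nonneg_of_nonpos (hpos s hs).le hl), map_zero]
    · intro s hs
      simp only [AWT.spectralEnergy, hhat s hs]
  · intro s hs
    refine (AWT.integrableOn_norm_kernelHat_sq_mul (hκi' s hs) hΦ.density_integrable).congr_fun
      (fun l hl => ?_) measurableSet_Ioi
    simp only [hhat' s hs l hl]
  · refine hΦ.borellTIS_of_kernel hab hw hw0 (κ := AWT.waveletKernelDeriv g)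
      hK.integrable_deriv (fun s _ => hκm' s) (AWT.ae_ne_zero.mono hK.norm_deriv_le)
      (Eventually.of_forall fun τ =>
        (hC.halfLineSymbol.continuousOn_waveletKernelDeriv τ).mono hpos) ?_ ?_ ?_
    · intro s hs l hl
      rw [hψ.kernelHat_waveletKernelDeriv hC (hpos s hs), if_neg (not_lt.2 hl)]
    · filter_upwards [hae] with ω hω s hs
      exact (hω s (hsub s hs)).2.deriv
    · intro s hs
      refine setIntegral_congr_fun measurableSet_Ioi fun l hl => ?_
      simp only [hhat' s hs l hl]
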